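/- Let $G=(V,E)$ be a finite loopless graph (parallel edges allowed). A weighted Holant instance $\Omega$ on $G$ consists of a symmetric function $F_v=[f_0,\dots,f_{d_v}]$ with nonnegative real values at every vertex $v$, where $d_v$ is the degree of $v$ and $f_j$ is the value of $F_v$ on inputs of Hamming weight $j$, and of a real weight $\lambda_e$ for every edge $e$. With $E(v)$ the set of edges incident with $v$, its partition function is $$Z(\Omega)=\sum_{\sigma:E\to\{0,1\}}\ \prod_{e\in E}\lambda_e^{\sigma(e)}\prod_{v\in V}F_v(\sigma|_{E(v)}).$$ For $p>0$ let $\mathcal F_{1.17,+\infty}^{p}$ be the set of all symmetric functions $[f_0,\dots,f_d]$, $d\ge 0$, with nonnegative real values for which there is a real $c\ge 1.17$ (which may differ from function to function) with $f_{i+2}=c f_{i+1}+f_i$ for $0\le i\le d-2$, and $f_{i+1}\ge p f_i$ for $0\le i\le d-1$. Let $\Lambda_{1,+\infty}=[1,\infty)$. The problem $\mathrm{Holant}(\mathcal F_{1.17,+\infty}^{p},\Lambda_{1,+\infty})$ is to compute $Z(\Omega)$ for instances $\Omega$ with all $F_v\in\mathcal F_{1.17,+\infty}^{p}$ and all $\lambda_e\in\Lambda_{1,+\infty}$.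 **Theorem.** For every $p>0$ there is an FPTAS for $\mathrm{Holant}(\mathcal F_{1.17,+\infty}^{p},\Lambda_{1,+\infty})$: there is a deterministic algorithm (depending on $p$ only) that, given an instance $\Omega$ of the problem and $\varepsilon>0$, returns a number $Z'$ with $$(1-\varepsilon)Z(\Omega)<Z'<(1+\varepsilon)Z(\Omega)$$ if $Z(\Omega)\neq 0$, and $Z'=0$ if $Z(\Omega)=0$, in time polynomial in the size of the input and in $1/\varepsilon$. Here the algorithm is a program with rational constants that uses on numbers only the four field operations and comparisons. The same program satisfies the time bound in both of the following senses: for real instances with arithmetic at unit cost, where the size of the input is that of the graph, $|V|+|E|$ up to constant factors; and for rational instances and rational $\varepsilon$ with arithmetic charged by bit length, where the size of the input is its length in bits. -/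

import Mathlib

/-! ## Weighted Holant instances with symmetric vertex functions -/

/-- A symmetric function `[f₀, f₁, …, f_d]` of some arity `d`: `f_j` is its value on the inputs
of Hamming weight `j`. -/
abbrev SymFun (K : Type) : Type := Σ d : ℕ, (Fin (d + 1) → K)

/-- A finite graph on `n` vertices and `m` edges, without loops; parallel edges are allowed. -/
structure FinGraph where
  n : ℕ
  m : ℕ
  src : Fin m → Fin n
  tgt : Fin m → Fin n
  loopless : ∀ e, src e ≠ tgt e

namespace FinGraph

/-- The set `E(v)` of the edges incident with `v`. -/
def edgesAt (G : FinGraph) (v : Fin G.n) : Finset (Fin G.m) :=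
  Finset.univ.filter fun e => G.src e = v ∨ G.tgt e = v

def deg (G : FinGraph) (v : Fin G.n) : ℕ := (G.edgesAt v).card

/-- The Hamming weight of the restriction of the configuration `σ` to `E(v)`. -/
def weightAt (G : FinGraph) (v : Fin G.n) (σ : Fin G.m → Bool) : Fin (G.deg v + 1) :=
  ⟨((G.edgesAt v).filter fun e => σ e = true).card,
    Nat.lt_succ_of_le (Finset.card_filter_le _ _)⟩

end FinGraph

/-- A weighted Holant instance with numbers from `K`: a graph, at every vertex `v` a symmetric
function of arity `deg v`, and for every edge a weight `λ_e = λ_e(1)` (with `λ_e(0) = 1`). -/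
structure HolantInstance (K : Type) where
  G : FinGraph
  sig : (v : Fin G.n) → Fin (G.deg v + 1) → K
  lam : Fin G.m → K

namespace HolantInstance

def map {K L : Type} (φ : K → L) (Ω : HolantInstance K) : HolantInstance L where
  G := Ω.G
  sig v i := φ (Ω.sig v i)
  lam e := φ (Ω.lam e)

/-- The partition function `Z(Ω)`, the sum of the weights of all configurations. -/
def Z {K : Type} [CommSemiring K] (Ω : HolantInstance K) : K :=
  ∑ σ : Fin Ω.G.m → Bool,
    (∏ e, if σ e = true then Ω.lam e else 1) * ∏ v, Ω.sig v (Ω.G.weightAt v σ)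

/-- `Ω` is an input of the problem `Holant(𝓕, Λ)`. -/
def IsInputOf (Ω : HolantInstance ℝ) (𝓕 : Set (SymFun ℝ)) (Λ : Set ℝ) : Prop :=
  (∀ v, (⟨Ω.G.deg v, Ω.sig v⟩ : SymFun ℝ) ∈ 𝓕) ∧ ∀ e, Ω.lam e ∈ Λ

end HolantInstance

/-- `f_{i+2} = c f_{i+1} + f_i` for `0 ≤ i ≤ d - 2`. -/
def IsFibonacci (c : ℝ) (F : SymFun ℝ) : Prop :=
  ∀ i : ℕ, ∀ h : i + 2 ≤ F.1,
    F.2 ⟨i + 2, by omega⟩ = c * F.2 ⟨i + 1, by omega⟩ + F.2 ⟨i, by omega⟩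

/-- The family `𝓕_c^p`: nonnegative Fibonacci functions with parameter `c` and
`f_{i+1} ≥ p f_i` for `0 ≤ i ≤ d - 1`. -/
def fibonacciFamily (c p : ℝ) : Set (SymFun ℝ) :=
  {F | (∀ i, 0 ≤ F.2 i) ∧ IsFibonacci c F ∧
    ∀ i : Fin F.1, p * F.2 i.castSucc ≤ F.2 i.succ}

/-- The family `𝓕_{c₀, +∞}^p`, the union of the `𝓕_c^p` over `c ≥ c₀`. -/
def fibonacciFamilyFrom (c₀ p : ℝ) : Set (SymFun ℝ) :=
  ⋃ c ∈ Set.Ici c₀, fibonacciFamily c p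

/-! ## The model of computation

Programs of a first-order recursive language (a small Lisp) whose data are binary trees with
numbers at the leaves.  The numbers come from an ordered field `K`; a program can only apply the
four field operations to them and compare two of them.  A bit-length function `w : K → ℕ` gives
the price of arithmetic: every evaluation step costs `1`, and an arithmetic operation or a
comparison costs in addition the lengths of its two operands.  Trees are shared and not copied,
so that every step that is not arithmetic has constant cost on a random access machine. -/

/-- Data of programs. -/
inductive Val (K : Type) : Type
  | nil : Val K
  | num (a : K) : Val K
  | pair (a b : Val K) : Val K

inductive ArithOp : Type
  | add | sub | mul | div

/-- Expressions.  Variables are de Bruijn indices; the constants are rational, so no information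
can be hidden in them; `call f a` applies the `f`-th function of the program to `a`. -/
inductive Expr : Type
  | var (i : ℕ) : Expr
  | const (q : ℚ) : Expr
  | nil : Expr
  | pair (a b : Expr) : Expr
  | fst (a : Expr) : Expr
  | snd (a : Expr) : Expr
  | arith (o : ArithOp) (a b : Expr) : Expr
  | letIn (a b : Expr) : Expr
  | ifNil (a b c : Expr) : Expr
  | ifLt (a b c d : Expr) : Expr
  | call (f : ℕ) (a : Expr) : Expr

/-- A program is a finite list of function bodies, each with one argument, the variable `0`.
The functions may call each other; the first one is the main function. -/
abbrev Program : Type := List Expr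

/-- The result of an arithmetic operation; division by `0` has none. -/
def ArithOp.result {K : Type} [Field K] : ArithOp → K → K → K → Prop
  | .add, a, b, r => r = a + b
  | .sub, a, b, r => r = a - b
  | .mul, a, b, r => r = a * b
  | .div, a, b, r => b ≠ 0 ∧ r = a / b

/-- `Eval w P env e v t`: in the program `P` and the environment `env` the expression `e`
evaluates to `v`, at total cost `t`. -/
inductive Eval {K : Type} [Field K] [LinearOrder K] (w : K → ℕ) (P : Program) :
    List (Val K) → Expr → Val K → ℕ → Prop
  | var {env : List (Val K)} {i : ℕ} {v : Val K} (h : env[i]? = some v) :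
      Eval w P env (.var i) v 1
  | const {env : List (Val K)} {q : ℚ} :
      Eval w P env (.const q) (.num (q : K)) 1
  | nil {env : List (Val K)} :
      Eval w P env .nil .nil 1
  | pair {env : List (Val K)} {a b : Expr} {u v : Val K} {s t : ℕ}
      (ha : Eval w P env a u s) (hb : Eval w P env b v t) :
      Eval w P env (.pair a b) (.pair u v) (s + t + 1)
  | fst {env : List (Val K)} {a : Expr} {u v : Val K} {s : ℕ}
      (ha : Eval w P env a (.pair u v) s) :
      Eval w P env (.fst a) u (s + 1)
  | snd {env : List (Val K)} {a : Expr} {u v : Val K} {s : ℕ}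
      (ha : Eval w P env a (.pair u v) s) :
      Eval w P env (.snd a) v (s + 1)
  | arith {env : List (Val K)} {o : ArithOp} {a b : Expr} {x y r : K} {s t : ℕ}
      (ha : Eval w P env a (.num x) s) (hb : Eval w P env b (.num y) t)
      (hr : o.result x y r) :
      Eval w P env (.arith o a b) (.num r) (s + t + w x + w y + 1)
  | letIn {env : List (Val K)} {a b : Expr} {u v : Val K} {s t : ℕ}
      (ha : Eval w P env a u s) (hb : Eval w P (u :: env) b v t) :
      Eval w P env (.letIn a b) v (s + t + 1)
  | ifNil_pos {env : List (Val K)} {a b c : Expr} {v : Val K} {s t : ℕ}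
      (ha : Eval w P env a .nil s) (hb : Eval w P env b v t) :
      Eval w P env (.ifNil a b c) v (s + t + 1)
  | ifNil_neg {env : List (Val K)} {a b c : Expr} {u v : Val K} {s t : ℕ}
      (ha : Eval w P env a u s) (hu : u ≠ .nil) (hc : Eval w P env c v t) :
      Eval w P env (.ifNil a b c) v (s + t + 1)
  | ifLt_pos {env : List (Val K)} {a b c d : Expr} {x y : K} {v : Val K} {s t r : ℕ}
      (ha : Eval w P env a (.num x) s) (hb : Eval w P env b (.num y) t)
      (hxy : x < y) (hc : Eval w P env c v r) :
      Eval w P env (.ifLt a b c d) v (s + t + r + w x + w y + 1)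
  | ifLt_neg {env : List (Val K)} {a b c d : Expr} {x y : K} {v : Val K} {s t r : ℕ}
      (ha : Eval w P env a (.num x) s) (hb : Eval w P env b (.num y) t)
      (hxy : ¬ x < y) (hd : Eval w P env d v r) :
      Eval w P env (.ifLt a b c d) v (s + t + r + w x + w y + 1)
  | call {env : List (Val K)} {f : ℕ} {a body : Expr} {u v : Val K} {s t : ℕ}
      (ha : Eval w P env a u s) (hf : P[f]? = some body) (hb : Eval w P [u] body v t) :
      Eval w P env (.call f a) v (s + t + 1)

/-- Programs are deterministic: the value and the cost of an evaluation are unique. -/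
theorem Eval.deterministic {K : Type} [Field K] [LinearOrder K] {w : K → ℕ} {P : Program}
    {env : List (Val K)} {e : Expr} {v v' : Val K} {t t' : ℕ}
    (h : Eval w P env e v t) (h' : Eval w P env e v' t') : v = v' ∧ t = t' := by
  induction h generalizing v' t' with
  | var h => cases h' with | var h2 => simp_all
  | const => cases h'; simp
  | nil => cases h'; simp
  | pair _ _ iha ihb =>
    cases h' with
    | pair ha hb => obtain ⟨rfl, rfl⟩ := iha ha; obtain ⟨rfl, rfl⟩ := ihb hb; simp
  | fst _ iha =>
    cases h' with
    | fst ha => have := iha ha; simp_all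
  | snd _ iha =>
    cases h' with
    | snd ha => have := iha ha; simp_all
  | @arith _ o _ _ _ _ _ _ _ _ _ hr iha ihb =>
    cases h' with
    | arith ha hb hr2 =>
      have h1 := iha ha
      have h2 := ihb hb
      cases o <;> simp_all [ArithOp.result]
  | letIn _ _ iha ihb =>
    cases h' with
    | letIn ha hb => obtain ⟨rfl, rfl⟩ := iha ha; obtain ⟨rfl, rfl⟩ := ihb hb; simp
  | ifNil_pos _ _ iha ihb =>
    cases h' with
    | ifNil_pos ha hb => have := iha ha; have := ihb hb; simp_all
    | ifNil_neg ha hu _ => have := iha ha; simp_all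
  | ifNil_neg _ hu _ iha ihb =>
    cases h' with
    | ifNil_pos ha _ => have := iha ha; simp_all
    | ifNil_neg ha _ hb => have := iha ha; have := ihb hb; simp_all
  | ifLt_pos _ _ hxy _ iha ihb ihc =>
    cases h' with
    | ifLt_pos ha hb _ hc => have := iha ha; have := ihb hb; have := ihc hc; simp_all
    | ifLt_neg ha hb hn _ =>
      have h1 := iha ha
      have h2 := ihb hb
      simp only [Val.num.injEq] at h1 h2
      rw [h1.1, h2.1] at hxy
      exact absurd hxy hn
  | ifLt_neg _ _ hxy _ iha ihb ihc =>
    cases h' with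
    | ifLt_pos ha hb hn _ =>
      have h1 := iha ha
      have h2 := ihb hb
      simp only [Val.num.injEq] at h1 h2
      rw [h1.1, h2.1] at hxy
      exact absurd hn hxy
    | ifLt_neg ha hb _ hc => have := iha ha; have := ihb hb; have := ihc hc; simp_all
  | call _ hf _ iha ihb =>
    cases h' with
    | call ha hf2 hb =>
      obtain ⟨rfl, rfl⟩ := iha ha
      rw [hf] at hf2
      cases hf2
      obtain ⟨rfl, rfl⟩ := ihb hb
      simp

namespace Val

variable {K : Type}

/-- The size of a datum: the number of its nodes plus the lengths of all its numbers. -/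
def size (w : K → ℕ) : Val K → ℕ
  | nil => 1
  | num a => w a + 1
  | pair a b => a.size w + b.size w + 1

def ofList : List (Val K) → Val K
  | [] => nil
  | a :: l => pair a (ofList l)

end Val

/-- The input of a program: `ε`, the list of the vertex functions (each the list of its values
`f₀, …, f_d`), and the list of the edges (each with its two ends, given by their numbers
`0, …, n - 1`, and its weight). -/
def HolantInstance.encode {K : Type} [Field K] (Ω : HolantInstance K) (ε : K) : Val K :=
  .pair (.num ε) (.pair
    (Val.ofList (List.ofFn fun v => Val.ofList (List.ofFn fun i => .num (Ω.sig v i))))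
    (Val.ofList (List.ofFn fun e =>
      .pair (.num ((Ω.G.src e : ℕ) : K))
        (.pair (.num ((Ω.G.tgt e : ℕ) : K)) (.num (Ω.lam e))))))

/-! ## Fully polynomial-time approximation schemes -/

/-- `z` approximates the value `Z ≥ 0` with relative error less than `ε`
(for `Z = 0`, where the strict inequalities are void, `z` has to be exact). -/
def RelApprox (ε Z z : ℝ) : Prop :=
  (Z = 0 → z = 0) ∧ (Z ≠ 0 → (1 - ε) * Z < z ∧ z < (1 + ε) * Z)

/-- The program `P`, run with numbers from `K ⊆ ℝ` of lengths `w`, is an FPTAS for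
`Holant(𝓕, Λ)` on the instances with numbers from `K`. -/
def IsFPTAS (K : Type) [Field K] [LinearOrder K] [Algebra K ℝ] (w : K → ℕ) (P : Program)
    (𝓕 : Set (SymFun ℝ)) (Λ : Set ℝ) : Prop :=
  ∃ C : ℝ, ∃ k : ℕ, ∀ Ω : HolantInstance K, (Ω.map (algebraMap K ℝ)).IsInputOf 𝓕 Λ →
    ∀ ε : K, 0 < ε → ∃ z : K, ∃ t : ℕ,
      Eval w P [Ω.encode ε] (.call 0 (.var 0)) (.num z) t ∧
      RelApprox (algebraMap K ℝ ε) (Ω.map (algebraMap K ℝ)).Z (algebraMap K ℝ z) ∧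
      (t : ℝ) ≤ C * ((Ω.encode ε).size w + 1 / algebraMap K ℝ ε) ^ k

/-- The length of a rational number: the number of binary digits of numerator and
denominator. -/
def ratLength (q : ℚ) : ℕ := q.num.natAbs.size + q.den.size

/-- There is an FPTAS for `Holant(𝓕, Λ)`: one program that is an FPTAS for real instances, where
arithmetic has unit cost and the size of the input is that of the graph, and also for rational
instances, where arithmetic is charged by bit length and the size of the input is its length in
bits. -/
def HasFPTAS (𝓕 : Set (SymFun ℝ)) (Λ : Set ℝ) : Prop :=
  ∃ P : Program, IsFPTAS ℝ (fun _ => 0) P 𝓕 Λ ∧ IsFPTAS ℚ ratLength P 𝓕 Λ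

/-!
A Fibonacci function with parameter `c` is determined by its first two values, and giving the
value `1` to one of its inputs turns `[f₀, f₁]` into `[f₁, c f₁ + f₀]`.  For a dangling edge at a
vertex, the marginal ratio `Z(0) / Z(1)` is therefore an explicit function of three such ratios in
graphs with fewer edges (`ratioStep`), and `Z` is the weight of the all-ones configuration times a
product, over the edges, of factors that are expressed by two of these ratios each.

A ratio whose recursion has depth at least `2 P`, where the ratios `f₀ / f₁` are at most `P`, is at
most `1 / c₀`, because its reciprocal gains `1 / P` at every level until it exceeds `c₀`.  A ratio
of smaller depth is computed exactly.  As long as all ratios that are not exact are at most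
`1 / c₀`, a step of the recursion reduces logarithmic errors by the factor `decayRate < 1`.  Hence
truncation after logarithmically many levels determines `Z` up to the required relative error, and
the recursion tree, with three branches at each node, has polynomial size.

With bit lengths the cost is polynomial as well: the number computed at a node of the recursion
tree is built by a bounded number of operations per descendant, each of which adds at most
constantly many digits to the sum of the lengths of its operands.
-/

namespace FibonacciHolant

/-! ## Edge lists and the marginal recursion -/

section EdgeList

variable {V K : Type*}

/-- An edge of a graph on `V`, as its two ends (in either order) and its weight. -/
abbrev WeightedEdge (V K : Type*) : Type _ := V × V × K

variable [DecidableEq V]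

/-- Takes the first edge incident with `v` out of a list: the result consists of its other end,
its weight, and the list of the remaining edges. -/
def pickEdge (v : V) : List (WeightedEdge V K) → Option ((V × K) × List (WeightedEdge V K))
  | [] => none
  | (x, y, l) :: es =>
    if x = v then some ((y, l), es)
    else if y = v then some ((x, l), es)
    else (pickEdge v es).map fun r => (r.1, (x, y, l) :: r.2)

theorem pickEdge_eq_none_iff {v : V} {es : List (WeightedEdge V K)} :
    pickEdge v es = none ↔ ∀ e ∈ es, e.1 ≠ v ∧ e.2.1 ≠ v := by
  induction es with
  | nil => simp [pickEdge]
  | cons e es ih =>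
    obtain ⟨x, y, l⟩ := e
    rw [List.forall_mem_cons, ← ih, pickEdge]
    split_ifs <;> simp_all

theorem exists_append_of_pickEdge_eq_some {v u : V} {l : K} {es rest : List (WeightedEdge V K)}
    (h : pickEdge v es = some ((u, l), rest)) :
    ∃ pre suf, rest = pre ++ suf ∧
      (es = pre ++ (v, u, l) :: suf ∨ es = pre ++ (u, v, l) :: suf) := by
  induction es generalizing rest with
  | nil => simp [pickEdge] at h
  | cons e es ih =>
    obtain ⟨x, y, l'⟩ := e
    rw [pickEdge] at h
    split_ifs at h with hx hy
    · obtain ⟨⟨rfl, rfl⟩, rfl⟩ : (y = u ∧ l' = l) ∧ es = rest := by simpa using h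
      exact ⟨[], es, rfl, .inl (by rw [hx]; rfl)⟩
    · obtain ⟨⟨rfl, rfl⟩, rfl⟩ : (x = u ∧ l' = l) ∧ es = rest := by simpa using h
      exact ⟨[], es, rfl, .inr (by rw [hy]; rfl)⟩
    · obtain ⟨⟨⟨u', k⟩, rest'⟩, hes, heq⟩ := Option.map_eq_some_iff.1 h
      obtain ⟨⟨rfl, rfl⟩, rfl⟩ : (u' = u ∧ k = l) ∧ (x, y, l') :: rest' = rest := by simpa using heq
      obtain ⟨pre, suf, rfl, hsplit⟩ := ih hes
      exact ⟨(x, y, l') :: pre, suf, rfl, hsplit.imp (by rintro rfl; rfl) (by rintro rfl; rfl)⟩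

theorem length_of_pickEdge {v u : V} {l : K} {es rest : List (WeightedEdge V K)}
    (h : pickEdge v es = some ((u, l), rest)) : es.length = rest.length + 1 := by
  obtain ⟨pre, suf, rfl, rfl | rfl⟩ := exists_append_of_pickEdge_eq_some h <;>
    simp [Nat.add_assoc]

theorem forall_weight_of_pickEdge {p : K → Prop} {v u : V} {l : K}
    {es rest : List (WeightedEdge V K)} (h : pickEdge v es = some ((u, l), rest))
    (hp : ∀ e ∈ es, p e.2.2) : p l ∧ ∀ e ∈ rest, p e.2.2 := by
  obtain ⟨pre, suf, rfl, rfl | rfl⟩ := exists_append_of_pickEdge_eq_some h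
  all_goals
    rw [List.forall_mem_append, List.forall_mem_cons] at hp
    exact ⟨hp.2.1, List.forall_mem_append.2 ⟨hp.1, hp.2.2⟩⟩

theorem pickEdge_induction {motive : List (WeightedEdge V K) → Prop}
    (step : ∀ es, (∀ {v u : V} {l : K} {rest}, pickEdge v es = some ((u, l), rest) → motive rest) →
      motive es) (es : List (WeightedEdge V K)) : motive es :=
  (measure List.length).wf.induction es fun es ih => step es fun h => ih _ <| by
    simp [WellFoundedRelation.rel, InvImage, length_of_pickEdge h]

/-- Whether the recursion along `pickEdge`, started at the dangling edge of `v`, is deeper than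
`n`.  The third branch of the recursion is as deep as the second and is left out. -/
def isDeep : ℕ → List (WeightedEdge V K) → V → Bool
  | 0, es, v => (pickEdge v es).isSome
  | n + 1, es, v =>
    match pickEdge v es with
    | none => false
    | some ((u, _), rest) => isDeep n rest u || isDeep n rest v

variable [Field K]

/-- The quotients `f₀ / f₁` of the vertex functions after the value `1` has been given to an edge
at `u`, where `s` lists these quotients before and `c` the Fibonacci parameters. -/
def pin (c s : V → K) (u : V) : V → K := Function.update s u (1 / (c u + s u))

/-- The marginal ratio of a dangling edge at `v` after its next edge `vu` has been split: `a` is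
the ratio of `u` with `v` pinned, and `b₀`, `b₁` are the ratios of `v` with `u` free and pinned. -/
def ratioStep (l c a b₀ b₁ : K) : K := (1 + a / l * b₀) / (c + (a / l + b₁))

/-- The marginal ratio `Z(0) / Z(1)` of a dangling edge at `v`, by recursion on the edges. -/
def exactRatio (c s : V → K) (es : List (WeightedEdge V K)) (v : V) : K :=
  match h : pickEdge v es with
  | none => s v
  | some ((u, l), rest) =>
    ratioStep l (c v) (exactRatio c (pin c s v) rest u) (exactRatio c s rest v)
      (exactRatio c (pin c s u) rest v)
termination_by es.length
decreasing_by all_goals simp [length_of_pickEdge h]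

theorem exactRatio_of_pickEdge_eq_none (c s : V → K) {es : List (WeightedEdge V K)} {v : V}
    (h : pickEdge v es = none) : exactRatio c s es v = s v := by
  rw [exactRatio]
  split <;> simp_all

theorem exactRatio_of_pickEdge_eq_some (c s : V → K) {es rest : List (WeightedEdge V K)}
    {v u : V} {l : K} (h : pickEdge v es = some ((u, l), rest)) :
    exactRatio c s es v =
      ratioStep l (c v) (exactRatio c (pin c s v) rest u) (exactRatio c s rest v)
        (exactRatio c (pin c s u) rest v) := by
  rw [exactRatio]
  split <;> simp_all

end EdgeList

/-! ## The partition function -/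

section PartitionFunction

variable {V K : Type*} [DecidableEq V] [CommSemiring K]

/-- Gives the value `1` to an edge at `u`.  A Fibonacci function with known parameter is
represented by its first two values. -/
def shiftAt (c : V → K) (u : V) (F : V → K × K) : V → K × K :=
  Function.update F u ((F u).2, c u * (F u).2 + (F u).1)

theorem shiftAt_self (c : V → K) (u : V) (F : V → K × K) :
    shiftAt c u F u = ((F u).2, c u * (F u).2 + (F u).1) :=
  Function.update_self ..

theorem shiftAt_of_ne (c : V → K) {u v : V} (h : v ≠ u) (F : V → K × K) :
    shiftAt c u F v = F v :=
  Function.update_of_ne h ..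

theorem shiftAt_comm (c : V → K) (u v : V) (F : V → K × K) :
    shiftAt c u (shiftAt c v F) = shiftAt c v (shiftAt c u F) := by
  rcases eq_or_ne u v with rfl | h
  · rfl
  · rw [shiftAt, shiftAt_of_ne c h, shiftAt, Function.update_comm h.symm, shiftAt,
      shiftAt_of_ne c h.symm, shiftAt]

variable [Fintype V]

/-- The partition function of a graph given by the list of its edges. -/
def listZ (c : V → K) : List (WeightedEdge V K) → (V → K × K) → K
  | [], F => ∏ v, (F v).1
  | (x, y, l) :: es, F => listZ c es F + l * listZ c es (shiftAt c x (shiftAt c y F))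

theorem listZ_cons (c : V → K) (x y : V) (l : K) (es : List (WeightedEdge V K)) (F : V → K × K) :
    listZ c ((x, y, l) :: es) F = listZ c es F + l * listZ c es (shiftAt c x (shiftAt c y F)) :=
  rfl

theorem listZ_append_cons (c : V → K) (pre : List (WeightedEdge V K)) (x y : V) (l : K)
    (suf : List (WeightedEdge V K)) (F : V → K × K) :
    listZ c (pre ++ (x, y, l) :: suf) F =
      listZ c (pre ++ suf) F + l * listZ c (pre ++ suf) (shiftAt c x (shiftAt c y F)) := by
  induction pre generalizing F with
  | nil => rfl
  | cons e pre ih =>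
    obtain ⟨a, b, k⟩ := e
    have hcomm : shiftAt c x (shiftAt c y (shiftAt c a (shiftAt c b F))) =
        shiftAt c a (shiftAt c b (shiftAt c x (shiftAt c y F))) := by
      rw [shiftAt_comm c y a, shiftAt_comm c y b, shiftAt_comm c x a, shiftAt_comm c x b]
    simp only [List.cons_append, listZ_cons, ih, hcomm]
    ring

theorem listZ_of_pickEdge_eq_some (c : V → K) {v u : V} {l : K} {es rest : List (WeightedEdge V K)}
    (h : pickEdge v es = some ((u, l), rest)) (F : V → K × K) :
    listZ c es F = listZ c rest F + l * listZ c rest (shiftAt c v (shiftAt c u F)) := by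
  obtain ⟨pre, suf, rfl, rfl | rfl⟩ := exists_append_of_pickEdge_eq_some h
  · exact listZ_append_cons ..
  · rw [listZ_append_cons, shiftAt_comm]

theorem prod_shiftAt_fst (c : V → K) (v : V) (F : V → K × K) :
    ∏ w, (shiftAt c v F w).1 = (F v).2 * ∏ w ∈ Finset.univ.erase v, (F w).1 := by
  rw [← Finset.mul_prod_erase Finset.univ _ (Finset.mem_univ v), shiftAt_self]
  congr 1
  exact Finset.prod_congr rfl fun w hw => by rw [shiftAt_of_ne c (Finset.ne_of_mem_erase hw)]

theorem listZ_shiftAt_shiftAt (c : V → K) (v : V) (es : List (WeightedEdge V K)) (F : V → K × K) :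
    listZ c es (shiftAt c v (shiftAt c v F)) =
      c v * listZ c es (shiftAt c v F) + listZ c es F := by
  induction es generalizing F with
  | nil =>
    have hrest : ∏ w ∈ Finset.univ.erase v, (shiftAt c v F w).1 =
        ∏ w ∈ Finset.univ.erase v, (F w).1 :=
      Finset.prod_congr rfl fun w hw => by rw [shiftAt_of_ne c (Finset.ne_of_mem_erase hw)]
    simp only [listZ, prod_shiftAt_fst, shiftAt_self, hrest,
      ← Finset.mul_prod_erase Finset.univ (fun w => (F w).1) (Finset.mem_univ v)]
    ring
  | cons e es ih =>
    obtain ⟨x, y, l⟩ := e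
    have hcomm : ∀ G, shiftAt c x (shiftAt c y (shiftAt c v G)) =
        shiftAt c v (shiftAt c x (shiftAt c y G)) := fun G => by
      rw [shiftAt_comm c y v, shiftAt_comm c x v]
    simp only [listZ_cons, hcomm, ih]
    ring

theorem listZ_of_pickEdge_eq_none (c : V → K) {v : V} {es : List (WeightedEdge V K)}
    (h : pickEdge v es = none) (F : V → K × K) :
    listZ c es F * (F v).2 = (F v).1 * listZ c es (shiftAt c v F) := by
  induction es generalizing F with
  | nil =>
    simp only [listZ, prod_shiftAt_fst,
      ← Finset.mul_prod_erase Finset.univ (fun w => (F w).1) (Finset.mem_univ v)]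
    ring
  | cons e es ih =>
    obtain ⟨x, y, l⟩ := e
    obtain ⟨⟨hx, hy⟩, hes⟩ := List.forall_mem_cons.1 (pickEdge_eq_none_iff.1 h)
    have ih := ih (pickEdge_eq_none_iff.2 hes)
    have hfix : shiftAt c x (shiftAt c y F) v = F v := by
      rw [shiftAt_of_ne c (Ne.symm hx), shiftAt_of_ne c (Ne.symm hy)]
    have hcomm : shiftAt c x (shiftAt c y (shiftAt c v F)) =
        shiftAt c v (shiftAt c x (shiftAt c y F)) := by
      rw [shiftAt_comm c y v, shiftAt_comm c x v]
    rw [listZ_cons, listZ_cons, hcomm, add_mul, ih F, mul_assoc, ← hfix, ih, hfix]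
    ring

end PartitionFunction

/-! ## The marginal ratios -/

section MarginalRatio

variable {V K : Type*} [DecidableEq V] [Field K]

theorem pin_self (c s : V → K) (u : V) : pin c s u u = 1 / (c u + s u) :=
  Function.update_self ..

theorem pin_of_ne (c s : V → K) {u v : V} (h : v ≠ u) : pin c s u v = s v :=
  Function.update_of_ne h ..

theorem shiftAt_fst_div_snd (c : V → K) (u : V) {F : V → K × K} (hF : ∀ v, (F v).2 ≠ 0) :
    (fun v => (shiftAt c u F v).1 / (shiftAt c u F v).2) =
      pin c (fun v => (F v).1 / (F v).2) u := by
  funext v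
  rcases eq_or_ne v u with rfl | h
  · have := hF v
    rw [shiftAt_self, pin_self, div_eq_div_iff_comm]
    field_simp
  · rw [shiftAt_of_ne c h, pin_of_ne _ _ h]

variable [LinearOrder K] [IsStrictOrderedRing K] {c s : V → K} {es : List (WeightedEdge V K)}

theorem ratioStep_nonneg {l c a b₀ b₁ : K} (hl : 0 < l) (hc : 0 < c) (ha : 0 ≤ a) (hb₀ : 0 ≤ b₀)
    (hb₁ : 0 ≤ b₁) : 0 ≤ ratioStep l c a b₀ b₁ := by
  unfold ratioStep
  positivity

theorem ratioStep_le {l c a b₀ b₁ P : K} (hl : 0 < l) (hc : 0 < c) (hcP : 1 ≤ c * P)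
    (ha : 0 ≤ a) (hb₀ : b₀ ≤ P) (hb₁ : 0 ≤ b₁) : ratioStep l c a b₀ b₁ ≤ P := by
  have hal : 0 ≤ a / l := by positivity
  have hP : 0 ≤ P := (pos_of_mul_pos_right (zero_lt_one.trans_le hcP) hc.le).le
  rw [ratioStep, div_le_iff₀ (by positivity)]
  linarith [mul_le_mul_of_nonneg_left hb₀ hal, mul_nonneg hP hb₁]

theorem pin_nonneg (hc : ∀ v, 0 < c v) (hs : ∀ v, 0 ≤ s v) (u v : V) : 0 ≤ pin c s u v := by
  rcases eq_or_ne v u with rfl | h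
  · rw [pin_self]
    have := hc v
    have := hs v
    positivity
  · rw [pin_of_ne c s h]
    exact hs v

theorem pin_le {P : K} (hc : ∀ v, 0 < c v) (hcP : ∀ v, 1 ≤ c v * P) (hs : ∀ v, 0 ≤ s v)
    (hsP : ∀ v, s v ≤ P) (u v : V) : pin c s u v ≤ P := by
  rcases eq_or_ne v u with rfl | h
  · have hP : 0 ≤ P := (hs v).trans (hsP v)
    rw [pin_self, div_le_iff₀ (add_pos_of_pos_of_nonneg (hc v) (hs v))]
    linarith [hcP v, mul_nonneg hP (hs v)]
  · rw [pin_of_ne c s h]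
    exact hsP v

theorem exactRatio_nonneg (hc : ∀ v, 0 < c v) (hs : ∀ v, 0 ≤ s v) (hl : ∀ e ∈ es, 0 < e.2.2)
    (v : V) : 0 ≤ exactRatio c s es v := by
  induction es using pickEdge_induction generalizing s v with
  | step es ih =>
    cases h : pickEdge v es with
    | none => rw [exactRatio_of_pickEdge_eq_none c s h]; exact hs v
    | some r =>
      obtain ⟨hl, hrest⟩ := forall_weight_of_pickEdge h hl
      rw [exactRatio_of_pickEdge_eq_some c s h]
      exact ratioStep_nonneg hl (hc v) (ih h (pin_nonneg hc hs v) hrest _) (ih h hs hrest v)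
        (ih h (pin_nonneg hc hs _) hrest v)

theorem exactRatio_le {P : K} (hc : ∀ v, 0 < c v) (hcP : ∀ v, 1 ≤ c v * P) (hs : ∀ v, 0 ≤ s v)
    (hsP : ∀ v, s v ≤ P) (hl : ∀ e ∈ es, 0 < e.2.2) (v : V) : exactRatio c s es v ≤ P := by
  induction es using pickEdge_induction generalizing s v with
  | step es ih =>
    cases h : pickEdge v es with
    | none => rw [exactRatio_of_pickEdge_eq_none c s h]; exact hsP v
    | some r =>
      obtain ⟨hl, hrest⟩ := forall_weight_of_pickEdge h hl
      rw [exactRatio_of_pickEdge_eq_some c s h]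
      exact ratioStep_le hl (hc v) (hcP v) (exactRatio_nonneg hc (pin_nonneg hc hs v) hrest _)
        (ih h hs hsP hrest v) (exactRatio_nonneg hc (pin_nonneg hc hs _) hrest v)

theorem shiftAt_fst_nonneg_snd_pos (hc : ∀ v, 0 < c v) {F : V → K × K}
    (hF : ∀ v, 0 ≤ (F v).1 ∧ 0 < (F v).2) (u v : V) :
    0 ≤ (shiftAt c u F v).1 ∧ 0 < (shiftAt c u F v).2 := by
  rcases eq_or_ne v u with rfl | h
  · obtain ⟨h₁, h₂⟩ := hF v
    have := hc v
    rw [shiftAt_self]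
    constructor <;> positivity
  · rw [shiftAt_of_ne c h]
    exact hF v

theorem shiftAt_pos (hc : ∀ v, 0 < c v) {F : V → K × K} (hF : ∀ v, 0 < (F v).1 ∧ 0 < (F v).2)
    (u v : V) : 0 < (shiftAt c u F v).1 ∧ 0 < (shiftAt c u F v).2 := by
  refine ⟨?_, (shiftAt_fst_nonneg_snd_pos hc (fun v => ⟨(hF v).1.le, (hF v).2⟩) u v).2⟩
  rcases eq_or_ne v u with rfl | h
  · rw [shiftAt_self]
    exact (hF v).2
  · rw [shiftAt_of_ne c h]
    exact (hF v).1

theorem listZ_pos [Fintype V] (hc : ∀ v, 0 < c v) (hl : ∀ e ∈ es, 0 < e.2.2) {F : V → K × K}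
    (hF : ∀ v, 0 < (F v).1 ∧ 0 < (F v).2) : 0 < listZ c es F := by
  induction es generalizing F with
  | nil => exact Finset.prod_pos fun v _ => (hF v).1
  | cons e es ih =>
    obtain ⟨hl, hes⟩ := List.forall_mem_cons.1 hl
    have hfree := ih hes hF
    have hpinned := ih hes (shiftAt_pos hc (shiftAt_pos hc hF e.2.1) e.1)
    exact add_pos hfree (mul_pos hl hpinned)

theorem listZ_eq_exactRatio_mul [Fintype V] (hc : ∀ v, 0 < c v) (hl : ∀ e ∈ es, 0 < e.2.2)
    {F : V → K × K} (hF : ∀ v, 0 ≤ (F v).1 ∧ 0 < (F v).2) (v : V) :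
    listZ c es F =
      exactRatio c (fun v => (F v).1 / (F v).2) es v * listZ c es (shiftAt c v F) := by
  induction es using pickEdge_induction generalizing F v with
  | step es ih =>
    cases h : pickEdge v es with
    | none =>
      rw [exactRatio_of_pickEdge_eq_none _ _ h, div_mul_eq_mul_div, eq_div_iff (hF v).2.ne',
        listZ_of_pickEdge_eq_none c h]
    | some r =>
      obtain ⟨⟨u, l⟩, rest⟩ := r
      obtain ⟨hl, hrest⟩ := forall_weight_of_pickEdge h hl
      have hs : ∀ v, 0 ≤ (F v).1 / (F v).2 := fun v => div_nonneg (hF v).1 (hF v).2.le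
      have hF₂ : ∀ v, (F v).2 ≠ 0 := fun v => (hF v).2.ne'
      have ha := ih h hrest (shiftAt_fst_nonneg_snd_pos hc hF v) u
      have hb₀ := ih h hrest hF v
      have hb₁ := ih h hrest (shiftAt_fst_nonneg_snd_pos hc hF u) v
      rw [shiftAt_fst_div_snd c v hF₂, shiftAt_comm c u v] at ha
      rw [shiftAt_fst_div_snd c u hF₂] at hb₁
      have ha_nonneg := exactRatio_nonneg hc (pin_nonneg hc hs v) hrest u
      have hb₁_nonneg := exactRatio_nonneg hc (pin_nonneg hc hs u) hrest v
      have hden : 0 < c v + (exactRatio c (pin c (fun v => (F v).1 / (F v).2) v) rest u / l +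
          exactRatio c (pin c (fun v => (F v).1 / (F v).2) u) rest v) := by
        have := hc v
        positivity
      rw [exactRatio_of_pickEdge_eq_some _ _ h, listZ_of_pickEdge_eq_some c h,
        listZ_of_pickEdge_eq_some c h (shiftAt c v F), shiftAt_comm c u v, listZ_shiftAt_shiftAt,
        hb₀, ha, hb₁, ratioStep, div_mul_eq_mul_div, eq_div_iff hden.ne']
      field_simp
      ring

theorem listZ_cons_eq_mul [Fintype V] (hc : ∀ v, 0 < c v) (hl : ∀ e ∈ es, 0 < e.2.2)
    {F : V → K × K} (hF : ∀ v, 0 ≤ (F v).1 ∧ 0 < (F v).2) (x y : V) (l : K) :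
    listZ c ((x, y, l) :: es) F =
      (l + exactRatio c (fun v => (F v).1 / (F v).2) es x *
          exactRatio c (pin c (fun v => (F v).1 / (F v).2) x) es y) *
        listZ c es (shiftAt c y (shiftAt c x F)) := by
  have hy := listZ_eq_exactRatio_mul hc hl (shiftAt_fst_nonneg_snd_pos hc hF x) y
  rw [shiftAt_fst_div_snd c x fun v => (hF v).2.ne'] at hy
  rw [listZ_cons, shiftAt_comm c x y, listZ_eq_exactRatio_mul hc hl hF x, hy]
  ring

theorem exactRatio_mul_exactRatio_pin_comm_of_pos [Finite V] (hc : ∀ v, 0 < c v)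
    (hl : ∀ e ∈ es, 0 < e.2.2) (hs : ∀ v, 0 < s v) (u v : V) :
    exactRatio c s es u * exactRatio c (pin c s u) es v =
      exactRatio c s es v * exactRatio c (pin c s v) es u := by
  have := Fintype.ofFinite V
  set F : V → K × K := fun v => (s v, 1)
  have hF : ∀ v, 0 ≤ (F v).1 ∧ 0 < (F v).2 := fun v => ⟨(hs v).le, one_pos⟩
  have hFs : (fun v => (F v).1 / (F v).2) = s := funext fun v => div_one _
  have hZ : ∀ u v, listZ c es F =
      exactRatio c s es u * exactRatio c (pin c s u) es v *
        listZ c es (shiftAt c v (shiftAt c u F)) := fun u v => by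
    rw [listZ_eq_exactRatio_mul hc hl hF u,
      listZ_eq_exactRatio_mul hc hl (shiftAt_fst_nonneg_snd_pos hc hF u) v,
      shiftAt_fst_div_snd c u fun v => (hF v).2.ne', hFs, mul_assoc]
  have hZ_pos : 0 < listZ c es (shiftAt c v (shiftAt c u F)) :=
    listZ_pos hc hl (shiftAt_pos hc (shiftAt_pos hc (fun v => ⟨hs v, one_pos⟩) u) v)
  refine mul_right_cancel₀ hZ_pos.ne' ?_
  rw [← hZ u v, shiftAt_comm, ← hZ v u]

end MarginalRatio

section Continuity

variable {V : Type*} [DecidableEq V] {c : V → ℝ} {es : List (WeightedEdge V ℝ)}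

theorem continuousOn_pin (hc : ∀ v, 0 < c v) (u : V) :
    ContinuousOn (fun s => pin c s u) {s | ∀ v, 0 ≤ s v} := by
  refine continuousOn_pi.2 fun v => ?_
  rcases eq_or_ne v u with rfl | h
  · simp only [pin_self]
    exact continuousOn_const.div (by fun_prop) fun s hs =>
      (add_pos_of_pos_of_nonneg (hc v) (hs v)).ne'
  · simp only [pin_of_ne c _ h]
    fun_prop

theorem continuousOn_exactRatio (hc : ∀ v, 0 < c v) (hl : ∀ e ∈ es, 0 < e.2.2) (v : V) :
    ContinuousOn (fun s => exactRatio c s es v) {s | ∀ v, 0 ≤ s v} := by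
  induction es using pickEdge_induction generalizing v with
  | step es ih =>
    cases h : pickEdge v es with
    | none =>
      simp only [exactRatio_of_pickEdge_eq_none c _ h]
      fun_prop
    | some r =>
      obtain ⟨⟨u, l⟩, rest⟩ := r
      obtain ⟨hl, hrest⟩ := forall_weight_of_pickEdge h hl
      simp only [exactRatio_of_pickEdge_eq_some c _ h, ratioStep]
      have hpinned : ∀ x y, ContinuousOn (fun s => exactRatio c (pin c s x) rest y)
          {s | ∀ v, 0 ≤ s v} := fun x y =>
        (ih h hrest y).comp (continuousOn_pin hc x) fun s hs => pin_nonneg hc hs x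
      have ha := (hpinned v u).div_const l
      refine (continuousOn_const.add (ha.mul (ih h hrest v))).div
        (continuousOn_const.add (ha.add (hpinned u v))) fun s hs => ?_
      have ha_nonneg := exactRatio_nonneg hc (pin_nonneg hc hs v) hrest u
      have hb₁_nonneg := exactRatio_nonneg hc (pin_nonneg hc hs u) hrest v
      have := hc v
      positivity

variable [Finite V] {s : V → ℝ}

-- Both sides are the law of two dangling edges, revealed in either order.  The conditional laws
-- are quotients of partition functions only when these do not vanish, as for positive `s`.
theorem exactRatio_mul_exactRatio_pin_comm (hc : ∀ v, 0 < c v) (hl : ∀ e ∈ es, 0 < e.2.2)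
    (hs : ∀ v, 0 ≤ s v) (u v : V) :
    exactRatio c s es u * exactRatio c (pin c s u) es v =
      exactRatio c s es v * exactRatio c (pin c s v) es u := by
  have hcont : ∀ u v, ContinuousOn (fun s => exactRatio c s es u * exactRatio c (pin c s u) es v)
      {s | ∀ v, 0 ≤ s v} := fun u v =>
    (continuousOn_exactRatio hc hl u).mul <|
      (continuousOn_exactRatio hc hl v).comp (continuousOn_pin hc u) fun s hs => pin_nonneg hc hs u
  have hdense : {s : V → ℝ | ∀ v, 0 ≤ s v} ⊆ closure {s | ∀ v, 0 < s v} := by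
    have horthant := closure_pi_set (Set.univ : Set V) fun _ => Set.Ioi (0 : ℝ)
    simp only [closure_Ioi] at horthant
    intro s hs
    have hmem : s ∈ Set.univ.pi fun _ : V => Set.Ici (0 : ℝ) := fun v _ => hs v
    rw [← horthant] at hmem
    have hsub : Set.univ.pi (fun _ : V => Set.Ioi (0 : ℝ)) ⊆ {s | ∀ v, 0 < s v} :=
      fun s hs v => hs v trivial
    exact closure_mono hsub hmem
  exact Set.EqOn.of_subset_closure
    (fun s hs => exactRatio_mul_exactRatio_pin_comm_of_pos hc hl hs u v) (hcont u v) (hcont v u)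
    (fun s hs v => (hs v).le) hdense hs

end Continuity

section DeepRatio

-- The ratios `a₀, a₁` of `u` (with `v` free or pinned) and `b₀, b₁` of `v` satisfy
-- `a₀ b₁ = b₀ a₁`, so the bounds on `a₀` and `b₀` turn `a₁ b₀` into parts of `b₁` and `a₁`.
theorem ratioStep_mul_le_one {l c a₀ a₁ b₀ b₁ α β σ : ℝ} (hl : 1 ≤ l) (hσc : σ ≤ c)
    (hc : 0 < c) (ha₁ : 0 ≤ a₁) (hb₀ : 0 ≤ b₀) (hb₁ : 0 ≤ b₁) (hcomm : a₀ * b₁ = b₀ * a₁)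
    (hα : a₀ * α ≤ 1) (hβ : b₀ * β ≤ 1) (hσαβ : σ ≤ α + β) :
    ratioStep l c a₁ b₀ b₁ * σ ≤ 1 := by
  have := one_pos.trans_le hl
  have hprod : σ * (a₁ * b₀) ≤ a₁ + b₁ := calc
    σ * (a₁ * b₀) ≤ (α + β) * (a₁ * b₀) := by gcongr
    _ = (a₀ * α) * b₁ + (b₀ * β) * a₁ := by linear_combination (-α) * hcomm
    _ ≤ 1 * b₁ + 1 * a₁ := by gcongr
    _ = a₁ + b₁ := by ring
  rw [ratioStep, div_mul_eq_mul_div, div_le_one (by positivity)]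
  calc (1 + a₁ / l * b₀) * σ = σ + σ * (a₁ * b₀) / l := by ring
    _ ≤ c + (a₁ + b₁) / l := by gcongr
    _ = c + (a₁ / l + b₁ / l) := by rw [add_div]
    _ ≤ c + (a₁ / l + b₁) := by gcongr; exact div_le_self hb₁ hl

variable {V : Type*} [DecidableEq V] [Finite V] {c s : V → ℝ} {es : List (WeightedEdge V ℝ)}

theorem exactRatio_mul_min_le_one {c₀ P : ℝ} (hc₀ : 0 < c₀) (hP : 1 ≤ c₀ * P)
    (hc : ∀ v, c₀ ≤ c v) (hs : ∀ v, 0 ≤ s v) (hsP : ∀ v, s v ≤ P) (hl : ∀ e ∈ es, 1 ≤ e.2.2)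
    {n : ℕ} {v : V} (hdeep : isDeep n es v = true) :
    exactRatio c s es v * min c₀ ((n + 1) / P) ≤ 1 := by
  have hP₀ : 0 < P := pos_of_mul_pos_right (one_pos.trans_le hP) hc₀.le
  have hc_pos : ∀ v, 0 < c v := fun v => hc₀.trans_le (hc v)
  have hcP : ∀ v, 1 ≤ c v * P := fun v =>
    hP.trans (mul_le_mul_of_nonneg_right (hc v) hP₀.le)
  have hinv : ∀ {es : List (WeightedEdge V ℝ)}, (∀ e ∈ es, 1 ≤ e.2.2) → ∀ v,
      exactRatio c s es v * (1 / P) ≤ 1 := fun hl v => by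
    rw [mul_one_div, div_le_one hP₀]
    exact exactRatio_le hc_pos hcP hs hsP (fun e he => one_pos.trans_le (hl e he)) v
  induction n generalizing es v with
  | zero =>
    refine le_trans (mul_le_mul_of_nonneg_left ?_ ?_) (hinv hl v)
    · simp
    · exact exactRatio_nonneg hc_pos hs (fun e he => one_pos.trans_le (hl e he)) v
  | succ n ih =>
    cases h : pickEdge v es with
    | none => simp [isDeep, h] at hdeep
    | some r =>
      obtain ⟨⟨u, l⟩, rest⟩ := r
      obtain ⟨hl, hrest⟩ := forall_weight_of_pickEdge h hl
      have hrest₀ : ∀ e ∈ rest, 0 < e.2.2 := fun e he => one_pos.trans_le (hrest e he)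
      have hgrow : min c₀ ((↑(n + 1) + 1) / P) ≤ min c₀ ((n + 1) / P) + 1 / P := by
        rw [← min_add_add_right, ← add_div, Nat.cast_succ]
        exact min_le_min (le_add_of_nonneg_right (by positivity)) le_rfl
      have hstep := fun α β => ratioStep_mul_le_one (α := α) (β := β)
        (σ := min c₀ ((↑(n + 1) + 1) / P)) hl ((min_le_left _ _).trans (hc v))
        (hc_pos v) (exactRatio_nonneg hc_pos (pin_nonneg hc_pos hs v) hrest₀ u)
        (exactRatio_nonneg hc_pos hs hrest₀ v)
        (exactRatio_nonneg hc_pos (pin_nonneg hc_pos hs u) hrest₀ v)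
        (exactRatio_mul_exactRatio_pin_comm hc_pos hrest₀ hs u v)
      rw [exactRatio_of_pickEdge_eq_some c s h]
      have hdeep' : isDeep n rest u = true ∨ isDeep n rest v = true := by
        simpa [isDeep, h] using hdeep
      rcases hdeep' with hu | hv
      · exact hstep _ _ (ih hrest hu) (hinv hrest v) hgrow
      · exact hstep _ _ (hinv hrest u) (ih hrest hv) (hgrow.trans (add_comm _ _).le)

end DeepRatio

/-! ## Decay of correlations -/

section LogClose

open Real

/-- `x` and `y` agree up to a factor between `exp (-E)` and `exp E`.  In this form the notion
includes `x = y = 0`, where logarithms would not do. -/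
def LogClose (E x y : ℝ) : Prop := ∃ β : ℝ, |β| ≤ E ∧ x = y * exp β

variable {E x y : ℝ}

theorem LogClose.refl (hE : 0 ≤ E) (x : ℝ) : LogClose E x x := ⟨0, by simpa, by simp⟩

theorem LogClose.mul {E' x' y' : ℝ} (h : LogClose E x y) (h' : LogClose E' x' y') :
    LogClose (E + E') (x * x') (y * y') := by
  obtain ⟨β, hβ, rfl⟩ := h
  obtain ⟨β', hβ', rfl⟩ := h'
  exact ⟨β + β', (abs_add_le _ _).trans (add_le_add hβ hβ'), by rw [exp_add]; ring⟩

theorem logClose_of_le_mul_exp (hx : 0 < x) (hy : 0 < y) (hxy : x ≤ y * exp E)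
    (hyx : y ≤ x * exp E) : LogClose E x y := by
  refine ⟨log (x / y), abs_le.2 ⟨?_, ?_⟩, ?_⟩
  · rwa [neg_le, ← log_inv, inv_div, log_le_iff_le_exp (by positivity), div_le_iff₀' hx]
  · rwa [log_le_iff_le_exp (by positivity), div_le_iff₀' hy]
  · rw [exp_log (by positivity), mul_div_cancel₀ _ hy.ne']

theorem LogClose.min_right {θ : ℝ} (h : LogClose E x y) (hy₀ : 0 ≤ y) (hy : y ≤ θ) :
    LogClose E (min x θ) y := by
  rcases le_total x θ with hx | hx
  · rwa [min_eq_left hx]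
  rw [min_eq_right hx]
  obtain ⟨β, hβ, rfl⟩ := h
  have hE : 0 ≤ E := (abs_nonneg β).trans hβ
  rcases hy₀.eq_or_lt with rfl | hy_pos
  · rw [zero_mul] at hx
    rw [le_antisymm hx hy]
    exact .refl hE 0
  · have hθ : 0 < θ := hy_pos.trans_le hy
    refine logClose_of_le_mul_exp hθ hy_pos ?_ ?_
    · exact hx.trans (by gcongr; exact (le_abs_self β).trans hβ)
    · exact hy.trans (le_mul_of_one_le_right hθ.le (one_le_exp hE))

theorem LogClose.const_add {l : ℝ} (hl : 0 < l) (hy : 0 ≤ y) (h : LogClose E x y) :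
    LogClose E (l + x) (l + y) := by
  obtain ⟨β, hβ, rfl⟩ := h
  have hl_le : l ≤ l * exp E := le_mul_of_one_le_right hl.le (one_le_exp ((abs_nonneg β).trans hβ))
  have hβE : exp β ≤ exp E := exp_le_exp.2 ((le_abs_self β).trans hβ)
  have hβE' : 1 ≤ exp β * exp E := by
    rw [← exp_add]
    exact one_le_exp (by linarith [neg_abs_le β])
  refine logClose_of_le_mul_exp (by positivity) (by positivity) ?_ ?_
  · rw [add_mul]
    gcongr
  · rw [add_mul, mul_assoc]
    gcongr
    exact le_mul_of_one_le_right hy hβE'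

theorem mul_exp_mul_le {B α t : ℝ} (hx : 0 ≤ x) (hxB : x ≤ B) (hxα : x * exp α ≤ B)
    (ht : t ∈ Set.Icc (0 : ℝ) 1) : x * exp (t * α) ≤ B := by
  rcases le_total α 0 with h | h
  · refine (mul_le_of_le_one_right hx (exp_le_one_iff.2 ?_)).trans hxB
    exact mul_nonpos_of_nonneg_of_nonpos ht.1 h
  · refine (mul_le_mul_of_nonneg_left (exp_le_exp.2 ?_) hx).trans hxα
    exact mul_le_of_le_one_left h ht.2

/-- The relation of a computed ratio `x'` to the exact ratio `x`: exact if the recursion for it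
was not deep, and otherwise with logarithmic error `E` and both below the cutoff `θ`. -/
def IsApprox (θ E : ℝ) (deep : Bool) (x' x : ℝ) : Prop :=
  if deep then x ≤ θ ∧ x' ≤ θ ∧ LogClose E x' x else x' = x

theorem IsApprox.logClose {θ : ℝ} {deep : Bool} (h : IsApprox θ E deep x y) (hE : 0 ≤ E) :
    LogClose E x y := by
  cases deep with
  | false => rw [show x = y from h]; exact .refl hE y
  | true => exact h.2.2

theorem IsApprox.div_const {θ l : ℝ} {deep : Bool} (h : IsApprox θ E deep x y) (hθ : 0 ≤ θ)
    (hl : 1 ≤ l) : IsApprox θ E deep (x / l) (y / l) := by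
  have hdiv : ∀ {z}, z ≤ θ → z / l ≤ θ := fun hz => by
    rw [div_le_iff₀ (one_pos.trans_le hl)]
    exact hz.trans (le_mul_of_one_le_right hθ hl)
  cases deep with
  | false => exact congrArg (· / l) h
  | true =>
    obtain ⟨hy, hx, β, hβ, rfl⟩ := h
    exact ⟨hdiv hy, hdiv hx, β, hβ, by ring⟩

theorem IsApprox.exists_exp {θ : ℝ} {deep : Bool} (h : IsApprox θ E deep x y) (hE : 0 ≤ E)
    (hy : 0 ≤ y) : ∃ β, |β| ≤ E ∧ x = y * exp β ∧
      if deep then ∀ t ∈ Set.Icc (0 : ℝ) 1, y * exp (t * β) ≤ θ else β = 0 := by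
  cases deep with
  | false => exact ⟨0, by simpa, by simpa [IsApprox] using h, rfl⟩
  | true =>
    obtain ⟨hyθ, hxθ, β, hβ, rfl⟩ := h
    exact ⟨β, hβ, rfl, fun t ht => mul_exp_mul_le hy hyθ hxθ ht⟩

end LogClose

section LogDerivative

open Real

/-- The derivative of `log ((1 + a b₀) / (c + (a + b₁)))` when the logarithms of `a`, `b₀` and `b₁`
move with speeds `α`, `β₀` and `β₁`. -/
noncomputable def ratioLogDeriv (c a b₀ b₁ α β₀ β₁ : ℝ) : ℝ :=
  a * b₀ / (1 + a * b₀) * (α + β₀) - (a * α + b₁ * β₁) / (c + (a + b₁))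

theorem hasDerivAt_log_ratio {c a b₀ b₁ : ℝ} (hc : 0 < c) (ha : 0 ≤ a) (hb₀ : 0 ≤ b₀)
    (hb₁ : 0 ≤ b₁) (α β₀ β₁ t : ℝ) :
    HasDerivAt (fun t => log (1 + a * exp (t * α) * (b₀ * exp (t * β₀))) -
        log (c + (a * exp (t * α) + b₁ * exp (t * β₁))))
      (ratioLogDeriv c (a * exp (t * α)) (b₀ * exp (t * β₀)) (b₁ * exp (t * β₁)) α β₀ β₁) t := by
  have hexp : ∀ x y : ℝ, HasDerivAt (fun t => x * exp (t * y)) (x * exp (t * y) * y) t :=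
    fun x y => by simpa [mul_assoc] using (((hasDerivAt_id t).mul_const y).exp).const_mul x
  have hnum := (((hexp a α).mul (hexp b₀ β₀)).const_add 1).log (by
    simp only [Pi.mul_apply]
    positivity)
  have hden := (((hexp a α).add (hexp b₁ β₁)).const_add c).log (by
    simp only [Pi.add_apply]
    positivity)
  refine (hnum.sub hden).congr_deriv ?_
  simp only [ratioLogDeriv, Pi.mul_apply, Pi.add_apply]
  ring

theorem logClose_of_ratioLogDeriv_le {c a b₀ b₁ α β₀ β₁ D : ℝ} (hc : 0 < c) (ha : 0 ≤ a)
    (hb₀ : 0 ≤ b₀) (hb₁ : 0 ≤ b₁)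
    (hD : ∀ t ∈ Set.Icc (0 : ℝ) 1, |ratioLogDeriv c (a * exp (t * α)) (b₀ * exp (t * β₀))
      (b₁ * exp (t * β₁)) α β₀ β₁| ≤ D) :
    LogClose D ((1 + a * exp α * (b₀ * exp β₀)) / (c + (a * exp α + b₁ * exp β₁)))
      ((1 + a * b₀) / (c + (a + b₁))) := by
  have hmv := norm_image_sub_le_of_norm_deriv_le_segment_01'
    (fun t _ => (hasDerivAt_log_ratio hc ha hb₀ hb₁ α β₀ β₁ t).hasDerivWithinAt)
    (fun t ht => hD t (Set.Ico_subset_Icc_self ht))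
  refine ⟨_, hmv, ?_⟩
  simp only [one_mul, zero_mul, exp_zero, mul_one]
  rw [exp_sub, exp_sub, exp_sub, exp_log (by positivity), exp_log (by positivity),
    exp_log (by positivity), exp_log (by positivity)]
  field_simp

end LogDerivative

section Contraction

/-- A factor by which a step of the recursion reduces logarithmic errors, for Fibonacci
parameters at least `c₀` and ratios at most `P`. -/
def decayRate {K : Type*} [Field K] (c₀ P : K) : K := 1 - (c₀ - 1) / (12 * P)

variable {c₀ P a b₀ b₁ c : ℝ}

theorem decayRate_lt_one (hc₀ : 1 < c₀) (hP : 0 < P) : decayRate c₀ P < 1 :=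
  sub_lt_self 1 (div_pos (sub_pos.2 hc₀) (by positivity))

theorem le_decayRate (hc₀ : c₀ ≤ 2) (hP : 1 ≤ P) : 11 / 12 ≤ decayRate c₀ P := by
  have : (c₀ - 1) / (12 * P) ≤ 1 / 12 := by
    rw [div_le_div_iff₀ (by positivity) (by norm_num)]
    linarith
  unfold decayRate
  linarith

theorem decay_left (hc₀ : c₀ ≤ 2) (hP : 1 ≤ P) (hc : 1 ≤ c) (ha : 0 ≤ a)
    (ha₁ : a ≤ 1) (hb₀ : 0 ≤ b₀) (hb₀P : b₀ ≤ P) (hb₁ : 0 ≤ b₁) :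
    |a * b₀ / (1 + a * b₀) - a / (c + (a + b₁))| ≤ decayRate c₀ P := by
  have hnum : a * b₀ / (1 + a * b₀) ≤ decayRate c₀ P := by
    have hab : a * b₀ ≤ P := (mul_le_of_le_one_left hb₀ ha₁).trans hb₀P
    have : (c₀ - 1) / (12 * P) ≤ 1 / (1 + a * b₀) := by
      rw [div_le_div_iff₀ (by positivity) (by positivity)]
      nlinarith [mul_nonneg ha hb₀]
    rw [decayRate, le_sub_comm, one_sub_div (by positivity)]
    simpa using this
  have hden : a / (c + (a + b₁)) ≤ 1 / 2 := by
    rw [div_le_iff₀ (by positivity)]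
    linarith
  have hrate := le_decayRate hc₀ hP
  have hnum₀ : 0 ≤ a * b₀ / (1 + a * b₀) := by positivity
  have hden₀ : 0 ≤ a / (c + (a + b₁)) := by positivity
  rw [abs_le]
  constructor <;> linarith

theorem mul_div_one_add_mul_le (hc₀ : 0 < c₀) (ha : 0 ≤ a) (hb₀ : 0 ≤ b₀)
    (hb₀c : b₀ ≤ c₀⁻¹) : a * b₀ / (1 + a * b₀) ≤ a / (c₀ + a) := by
  have : b₀ * c₀ ≤ 1 := by rwa [← le_div_iff₀ hc₀, one_div]
  rw [div_le_div_iff₀ (by positivity) (by positivity)]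
  linarith [mul_le_mul_of_nonneg_left this ha]

theorem div_add_div_le_decayRate {θ : ℝ} (hc₀ : 1 < c₀) (hc₀₂ : c₀ ≤ 2) (hP : 1 ≤ P) (ha : 0 ≤ a)
    (haP : a ≤ P) (hθ₀ : 0 < θ) (hθ : θ ≤ 1) :
    a / (c₀ + a) + θ / (c₀ + a + θ) ≤ decayRate c₀ P := by
  have hgap : a / (c₀ + a) + θ / (c₀ + a + θ) =
      1 - (c₀ ^ 2 + a * (c₀ - θ)) / ((c₀ + a) * (c₀ + a + θ)) := by
    field_simp
    ring
  have hden_le : (c₀ + a) * (c₀ + a + θ) ≤ 12 * P * (1 + a) := by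
    have : (c₀ + a) * (c₀ + a + θ) ≤ (2 + a) * (3 + a) :=
      mul_le_mul (by linarith) (by linarith) (by positivity) (by positivity)
    nlinarith
  have hnum_le : (c₀ - 1) * (1 + a) ≤ c₀ ^ 2 + a * (c₀ - θ) := by nlinarith
  rw [hgap, decayRate, sub_le_sub_iff_left, div_le_div_iff₀ (by positivity) (by positivity)]
  calc (c₀ - 1) * ((c₀ + a) * (c₀ + a + θ)) ≤ (c₀ - 1) * (12 * P * (1 + a)) := by
        gcongr
    _ = (c₀ - 1) * (1 + a) * (12 * P) := by ring
    _ ≤ (c₀ ^ 2 + a * (c₀ - θ)) * (12 * P) := by gcongr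

theorem decay_right (hc₀ : 1 < c₀) (hc₀₂ : c₀ ≤ 2) (hP : 1 ≤ P) (hc : c₀ ≤ c) (ha : 0 ≤ a)
    (haP : a ≤ P) (hb₀ : 0 ≤ b₀) (hb₀c : b₀ ≤ c₀⁻¹) (hb₁ : 0 ≤ b₁) (hb₁c : b₁ ≤ c₀⁻¹) :
    a * b₀ / (1 + a * b₀) + b₁ / (c + (a + b₁)) ≤ decayRate c₀ P := by
  have hc₀_pos : 0 < c₀ := one_pos.trans hc₀
  have hc_pos : 0 < c := hc₀_pos.trans_le hc
  have hθ : c₀⁻¹ ≤ 1 := inv_le_one_of_one_le₀ hc₀.le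
  have hθ₀ : 0 < c₀⁻¹ := by positivity
  have hnum := mul_div_one_add_mul_le hc₀_pos ha hb₀ hb₀c
  generalize c₀⁻¹ = θ at *
  have hden : b₁ / (c + (a + b₁)) ≤ θ / (c₀ + a + θ) := by
    rw [div_le_div_iff₀ (by positivity) (by positivity)]
    nlinarith
  have hsum := div_add_div_le_decayRate hc₀ hc₀₂ hP ha haP hθ₀ hθ
  linarith

theorem two_mul_div_add_div_le_decayRate {θ : ℝ} (hc₀ : 1 < c₀) (hc₀₂ : c₀ ≤ 2) (hP : 1 ≤ P)
    (ha : 0 ≤ a) (haθ : a ≤ θ) (hθ₀ : 0 < θ) (hθ : θ ≤ 1) :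
    2 * (a / (c₀ + a)) + (θ - a) / (c₀ + a + θ) ≤ decayRate c₀ P := by
  have hgap : 2 * (a / (c₀ + a)) + (θ - a) / (c₀ + a + θ) =
      1 - (c₀ ^ 2 + a * (c₀ - 2 * θ)) / ((c₀ + a) * (c₀ + a + θ)) := by
    field_simp
    ring
  have hden_le : (c₀ + a) * (c₀ + a + θ) ≤ 12 * P := calc
    (c₀ + a) * (c₀ + a + θ) ≤ 3 * 4 := by gcongr <;> linarith
    _ ≤ 12 * P := by linarith
  have hnum_le : c₀ - 1 ≤ c₀ ^ 2 + a * (c₀ - 2 * θ) := by nlinarith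
  rw [hgap, decayRate, sub_le_sub_iff_left]
  exact div_le_div₀ (by nlinarith) hnum_le (by positivity) hden_le

theorem decay_both (hc₀ : 1 < c₀) (hc₀₂ : c₀ ≤ 2) (hP : 1 ≤ P) (hc : c₀ ≤ c) (ha : 0 ≤ a)
    (hac : a ≤ c₀⁻¹) (hb₀ : 0 ≤ b₀) (hb₀c : b₀ ≤ c₀⁻¹) (hb₁ : 0 ≤ b₁) (hb₁c : b₁ ≤ c₀⁻¹) :
    |a * b₀ / (1 + a * b₀) - a / (c + (a + b₁))| + a * b₀ / (1 + a * b₀) +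
      b₁ / (c + (a + b₁)) ≤ decayRate c₀ P := by
  have hc₀_pos : 0 < c₀ := one_pos.trans hc₀
  have hc_pos : 0 < c := hc₀_pos.trans_le hc
  have hθ : c₀⁻¹ ≤ 1 := inv_le_one_of_one_le₀ hc₀.le
  have hθ₀ : 0 < c₀⁻¹ := by positivity
  have hrate := le_decayRate hc₀₂ hP
  have hnum := mul_div_one_add_mul_le hc₀_pos ha hb₀ hb₀c
  generalize c₀⁻¹ = θ at *
  rcases le_total (a * b₀ / (1 + a * b₀)) (a / (c + (a + b₁))) with h | h
  · have hsum : a / (c + (a + b₁)) + b₁ / (c + (a + b₁)) ≤ 11 / 12 := by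
      rw [← add_div, div_le_iff₀ (by positivity)]
      linarith
    rw [abs_of_nonpos (by linarith)]
    linarith
  · have hden : b₁ / (c + (a + b₁)) - a / (c + (a + b₁)) ≤ (θ - a) / (c₀ + a + θ) := by
      rw [← sub_div, div_le_div_iff₀ (by positivity) (by positivity)]
      nlinarith
    have hsum := two_mul_div_add_div_le_decayRate hc₀ hc₀₂ hP ha hac hθ₀ hθ
    rw [abs_of_nonneg (by linarith)]
    linarith

end Contraction

section Step

variable {c₀ P E c l a a' b₀ b₀' b₁ b₁' : ℝ}

theorem abs_ratioLogDeriv_le {α β₀ β₁ : ℝ} (hc₀ : 1 < c₀) (hc₀₂ : c₀ ≤ 2) (hP : 1 ≤ P)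
    (hc : c₀ ≤ c) (ha : 0 ≤ a) (hb₀ : 0 ≤ b₀) (hb₁ : 0 ≤ b₁) (hα : |α| ≤ E) (hβ₀ : |β₀| ≤ E)
    (hβ₁ : |β₁| ≤ E) (hleft : a ≤ c₀⁻¹ ∨ α = 0 ∧ a ≤ P)
    (hright : b₀ ≤ c₀⁻¹ ∧ b₁ ≤ c₀⁻¹ ∨ (β₀ = 0 ∧ β₁ = 0) ∧ b₀ ≤ P) :
    |ratioLogDeriv c a b₀ b₁ α β₀ β₁| ≤ decayRate c₀ P * E := by
  have hE : 0 ≤ E := (abs_nonneg α).trans hα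
  have hc_pos : 0 < c := by linarith
  have hθ : c₀⁻¹ ≤ 1 := inv_le_one_of_one_le₀ hc₀.le
  set x := a * b₀ / (1 + a * b₀) - a / (c + (a + b₁))
  set y := a * b₀ / (1 + a * b₀)
  set z := b₁ / (c + (a + b₁))
  have hy : 0 ≤ y := by positivity
  have hz : 0 ≤ z := by positivity
  have hsplit : ratioLogDeriv c a b₀ b₁ α β₀ β₁ = x * α + y * β₀ - z * β₁ := by
    simp only [ratioLogDeriv, x, y, z]
    ring
  have hterm : ∀ {u v}, |v| ≤ E → |u * v| ≤ |u| * E := fun h => by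
    rw [abs_mul]
    gcongr
  have hx := hterm (u := x) hα
  have hright_le : |y * β₀ - z * β₁| ≤ (y + z) * E := by
    refine (abs_sub _ _).trans ((add_le_add (hterm hβ₀) (hterm hβ₁)).trans_eq ?_)
    rw [abs_of_nonneg hy, abs_of_nonneg hz, add_mul]
  rw [hsplit, add_sub_assoc]
  rcases hleft with ha' | ⟨rfl, haP⟩ <;> rcases hright with ⟨hb₀', hb₁'⟩ | ⟨⟨rfl, rfl⟩, hb₀P⟩
  · calc |x * α + (y * β₀ - z * β₁)| ≤ |x| * E + (y + z) * E :=
          (abs_add_le _ _).trans (add_le_add hx hright_le)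
      _ = (|x| + y + z) * E := by ring
      _ ≤ decayRate c₀ P * E := by
          gcongr
          exact decay_both hc₀ hc₀₂ hP hc ha ha' hb₀ hb₀' hb₁ hb₁'
  · rw [mul_zero, mul_zero, sub_zero, add_zero]
    refine hx.trans (mul_le_mul_of_nonneg_right ?_ hE)
    exact decay_left hc₀₂ hP (hc₀.le.trans hc) ha (ha'.trans hθ) hb₀ hb₀P hb₁
  · rw [mul_zero, zero_add]
    refine hright_le.trans (mul_le_mul_of_nonneg_right ?_ hE)
    exact decay_right hc₀ hc₀₂ hP hc ha haP hb₀ hb₀' hb₁ hb₁'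
  · have := le_decayRate hc₀₂ hP
    simp only [mul_zero, sub_zero, add_zero, abs_zero]
    positivity

theorem logClose_ratioStep {deepU deepV : Bool} (hc₀ : 1 < c₀) (hc₀₂ : c₀ ≤ 2) (hP : 1 ≤ P)
    (hE : 0 ≤ E) (hc : c₀ ≤ c) (hl : 1 ≤ l) (ha₀ : 0 ≤ a) (haP : a ≤ P) (hb₀₀ : 0 ≤ b₀)
    (hb₀P : b₀ ≤ P) (hb₁₀ : 0 ≤ b₁) (ha : IsApprox c₀⁻¹ E deepU a' a)
    (hb₀ : IsApprox c₀⁻¹ E deepV b₀' b₀) (hb₁ : IsApprox c₀⁻¹ E deepV b₁' b₁) :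
    LogClose (decayRate c₀ P * E) (ratioStep l c a' b₀' b₁') (ratioStep l c a b₀ b₁) := by
  have hal₀ : 0 ≤ a / l := by positivity
  have hal : a / l ≤ P := (div_le_self ha₀ hl).trans haP
  obtain ⟨α, hα, hα', hu⟩ := (ha.div_const (by positivity) hl).exists_exp hE hal₀
  obtain ⟨β₀, hβ₀, rfl, hv₀⟩ := hb₀.exists_exp hE hb₀₀
  obtain ⟨β₁, hβ₁, rfl, hv₁⟩ := hb₁.exists_exp hE hb₁₀
  rw [ratioStep, hα', ratioStep]
  refine logClose_of_ratioLogDeriv_le (by linarith) hal₀ hb₀₀ hb₁₀ fun t ht => ?_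
  refine abs_ratioLogDeriv_le hc₀ hc₀₂ hP hc (by positivity) (by positivity) (by positivity)
    hα hβ₀ hβ₁ ?_ ?_
  · cases deepU with
    | true => exact .inl (hu t ht)
    | false => exact .inr ⟨hu, by simpa [show α = 0 from hu] using hal⟩
  · cases deepV with
    | true => exact .inl ⟨hv₀ t ht, hv₁ t ht⟩
    | false => exact .inr ⟨⟨hv₀, hv₁⟩, by simpa [show β₀ = 0 from hv₀] using hb₀P⟩

end Step

/-! ## The truncated recursion -/

section ApproxRatio

variable {V K : Type*} [DecidableEq V] [Field K] [LinearOrder K]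

/-- The truncated recursion.  The list `ls` bounds the depth; its entries tell whether a value
that depends on truncated branches is computed (`true`), and then cut off at `θ`, or replaced by a
default (`false`).  The first component of the result tells whether branches have been
truncated. -/
def approxRatio (θ : K) (c : V → K) :
    List Bool → (V → K) → List (WeightedEdge V K) → V → Bool × K
  | [], s, es, v =>
    match pickEdge v es with
    | none => (false, s v)
    | some _ => (true, 1 / c v)
  | b :: ls, s, es, v =>
    match pickEdge v es with
    | none => (false, s v)
    | some ((u, l), rest) =>
      let a := approxRatio θ c ls (pin c s v) rest u
      let b₀ := approxRatio θ c ls s rest v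
      let b₁ := approxRatio θ c ls (pin c s u) rest v
      let x := ratioStep l (c v) a.2 b₀.2 b₁.2
      if a.1 || b₀.1 then (true, if b then min x θ else 1 / c v) else (false, x)

variable (θ : K) (c s : V → K) {es rest : List (WeightedEdge V K)} {v u : V} {l : K}

theorem approxRatio_of_pickEdge_eq_none (ls : List Bool) (h : pickEdge v es = none) :
    approxRatio θ c ls s es v = (false, s v) := by
  cases ls <;> simp [approxRatio, h]

theorem approxRatio_of_pickEdge_eq_some (b : Bool) (ls : List Bool)
    (h : pickEdge v es = some ((u, l), rest)) :
    approxRatio θ c (b :: ls) s es v =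
      let x := ratioStep l (c v) (approxRatio θ c ls (pin c s v) rest u).2
        (approxRatio θ c ls s rest v).2 (approxRatio θ c ls (pin c s u) rest v).2
      if (approxRatio θ c ls (pin c s v) rest u).1 || (approxRatio θ c ls s rest v).1 then
        (true, if b then min x θ else 1 / c v)
      else (false, x) := by
  simp [approxRatio, h]

theorem approxRatio_fst (ls : List Bool) (es : List (WeightedEdge V K)) (v : V) :
    (approxRatio θ c ls s es v).1 = isDeep ls.length es v := by
  induction ls generalizing s es v with
  | nil => cases h : pickEdge v es <;> simp [approxRatio, isDeep, h]
  | cons b ls ih =>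
    cases h : pickEdge v es with
    | none => simp [approxRatio, isDeep, h]
    | some r =>
      obtain ⟨⟨u, l⟩, rest⟩ := r
      rw [approxRatio_of_pickEdge_eq_some θ c s b ls h]
      simp only [ih, isDeep, h, List.length_cons]
      cases isDeep ls.length rest u || isDeep ls.length rest v <;> simp

theorem approxRatio_eq_exactRatio (ls : List Bool) (hd : isDeep ls.length es v = false) :
    approxRatio θ c ls s es v = (false, exactRatio c s es v) := by
  induction ls generalizing s es v with
  | nil =>
    cases h : pickEdge v es with
    | none =>
      rw [approxRatio_of_pickEdge_eq_none θ c s _ h, exactRatio_of_pickEdge_eq_none c s h]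
    | some r => simp [isDeep, h] at hd
  | cons b ls ih =>
    cases h : pickEdge v es with
    | none =>
      rw [approxRatio_of_pickEdge_eq_none θ c s _ h, exactRatio_of_pickEdge_eq_none c s h]
    | some r =>
      obtain ⟨⟨u, l⟩, rest⟩ := r
      obtain ⟨hu, hv⟩ : isDeep ls.length rest u = false ∧ isDeep ls.length rest v = false := by
        simpa [isDeep, h] using hd
      rw [approxRatio_of_pickEdge_eq_some θ c s b ls h, exactRatio_of_pickEdge_eq_some c s h,
        ih _ hu, ih _ hv, ih _ hv]
      simp

theorem approxRatio_replicate_false (n : ℕ) (hd : isDeep n es v = true) :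
    approxRatio θ c (List.replicate n false) s es v = (true, 1 / c v) := by
  cases h : pickEdge v es with
  | none => cases n <;> simp [isDeep, h] at hd
  | some r =>
    obtain ⟨⟨u, l⟩, rest⟩ := r
    cases n with
    | zero => simp [approxRatio, h]
    | succ n =>
      have hd' : (isDeep n rest u || isDeep n rest v) = true := by simpa [isDeep, h] using hd
      rw [List.replicate_succ, approxRatio_of_pickEdge_eq_some θ c s _ _ h, approxRatio_fst,
        approxRatio_fst, List.length_replicate, if_pos hd', if_neg Bool.false_ne_true]

/-- The approximation to the partition function divided by the weight of the configuration that
is `1` everywhere, as a product of the ratios of the two ends of every edge. -/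
def approxProd (ls : List Bool) : (V → K) → List (WeightedEdge V K) → K
  | _, [] => 1
  | s, (x, y, l) :: es =>
    (l + (approxRatio θ c ls s es x).2 * (approxRatio θ c ls (pin c s x) es y).2) *
      approxProd ls (pin c (pin c s x) y) es

end ApproxRatio

/-- The levels of the truncated recursion: `h` levels that are evaluated above `2 P` levels that
are only explored, to make sure that the values on the former are below the cutoff. -/
def levelList (P h : ℕ) : List Bool := List.replicate h true ++ List.replicate (2 * P) false

theorem length_levelList (P h : ℕ) : (levelList P h).length = h + 2 * P := by
  simp [levelList]

theorem levelList_zero (P : ℕ) : levelList P 0 = List.replicate (2 * P) false := rfl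

theorem levelList_succ (P h : ℕ) : levelList P (h + 1) = true :: levelList P h := rfl

/-- A bound for the logarithmic error of the default value of the truncated recursion. -/
def defaultError (P : ℕ) : ℕ := P ^ 2 + 2 * P

section ApproxError

open Real

theorem logClose_one_div_ratioStep {P : ℕ} {c l a b₀ b₁ : ℝ} (hc : 1 ≤ c) (hl : 1 ≤ l)
    (ha : a ∈ Set.Icc (0 : ℝ) P) (hb₀ : b₀ ∈ Set.Icc (0 : ℝ) P) (hb₁ : b₁ ∈ Set.Icc (0 : ℝ) P) :
    LogClose (defaultError P) (1 / c) (ratioStep l c a b₀ b₁) := by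
  obtain ⟨ha₀, haP⟩ := ha
  obtain ⟨hb₀₀, hb₀P⟩ := hb₀
  obtain ⟨hb₁₀, hb₁P⟩ := hb₁
  have hP : (0 : ℝ) ≤ P := ha₀.trans haP
  have hexp : 1 + ((P : ℝ) ^ 2 + 2 * P) ≤ exp (defaultError P) := by
    have := add_one_le_exp (defaultError P : ℝ)
    push_cast [defaultError] at this ⊢
    linarith
  have hal₀ : 0 ≤ a / l := by positivity
  have hal : a / l ≤ P := (div_le_self ha₀ hl).trans haP
  have hprod : a / l * b₀ ≤ (P : ℝ) ^ 2 := by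
    rw [sq]
    exact mul_le_mul hal hb₀P hb₀₀ hP
  unfold ratioStep
  generalize a / l = x at *
  have hxb : 0 ≤ x * b₀ := by positivity
  refine logClose_of_le_mul_exp (by positivity) (by positivity) ?_ ?_
  · rw [div_mul_eq_mul_div, div_le_div_iff₀ (by positivity) (by positivity)]
    calc 1 * (c + (x + b₁)) ≤ (1 + ((P : ℝ) ^ 2 + 2 * P)) * c := by nlinarith
      _ ≤ (1 + x * b₀) * exp (defaultError P) * c := by
        gcongr
        exact hexp.trans (le_mul_of_one_le_left (exp_pos _).le (by linarith))
  · rw [div_mul_eq_mul_div, one_mul, div_le_div_iff₀ (by positivity) (by positivity)]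
    calc (1 + x * b₀) * c ≤ exp (defaultError P) * c := by gcongr; linarith
      _ ≤ exp (defaultError P) * (c + (x + b₁)) := by gcongr; linarith

variable {V : Type*} [DecidableEq V] {c s : V → ℝ} {es : List (WeightedEdge V ℝ)}

theorem pin_mem_Icc {P : ℝ} (hP : 1 ≤ P) (hc : ∀ v, 1 ≤ c v) (hs : ∀ v, s v ∈ Set.Icc 0 P)
    (u v : V) : pin c s u v ∈ Set.Icc 0 P :=
  have hc₀ := fun v => one_pos.trans_le (hc v)
  ⟨pin_nonneg hc₀ (fun v => (hs v).1) u v,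
    pin_le hc₀ (fun v => one_le_mul_of_one_le_of_one_le (hc v) hP) (fun v => (hs v).1)
      (fun v => (hs v).2) u v⟩

theorem exactRatio_mem_Icc {P : ℝ} (hP : 1 ≤ P) (hc : ∀ v, 1 ≤ c v)
    (hs : ∀ v, s v ∈ Set.Icc 0 P) (hl : ∀ e ∈ es, 1 ≤ e.2.2) (v : V) :
    exactRatio c s es v ∈ Set.Icc 0 P :=
  have hc₀ := fun v => one_pos.trans_le (hc v)
  have hl₀ := fun e he => one_pos.trans_le (hl e he)
  ⟨exactRatio_nonneg hc₀ (fun v => (hs v).1) hl₀ v,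
    exactRatio_le hc₀ (fun v => one_le_mul_of_one_le_of_one_le (hc v) hP) (fun v => (hs v).1)
      (fun v => (hs v).2) hl₀ v⟩

theorem logClose_one_div_exactRatio {P : ℕ} (hP : 1 ≤ P) (hc : ∀ v, 1 ≤ c v)
    (hs : ∀ v, s v ∈ Set.Icc (0 : ℝ) P) (hl : ∀ e ∈ es, 1 ≤ e.2.2) {v : V}
    (hv : pickEdge v es ≠ none) :
    LogClose (defaultError P) (1 / c v) (exactRatio c s es v) := by
  have hP' : (1 : ℝ) ≤ P := by exact_mod_cast hP
  obtain ⟨⟨⟨u, l⟩, rest⟩, h⟩ := Option.ne_none_iff_exists'.1 hv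
  obtain ⟨hl, hrest⟩ := forall_weight_of_pickEdge h hl
  rw [exactRatio_of_pickEdge_eq_some c s h]
  exact logClose_one_div_ratioStep (hc v) hl
    (exactRatio_mem_Icc hP' hc (pin_mem_Icc hP' hc hs v) hrest u)
    (exactRatio_mem_Icc hP' hc hs hrest v)
    (exactRatio_mem_Icc hP' hc (pin_mem_Icc hP' hc hs u) hrest v)

variable {c₀ : ℝ} {P : ℕ}

theorem exactRatio_le_inv [Finite V] (hc₀ : 1 ≤ c₀) (hc₀₂ : c₀ ≤ 2) (hP : 1 ≤ P)
    (hc : ∀ v, c₀ ≤ c v) (hs : ∀ v, s v ∈ Set.Icc (0 : ℝ) P) (hl : ∀ e ∈ es, 1 ≤ e.2.2) {n : ℕ}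
    (hn : 2 * P ≤ n) {v : V} (hdeep : isDeep n es v = true) :
    exactRatio c s es v ≤ c₀⁻¹ := by
  have hP' : (1 : ℝ) ≤ P := by exact_mod_cast hP
  have hn' : (2 * P : ℝ) ≤ n := by exact_mod_cast hn
  have hmin : c₀ ≤ (n + 1) / P := by
    rw [le_div_iff₀ (by positivity)]
    nlinarith
  have := exactRatio_mul_min_le_one (one_pos.trans_le hc₀)
    (one_le_mul_of_one_le_of_one_le hc₀ hP') hc (fun v => (hs v).1) (fun v => (hs v).2) hl hdeep
  rwa [min_eq_left hmin, ← le_div_iff₀ (one_pos.trans_le hc₀), one_div] at this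

theorem isApprox_approxRatio_levelList_zero [Finite V] (hc₀ : 1 ≤ c₀) (hc₀₂ : c₀ ≤ 2) (hP : 1 ≤ P)
    (hc : ∀ v, c₀ ≤ c v) (hs : ∀ v, s v ∈ Set.Icc (0 : ℝ) P) (hl : ∀ e ∈ es, 1 ≤ e.2.2) (v : V) :
    IsApprox c₀⁻¹ (defaultError P) (isDeep (2 * P) es v)
      (approxRatio c₀⁻¹ c (levelList P 0) s es v).2 (exactRatio c s es v) := by
  cases hd : isDeep (2 * P) es v with
  | false =>
    rw [approxRatio_eq_exactRatio _ c s _ (by rwa [length_levelList, zero_add])]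
    rfl
  | true =>
    have hpick : pickEdge v es ≠ none := fun h => by
      obtain ⟨n, hn⟩ := Nat.exists_eq_add_of_le' hP
      simp [isDeep, h, hn, Nat.mul_add] at hd
    rw [levelList_zero, approxRatio_replicate_false _ c s _ hd]
    refine ⟨exactRatio_le_inv hc₀ hc₀₂ hP hc hs hl le_rfl hd, ?_,
      logClose_one_div_exactRatio hP (fun v => hc₀.trans (hc v)) hs hl hpick⟩
    rw [one_div]
    exact inv_anti₀ (one_pos.trans_le hc₀) (hc v)

theorem isApprox_approxRatio [Finite V] (hc₀ : 1 < c₀) (hc₀₂ : c₀ ≤ 2) (hP : 1 ≤ P)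
    (hc : ∀ v, c₀ ≤ c v) (hs : ∀ v, s v ∈ Set.Icc (0 : ℝ) P) (hl : ∀ e ∈ es, 1 ≤ e.2.2) (h : ℕ)
    (v : V) :
    IsApprox c₀⁻¹ (decayRate c₀ P ^ h * defaultError P) (isDeep (h + 2 * P) es v)
      (approxRatio c₀⁻¹ c (levelList P h) s es v).2 (exactRatio c s es v) := by
  have hP' : (1 : ℝ) ≤ P := by exact_mod_cast hP
  have hc₁ : ∀ v, 1 ≤ c v := fun v => hc₀.le.trans (hc v)
  have hrate := le_decayRate hc₀₂ hP'
  induction h generalizing s es v with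
  | zero => simpa using isApprox_approxRatio_levelList_zero hc₀.le hc₀₂ hP hc hs hl v
  | succ h ih =>
    cases hd : isDeep (h + 1 + 2 * P) es v with
    | false =>
      rw [approxRatio_eq_exactRatio _ c s _ (by rwa [length_levelList])]
      rfl
    | true =>
      have hle := exactRatio_le_inv hc₀.le hc₀₂ hP hc hs hl (by simp) hd
      have hnonneg := (exactRatio_mem_Icc hP' hc₁ hs hl v).1
      rw [Nat.add_right_comm] at hd
      cases hpick : pickEdge v es with
      | none => simp [isDeep, hpick] at hd
      | some r =>
        obtain ⟨⟨u, l⟩, rest⟩ := r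
        obtain ⟨hl, hrest⟩ := forall_weight_of_pickEdge hpick hl
        have hd' : (isDeep (h + 2 * P) rest u || isDeep (h + 2 * P) rest v) = true := by
          simpa [isDeep, hpick] using hd
        have hpin := pin_mem_Icc hP' hc₁ hs
        have ha := exactRatio_mem_Icc hP' hc₁ (hpin v) hrest u
        have hb₀ := exactRatio_mem_Icc hP' hc₁ hs hrest v
        have hb₁ := exactRatio_mem_Icc hP' hc₁ (hpin u) hrest v
        rw [levelList_succ, approxRatio_of_pickEdge_eq_some _ c s _ _ hpick, approxRatio_fst,
          approxRatio_fst, length_levelList, if_pos hd', if_pos rfl]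
        refine ⟨hle, min_le_right _ _, LogClose.min_right ?_ hnonneg hle⟩
        rw [exactRatio_of_pickEdge_eq_some c s hpick, pow_succ', mul_assoc]
        exact logClose_ratioStep hc₀ hc₀₂ hP' (by positivity) (hc v) hl ha.1 ha.2 hb₀.1 hb₀.2
          hb₁.1 (ih (hpin v) hrest u) (ih hs hrest v) (ih (hpin u) hrest v)

variable [Fintype V]

/-- The product of the values of the vertex functions when all edges have the value `1`. -/
def topWeight {R : Type*} [CommSemiring R] (c : V → R) :
    List (WeightedEdge V R) → (V → R × R) → R
  | [], F => ∏ v, (F v).1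
  | (x, y, _) :: es, F => topWeight c es (shiftAt c y (shiftAt c x F))

theorem logClose_approxProd (hc₀ : 1 < c₀) (hc₀₂ : c₀ ≤ 2) (hP : 1 ≤ P) (hc : ∀ v, c₀ ≤ c v)
    (h : ℕ) (hl : ∀ e ∈ es, 1 ≤ e.2.2) {F : V → ℝ × ℝ} (hF : ∀ v, 0 ≤ (F v).1 ∧ 0 < (F v).2)
    (hFP : ∀ v, (F v).1 / (F v).2 ≤ P) :
    LogClose (es.length * (2 * (decayRate c₀ P ^ h * defaultError P)))
      (topWeight c es F * approxProd c₀⁻¹ c (levelList P h) (fun v => (F v).1 / (F v).2) es)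
      (listZ c es F) := by
  have hP' : (1 : ℝ) ≤ P := by exact_mod_cast hP
  have hc₁ : ∀ v, 1 ≤ c v := fun v => hc₀.le.trans (hc v)
  have hc_pos : ∀ v, 0 < c v := fun v => one_pos.trans_le (hc₁ v)
  have hrate := le_decayRate hc₀₂ hP'
  induction es generalizing F with
  | nil => simpa [topWeight, approxProd, listZ] using LogClose.refl le_rfl _
  | cons e es ih =>
    obtain ⟨x, y, l⟩ := e
    obtain ⟨hl, hes⟩ := List.forall_mem_cons.1 hl
    have hl₀ : 0 < l := one_pos.trans_le hl
    have hs : ∀ v, (F v).1 / (F v).2 ∈ Set.Icc (0 : ℝ) P :=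
      fun v => ⟨div_nonneg (hF v).1 (hF v).2.le, hFP v⟩
    have hsx := pin_mem_Icc hP' hc₁ hs x
    have hFx := shiftAt_fst_nonneg_snd_pos hc_pos hF x
    have hquot := shiftAt_fst_div_snd c y fun v => (hFx v).2.ne'
    rw [shiftAt_fst_div_snd c x fun v => (hF v).2.ne'] at hquot
    have hrec := ih hes (shiftAt_fst_nonneg_snd_pos hc_pos hFx y) fun v => by
      rw [congrFun hquot v]
      exact (pin_mem_Icc hP' hc₁ hsx y v).2
    rw [hquot] at hrec
    have hratio {s : V → ℝ} (hs : ∀ v, s v ∈ Set.Icc (0 : ℝ) P) (v : V) :=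
      (isApprox_approxRatio hc₀ hc₀₂ hP hc hs hes h v).logClose (by positivity)
    have hnonneg := mul_nonneg (exactRatio_mem_Icc hP' hc₁ hs hes x).1
      (exactRatio_mem_Icc hP' hc₁ hsx hes y).1
    have hstep := (((hratio hs x).mul (hratio hsx y)).const_add hl₀ hnonneg).mul hrec
    rw [listZ_cons_eq_mul hc_pos (fun e he => one_pos.trans_le (hes e he)) hF, topWeight,
      approxProd]
    convert hstep using 1
    · push_cast [List.length_cons]
      ring
    · ring

end ApproxError

/-! ## Fibonacci functions -/

section FibSeq

variable {R : Type*} [CommSemiring R]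

/-- The Fibonacci sequence with parameter `c` and given first two values. -/
def fibSeq (c : R) (f : R × R) : ℕ → R
  | 0 => f.1
  | 1 => f.2
  | n + 2 => c * fibSeq c f (n + 1) + fibSeq c f n

theorem fibSeq_zero (c : R) (n : ℕ) : fibSeq c 0 n = 0 := by
  induction n using Nat.twoStepInduction with
  | zero => rfl
  | one => rfl
  | more n ih ih' => simp [fibSeq, ih, ih']

theorem fibSeq_shift (c : R) (f : R × R) (n : ℕ) :
    fibSeq c (f.2, c * f.2 + f.1) n = fibSeq c f (n + 1) := by
  induction n using Nat.twoStepInduction with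
  | zero => rfl
  | one => rfl
  | more n ih ih' => rw [fibSeq, ih, ih', ← fibSeq]

variable {V : Type*} [DecidableEq V]

theorem fibSeq_shiftAt (c : V → R) (u v : V) (F : V → R × R) (n : ℕ) :
    fibSeq (c v) (shiftAt c u F v) n = fibSeq (c v) (F v) (n + if u = v then 1 else 0) := by
  rcases eq_or_ne u v with rfl | h
  · rw [shiftAt_self, fibSeq_shift, if_pos rfl]
  · rw [shiftAt_of_ne c h.symm, if_neg h, add_zero]

/-- The number of ends at `v` of edges with the value `1`. -/
def endCount {m : ℕ} (src tgt : Fin m → V) (σ : Fin m → Bool) (v : V) : ℕ :=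
  ∑ e, if σ e = true then (if src e = v then 1 else 0) + (if tgt e = v then 1 else 0) else 0

variable [Fintype V]

theorem listZ_ofFn (c : V → R) {m : ℕ} (src tgt : Fin m → V) (lam : Fin m → R) (F : V → R × R) :
    listZ c (List.ofFn fun e => (src e, tgt e, lam e)) F =
      ∑ σ : Fin m → Bool, (∏ e, if σ e = true then lam e else 1) *
        ∏ v, fibSeq (c v) (F v) (endCount src tgt σ v) := by
  induction m generalizing F with
  | zero => simp [listZ, endCount, fibSeq]
  | succ m ih =>
    rw [List.ofFn_succ, listZ_cons, ih, ih, ← (Fin.consEquiv fun _ => Bool).sum_comp,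
      Fintype.sum_prod_type, Fintype.sum_bool, add_comm, Finset.mul_sum]
    congr 1 <;> refine Finset.sum_congr rfl fun σ _ => ?_
    · simp only [Fin.consEquiv, Equiv.coe_fn_mk, Fin.prod_univ_succ, Fin.cons_zero, Fin.cons_succ,
        if_true, endCount, Fin.sum_univ_succ, fibSeq_shiftAt, mul_assoc]
      congr! 4
      ring
    · simp [Fin.consEquiv, Fin.prod_univ_succ, endCount, Fin.sum_univ_succ]

theorem topWeight_ofFn (c : V → R) {m : ℕ} (src tgt : Fin m → V) (lam : Fin m → R)
    (F : V → R × R) :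
    topWeight c (List.ofFn fun e => (src e, tgt e, lam e)) F =
      ∏ v, fibSeq (c v) (F v) (endCount src tgt (fun _ => true) v) := by
  induction m generalizing F with
  | zero => simp [topWeight, endCount, fibSeq]
  | succ m ih =>
    rw [List.ofFn_succ, topWeight, ih]
    refine Finset.prod_congr rfl fun v _ => ?_
    simp only [fibSeq_shiftAt, endCount, Fin.sum_univ_succ, if_true]
    congr 1
    ring

theorem endCount_eq_weightAt (G : FinGraph) (σ : Fin G.m → Bool) (v : Fin G.n) :
    endCount G.src G.tgt σ v = G.weightAt v σ := by
  simp only [endCount, FinGraph.weightAt, FinGraph.edgesAt, Finset.filter_filter,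
    Finset.card_filter]
  refine Finset.sum_congr rfl fun e _ => ?_
  have := G.loopless e
  by_cases hsrc : G.src e = v <;> by_cases htgt : G.tgt e = v <;> by_cases hσ : σ e = true <;>
    simp_all

theorem endCount_true_eq_deg (G : FinGraph) (v : Fin G.n) :
    endCount G.src G.tgt (fun _ => true) v = G.deg v := by
  rw [endCount_eq_weightAt]
  simp [FinGraph.weightAt, FinGraph.deg]

end FibSeq

section VertexFunction

/-- The first two values of a symmetric function, where a constant `[f₀]` is continued by
`f₁ = f₀`. -/
def firstTwo {K : Type*} : {d : ℕ} → (Fin (d + 1) → K) → K × K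
  | 0, f => (f 0, f 0)
  | _ + 1, f => (f 0, f 1)

/-- The quotient `f₀ / f₁` of a symmetric function. -/
def vertexQuot {K : Type*} [Field K] : {d : ℕ} → (Fin (d + 1) → K) → K
  | 0, _ => 1
  | _ + 1, f => f 0 / f 1

/-- The parameter of a Fibonacci function.  It is arbitrary if the arity is less than `2`. -/
def vertexParam {K : Type*} [Field K] : {d : ℕ} → (Fin (d + 1) → K) → K
  | 0, _ => 2
  | 1, _ => 2
  | _ + 2, f => (f 2 - f 0) / f 1

theorem eq_fibSeq_of_isFibonacci {c : ℝ} {d : ℕ} {f : Fin (d + 1) → ℝ} (h : IsFibonacci c ⟨d, f⟩)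
    {n : ℕ} (hn : n ≤ d) : f ⟨n, Nat.lt_succ_of_le hn⟩ = fibSeq c (firstTwo f) n := by
  induction n using Nat.twoStepInduction with
  | zero => cases d <;> rfl
  | one =>
    obtain ⟨d, rfl⟩ := Nat.exists_eq_add_of_le' hn
    rfl
  | more n ih ih' =>
    rw [fibSeq, ← ih (by omega), ← ih' (by omega)]
    exact h n hn

variable {c₀ p : ℝ} {d : ℕ} {f : Fin (d + 1) → ℝ}

theorem fibonacciFamilyFrom_anti {c₁ : ℝ} (h : c₀ ≤ c₁) :
    fibonacciFamilyFrom c₁ p ⊆ fibonacciFamilyFrom c₀ p :=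
  Set.biUnion_subset_biUnion_left (Set.Ici_subset_Ici.2 h)

theorem nonneg_of_mem_fibonacciFamilyFrom (hf : ⟨d, f⟩ ∈ fibonacciFamilyFrom c₀ p) (i) :
    0 ≤ f i := by
  obtain ⟨c, -, hnonneg, -⟩ := Set.mem_iUnion₂.1 hf
  exact hnonneg i

theorem mul_castSucc_le_succ {f : Fin (d + 2) → ℝ} (hf : ⟨d + 1, f⟩ ∈ fibonacciFamilyFrom c₀ p)
    (i : Fin (d + 1)) : p * f i.castSucc ≤ f i.succ := by
  obtain ⟨c, -, -, -, hp⟩ := Set.mem_iUnion₂.1 hf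
  exact hp i

theorem eq_zero_of_last_eq_zero (hp : 0 < p) (hf : ⟨d, f⟩ ∈ fibonacciFamilyFrom c₀ p)
    (hlast : f (Fin.last d) = 0) (i) : f i = 0 := by
  obtain ⟨c, -, hnonneg, -, hpf⟩ := Set.mem_iUnion₂.1 hf
  induction i using Fin.reverseInduction with
  | last => exact hlast
  | cast i ih =>
    have hmul : p * f i.castSucc ≤ 0 := ih ▸ hpf i
    exact le_antisymm (nonpos_of_mul_nonpos_right hmul hp) (hnonneg _)

theorem second_pos {f : Fin (d + 2) → ℝ} (hp : 0 < p) (hf : ⟨d + 1, f⟩ ∈ fibonacciFamilyFrom c₀ p)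
    (hlast : f (Fin.last _) ≠ 0) : 0 < f 1 := by
  refine (nonneg_of_mem_fibonacciFamilyFrom hf 1).lt_of_ne' fun hf₁ => hlast ?_
  have hmul : p * f 0 ≤ 0 := hf₁ ▸ mul_castSucc_le_succ hf 0
  have hf₀ : f 0 = 0 :=
    le_antisymm (nonpos_of_mul_nonpos_right hmul hp) (nonneg_of_mem_fibonacciFamilyFrom hf 0)
  obtain ⟨c, -, -, hfib, -⟩ := Set.mem_iUnion₂.1 hf
  rw [show Fin.last _ = ⟨d + 1, Nat.lt_succ_self _⟩ from rfl,
    eq_fibSeq_of_isFibonacci hfib le_rfl, firstTwo, hf₀, hf₁]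
  exact fibSeq_zero c _

theorem firstTwo_nonneg_pos (hp : 0 < p) (hf : ⟨d, f⟩ ∈ fibonacciFamilyFrom c₀ p)
    (hlast : f (Fin.last d) ≠ 0) : 0 ≤ (firstTwo f).1 ∧ 0 < (firstTwo f).2 := by
  cases d with
  | zero =>
    have hf₀ := nonneg_of_mem_fibonacciFamilyFrom hf 0
    exact ⟨hf₀, hf₀.lt_of_ne' hlast⟩
  | succ d => exact ⟨nonneg_of_mem_fibonacciFamilyFrom hf 0, second_pos hp hf hlast⟩

theorem firstTwo_fst_div_snd (hlast : f (Fin.last d) ≠ 0) :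
    (firstTwo f).1 / (firstTwo f).2 = vertexQuot f := by
  cases d with
  | zero => exact div_self hlast
  | succ d => rfl

theorem vertexQuot_le {P : ℝ} (hp : 0 < p) (hP : 1 ≤ P) (hpP : p⁻¹ ≤ P)
    (hf : ⟨d, f⟩ ∈ fibonacciFamilyFrom c₀ p) (hlast : f (Fin.last d) ≠ 0) : vertexQuot f ≤ P := by
  cases d with
  | zero => exact hP
  | succ d =>
    refine le_trans ?_ hpP
    rw [vertexQuot, div_le_iff₀ (second_pos hp hf hlast), le_inv_mul_iff₀ hp]
    exact mul_castSucc_le_succ hf 0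

theorem le_vertexParam_and_isFibonacci (hc₀ : c₀ ≤ 2) (hp : 0 < p)
    (hf : ⟨d, f⟩ ∈ fibonacciFamilyFrom c₀ p) (hlast : f (Fin.last d) ≠ 0) :
    c₀ ≤ vertexParam f ∧ IsFibonacci (vertexParam f) ⟨d, f⟩ := by
  match d, f with
  | 0, f => exact ⟨hc₀, fun i hi => absurd hi (by simp)⟩
  | 1, f => exact ⟨hc₀, fun i hi => absurd hi (by simp)⟩
  | d + 2, f =>
    have hf₁ := (second_pos hp hf hlast).ne'
    obtain ⟨c, hc, -, hfib, -⟩ := Set.mem_iUnion₂.1 hf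
    have hf₂ : f 2 = c * f 1 + f 0 := hfib 0 (by simp)
    have hparam : vertexParam f = c := by
      rw [vertexParam, hf₂, add_sub_cancel_right, mul_div_cancel_right₀ _ hf₁]
    exact hparam ▸ ⟨hc, hfib⟩

end VertexFunction

/-! ## Holant instances as edge lists -/

section Instance

variable {K : Type}

/-- The weighted edges of an instance. -/
def edgeList (Ω : HolantInstance K) : List (WeightedEdge (Fin Ω.G.n) K) :=
  List.ofFn fun e => (Ω.G.src e, Ω.G.tgt e, Ω.lam e)

theorem forall_weight_edgeList {Ω : HolantInstance K} {q : K → Prop} (h : ∀ e, q (Ω.lam e)) :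
    ∀ e ∈ edgeList Ω, q e.2.2 := by
  simpa [edgeList, List.forall_mem_ofFn_iff] using h

/-- The product of the last values of the vertex functions. -/
def topProd [CommSemiring K] (Ω : HolantInstance K) : K := ∏ v, Ω.sig v (Fin.last _)

/-- The approximation to the partition function with `h` evaluated levels. -/
def approxZ [Field K] [LinearOrder K] (θ : K) (P h : ℕ) (Ω : HolantInstance K) : K :=
  topProd Ω *
    approxProd θ (fun v => vertexParam (Ω.sig v)) (levelList P h) (fun v => vertexQuot (Ω.sig v))
      (edgeList Ω)

variable {Ω : HolantInstance ℝ} {c₀ p : ℝ}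

theorem Z_eq_zero_of_topProd_eq_zero (hp : 0 < p)
    (hΩ : Ω.IsInputOf (fibonacciFamilyFrom c₀ p) (Set.Ici 1)) (h : topProd Ω = 0) : Ω.Z = 0 := by
  obtain ⟨v, -, hv⟩ := Finset.prod_eq_zero_iff.1 h
  exact Finset.sum_eq_zero fun σ _ => mul_eq_zero_of_right _ <|
    Finset.prod_eq_zero (Finset.mem_univ v) (eq_zero_of_last_eq_zero hp (hΩ.1 v) hv _)

theorem Z_nonneg (hΩ : Ω.IsInputOf (fibonacciFamilyFrom c₀ p) (Set.Ici 1)) : 0 ≤ Ω.Z := by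
  refine Finset.sum_nonneg fun σ _ => mul_nonneg (Finset.prod_nonneg fun e _ => ?_)
    (Finset.prod_nonneg fun v _ => nonneg_of_mem_fibonacciFamilyFrom (hΩ.1 v) _)
  have : 1 ≤ Ω.lam e := hΩ.2 e
  split_ifs <;> linarith

theorem listZ_edgeList {c : Fin Ω.G.n → ℝ} (hc : ∀ v, IsFibonacci (c v) ⟨_, Ω.sig v⟩) :
    listZ c (edgeList Ω) (fun v => firstTwo (Ω.sig v)) = Ω.Z := by
  rw [edgeList, listZ_ofFn, HolantInstance.Z]
  congr! 3 with σ _ v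
  rw [endCount_eq_weightAt]
  exact (eq_fibSeq_of_isFibonacci (hc v) (Nat.lt_succ_iff.1 (Ω.G.weightAt v σ).2)).symm

theorem topWeight_edgeList {c : Fin Ω.G.n → ℝ} (hc : ∀ v, IsFibonacci (c v) ⟨_, Ω.sig v⟩) :
    topWeight c (edgeList Ω) (fun v => firstTwo (Ω.sig v)) = topProd Ω := by
  rw [edgeList, topWeight_ofFn, topProd]
  congr! with v
  rw [endCount_true_eq_deg]
  exact (eq_fibSeq_of_isFibonacci (hc v) le_rfl).symm

theorem logClose_approxZ {P : ℕ} (hc₀ : 1 < c₀) (hc₀₂ : c₀ ≤ 2) (hp : 0 < p) (hP : 1 ≤ P)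
    (hpP : p⁻¹ ≤ P) (hΩ : Ω.IsInputOf (fibonacciFamilyFrom c₀ p) (Set.Ici 1))
    (h : topProd Ω ≠ 0) (k : ℕ) :
    LogClose (Ω.G.m * (2 * (decayRate c₀ P ^ k * defaultError P))) (approxZ c₀⁻¹ P k Ω) Ω.Z := by
  have hlast : ∀ v, Ω.sig v (Fin.last _) ≠ 0 := fun v =>
    Finset.prod_ne_zero_iff.1 h v (Finset.mem_univ v)
  have hP' : (1 : ℝ) ≤ P := by exact_mod_cast hP
  have hparam := fun v => le_vertexParam_and_isFibonacci hc₀₂ hp (hΩ.1 v) (hlast v)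
  have hquot := fun v => firstTwo_fst_div_snd (hlast v)
  have hclose := logClose_approxProd hc₀ hc₀₂ hP (fun v => (hparam v).1) k
    (forall_weight_edgeList hΩ.2) (fun v => firstTwo_nonneg_pos hp (hΩ.1 v) (hlast v))
    fun v => (hquot v).trans_le (vertexQuot_le hp hP' hpP (hΩ.1 v) (hlast v))
  rw [listZ_edgeList fun v => (hparam v).2, topWeight_edgeList fun v => (hparam v).2,
    funext hquot, edgeList, List.length_ofFn] at hclose
  exact hclose

end Instance

/-! ## Change of the field -/

section Map

variable {V K L : Type*}

/-- Applies a function to the weights of the edges. -/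
def mapWeights (φ : K → L) (es : List (WeightedEdge V K)) : List (WeightedEdge V L) :=
  es.map (Prod.map id (Prod.map id φ))

theorem pickEdge_mapWeights [DecidableEq V] (φ : K → L) (v : V) (es : List (WeightedEdge V K)) :
    pickEdge v (mapWeights φ es) =
      (pickEdge v es).map fun r => (r.1.map id φ, mapWeights φ r.2) := by
  induction es with
  | nil => rfl
  | cons e es ih =>
    obtain ⟨x, y, l⟩ := e
    rw [mapWeights, List.map_cons, ← mapWeights, Prod.map_apply, Prod.map_apply, id, id, pickEdge,
      pickEdge, ih]
    split_ifs
    · rfl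
    · rfl
    · simp [Option.map_map, Function.comp_def, mapWeights]

variable [Field K] [Field L] (φ : K →+* L)

theorem ratioStep_map (l c a b₀ b₁ : K) :
    ratioStep (φ l) (φ c) (φ a) (φ b₀) (φ b₁) = φ (ratioStep l c a b₀ b₁) := by
  simp [ratioStep]

theorem vertexQuot_map {d : ℕ} (f : Fin (d + 1) → K) :
    vertexQuot (fun i => φ (f i)) = φ (vertexQuot f) := by
  cases d <;> simp [vertexQuot]

theorem vertexParam_map {d : ℕ} (f : Fin (d + 1) → K) :
    vertexParam (fun i => φ (f i)) = φ (vertexParam f) := by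
  match d with
  | 0 => exact (map_ofNat φ 2).symm
  | 1 => exact (map_ofNat φ 2).symm
  | _ + 2 => simp [vertexParam]

variable [DecidableEq V]

theorem pin_map (c s : V → K) (u : V) : pin (φ ∘ c) (φ ∘ s) u = φ ∘ pin c s u := by
  rw [pin, pin, Function.comp_update]
  simp

variable [LinearOrder K] [LinearOrder L] {φ}

theorem approxRatio_map (hφ : StrictMono φ) (θ : K) (c : V → K) (ls : List Bool) (s : V → K)
    (es : List (WeightedEdge V K)) (v : V) :
    approxRatio (φ θ) (φ ∘ c) ls (φ ∘ s) (mapWeights φ es) v =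
      (approxRatio θ c ls s es v).map id φ := by
  induction ls generalizing s es v with
  | nil => cases h : pickEdge v es <;> simp [approxRatio, pickEdge_mapWeights, h]
  | cons b ls ih =>
    have hmap := pickEdge_mapWeights φ v es
    cases h : pickEdge v es with
    | none =>
      rw [h] at hmap
      rw [approxRatio_of_pickEdge_eq_none _ _ _ _ h, approxRatio_of_pickEdge_eq_none _ _ _ _ hmap]
      rfl
    | some r =>
      obtain ⟨⟨u, l⟩, rest⟩ := r
      rw [h] at hmap
      rw [approxRatio_of_pickEdge_eq_some _ _ _ b ls h,
        approxRatio_of_pickEdge_eq_some _ _ _ b ls hmap, pin_map, pin_map, ih, ih, ih]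
      simp only [Prod.map_fst, Prod.map_snd, id, Function.comp_apply, ratioStep_map]
      split_ifs <;> simp [hφ.monotone.map_min]

theorem approxProd_map (hφ : StrictMono φ) (θ : K) (c : V → K) (ls : List Bool) (s : V → K)
    (es : List (WeightedEdge V K)) :
    approxProd (φ θ) (φ ∘ c) ls (φ ∘ s) (mapWeights φ es) = φ (approxProd θ c ls s es) := by
  induction es generalizing s with
  | nil => exact (map_one φ).symm
  | cons e es ih =>
    rw [mapWeights, List.map_cons, ← mapWeights]
    simp [approxProd, pin_map, approxRatio_map hφ, ih]

end Map

section InstanceMap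

variable {K L : Type} [Field K] [Field L] {φ : K →+* L}

theorem topProd_map (φ : K →+* L) (Ω : HolantInstance K) : topProd (Ω.map φ) = φ (topProd Ω) :=
  (map_prod φ _ _).symm

theorem approxZ_map [LinearOrder K] [LinearOrder L] (hφ : StrictMono φ) (θ : K) (P h : ℕ)
    (Ω : HolantInstance K) : approxZ (φ θ) P h (Ω.map φ) = φ (approxZ θ P h Ω) := by
  have hedges : edgeList (Ω.map φ) = mapWeights φ (edgeList Ω) := by
    simp only [edgeList, mapWeights, List.map_ofFn]
    rfl
  rw [approxZ, approxZ, topProd_map, map_mul, hedges, ← approxProd_map hφ]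
  congr 2 with v
  · exact vertexParam_map φ (Ω.sig v)
  · exact vertexQuot_map φ (Ω.sig v)

end InstanceMap

/-! ## The accuracy of the approximation -/

section Accuracy

open Real

theorem relApprox_of_logClose {ε E Z z : ℝ} (hε : 0 < ε) (hE : E ≤ ε / (2 * (1 + ε)))
    (hZ : 0 ≤ Z) (h : LogClose E z Z) : RelApprox ε Z z := by
  obtain ⟨β, hβ, rfl⟩ := h
  refine ⟨fun hZ => by rw [hZ, zero_mul], fun hZ' => ?_⟩
  replace hZ : 0 < Z := hZ.lt_of_ne' hZ'
  obtain ⟨hβ_ge, hβ_le⟩ := abs_le.1 (hβ.trans hE)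
  have hhalf : ε / (2 * (1 + ε)) < ε / (1 + ε) := by
    gcongr
    linarith
  have hlt : ε / (1 + ε) < ε := div_lt_self hε (by linarith)
  have hlower : 1 - ε < exp β := by linarith [add_one_le_exp β]
  have hupper : exp β < 1 + ε := by
    have hinv : (1 + ε)⁻¹ = 1 - ε / (1 + ε) := by
      field_simp
      ring
    rw [← inv_lt_inv₀ (by linarith) (exp_pos β), ← exp_neg, hinv]
    linarith [add_one_le_exp (-β)]
  rw [mul_comm Z]
  exact ⟨by gcongr, by gcongr⟩

end Accuracy

/-! ## Evaluation with bounded cost -/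

section Runs

variable {K : Type} [Field K] [LinearOrder K]

/-- `e` evaluates to `v` at cost at most `T`. -/
def Runs (w : K → ℕ) (P : Program) (env : List (Val K)) (e : Expr) (v : Val K) (T : ℕ) : Prop :=
  ∃ t, t ≤ T ∧ Eval w P env e v t

/-- A measure `μ` of the size of numbers that is comparable to the length `w` and is subadditive,
up to a constant, under the arithmetic operations. -/
structure LengthBound (w μ : K → ℕ) : Prop where
  length_le : ∀ x, w x ≤ 2 * μ x
  le_length : ∀ x, μ x ≤ w x
  result_le : ∀ {o : ArithOp} {x y z}, o.result x y z → μ z ≤ μ x + μ y + 1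

/-- `e` evaluates to the number `x` of size at most `q` at cost at most `T`. -/
def RunsNum (w μ : K → ℕ) (P : Program) (env : List (Val K)) (e : Expr) (x : K) (q T : ℕ) : Prop :=
  Runs w P env e (.num x) T ∧ μ x ≤ q

/-- Comparison of two numbers for equality. -/
def ifEq (a b c d : Expr) : Expr := .ifLt a b d (.ifLt b a d c)

variable {w μ : K → ℕ} {P : Program} {env : List (Val K)} {a b c d : Expr} {u v : Val K}
  {q r s t T : ℕ} {x y z : K}

namespace Runs

theorem mono (h : Runs w P env a v s) (hst : s ≤ t) : Runs w P env a v t := by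
  obtain ⟨k, hk, hk'⟩ := h
  exact ⟨k, hk.trans hst, hk'⟩

theorem var {i : ℕ} (h : env[i]? = some v) : Runs w P env (.var i) v 1 := ⟨1, le_rfl, .var h⟩

theorem const (q : ℚ) (h : (q : K) = x) : Runs w P env (.const q) (.num x) 1 :=
  ⟨1, le_rfl, h ▸ .const⟩

theorem nil : Runs w P env .nil .nil 1 := ⟨1, le_rfl, .nil⟩

theorem pair (ha : Runs w P env a u s) (hb : Runs w P env b v t) :
    Runs w P env (.pair a b) (.pair u v) (s + t + 1) := by
  obtain ⟨s', hs, ha⟩ := ha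
  obtain ⟨t', ht, hb⟩ := hb
  exact ⟨_, by omega, .pair ha hb⟩

theorem fst (ha : Runs w P env a (.pair u v) s) : Runs w P env (.fst a) u (s + 1) := by
  obtain ⟨s', hs, ha⟩ := ha
  exact ⟨_, by omega, .fst ha⟩

theorem snd (ha : Runs w P env a (.pair u v) s) : Runs w P env (.snd a) v (s + 1) := by
  obtain ⟨s', hs, ha⟩ := ha
  exact ⟨_, by omega, .snd ha⟩

theorem arith {o : ArithOp} (ha : Runs w P env a (.num x) s) (hb : Runs w P env b (.num y) t)
    (hr : o.result x y z) : Runs w P env (.arith o a b) (.num z) (s + t + w x + w y + 1) := by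
  obtain ⟨s', hs, ha⟩ := ha
  obtain ⟨t', ht, hb⟩ := hb
  exact ⟨_, by omega, .arith ha hb hr⟩

theorem letIn (ha : Runs w P env a u s) (hb : Runs w P (u :: env) b v t) :
    Runs w P env (.letIn a b) v (s + t + 1) := by
  obtain ⟨s', hs, ha⟩ := ha
  obtain ⟨t', ht, hb⟩ := hb
  exact ⟨_, by omega, .letIn ha hb⟩

theorem ifNil_pos (ha : Runs w P env a .nil s) (hb : Runs w P env b v t) :
    Runs w P env (.ifNil a b c) v (s + t + 1) := by
  obtain ⟨s', hs, ha⟩ := ha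
  obtain ⟨t', ht, hb⟩ := hb
  exact ⟨_, by omega, .ifNil_pos ha hb⟩

theorem ifNil_neg {u' : Val K} (ha : Runs w P env a (.pair u u') s) (hc : Runs w P env c v t) :
    Runs w P env (.ifNil a b c) v (s + t + 1) := by
  obtain ⟨s', hs, ha⟩ := ha
  obtain ⟨t', ht, hc⟩ := hc
  exact ⟨_, by omega, .ifNil_neg ha (by simp) hc⟩

theorem ifLt_pos (ha : Runs w P env a (.num x) s) (hb : Runs w P env b (.num y) t) (h : x < y)
    (hc : Runs w P env c v r) :
    Runs w P env (.ifLt a b c d) v (s + t + r + w x + w y + 1) := by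
  obtain ⟨s', hs, ha⟩ := ha
  obtain ⟨t', ht, hb⟩ := hb
  obtain ⟨r', hr, hc⟩ := hc
  exact ⟨_, by omega, .ifLt_pos ha hb h hc⟩

theorem ifLt_neg (ha : Runs w P env a (.num x) s) (hb : Runs w P env b (.num y) t) (h : ¬ x < y)
    (hd : Runs w P env d v r) :
    Runs w P env (.ifLt a b c d) v (s + t + r + w x + w y + 1) := by
  obtain ⟨s', hs, ha⟩ := ha
  obtain ⟨t', ht, hb⟩ := hb
  obtain ⟨r', hr, hd⟩ := hd
  exact ⟨_, by omega, .ifLt_neg ha hb h hd⟩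

theorem call {f : ℕ} (ha : Runs w P env a u s) (hf : P[f]? = some b) (hb : Runs w P [u] b v t) :
    Runs w P env (.call f a) v (s + t + 1) := by
  obtain ⟨s', hs, ha⟩ := ha
  obtain ⟨t', ht, hb⟩ := hb
  exact ⟨_, by omega, .call ha hf hb⟩

theorem ifEq_pos (ha : Runs w P env a (.num x) s) (hb : Runs w P env b (.num y) t) (h : x = y)
    (hc : Runs w P env c v r) :
    Runs w P env (ifEq a b c d) v (2 * (s + t + w x + w y + 1) + r) :=
  (ifLt_neg ha hb (by simp [h]) (ifLt_neg hb ha (by simp [h]) hc)).mono (by omega)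

theorem ifEq_neg (ha : Runs w P env a (.num x) s) (hb : Runs w P env b (.num y) t) (h : x ≠ y)
    (hd : Runs w P env d v r) :
    Runs w P env (ifEq a b c d) v (2 * (s + t + w x + w y + 1) + r) := by
  rcases lt_or_gt_of_ne h with h | h
  · exact (ifLt_pos ha hb h hd).mono (by omega)
  · exact (ifLt_neg ha hb (by simp [h.le]) (ifLt_pos hb ha h hd)).mono (by omega)

end Runs

namespace RunsNum

theorem mono (h : RunsNum w μ P env a x q s) (hqr : q ≤ r) (hst : s ≤ t) :
    RunsNum w μ P env a x r t :=
  ⟨h.1.mono hst, h.2.trans hqr⟩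

theorem const (k : ℚ) (h : (k : K) = x) (hx : μ x ≤ q) : RunsNum w μ P env (.const k) x q 1 :=
  ⟨.const k h, hx⟩

theorem arith {o : ArithOp} (hμ : LengthBound w μ) (ha : RunsNum w μ P env a x q s)
    (hb : RunsNum w μ P env b y r t) (hz : o.result x y z) :
    RunsNum w μ P env (.arith o a b) z (q + r + 1) (s + t + 2 * (q + r) + 1) := by
  have hx := (hμ.length_le x).trans (Nat.mul_le_mul_left 2 ha.2)
  have hy := (hμ.length_le y).trans (Nat.mul_le_mul_left 2 hb.2)
  refine ⟨(ha.1.arith hb.1 hz).mono (by omega), (hμ.result_le hz).trans ?_⟩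
  have := ha.2
  have := hb.2
  omega

theorem add (hμ : LengthBound w μ) (ha : RunsNum w μ P env a x q s)
    (hb : RunsNum w μ P env b y r t) :
    RunsNum w μ P env (.arith .add a b) (x + y) (q + r + 1) (s + t + 2 * (q + r) + 1) :=
  ha.arith hμ hb rfl

theorem sub (hμ : LengthBound w μ) (ha : RunsNum w μ P env a x q s)
    (hb : RunsNum w μ P env b y r t) :
    RunsNum w μ P env (.arith .sub a b) (x - y) (q + r + 1) (s + t + 2 * (q + r) + 1) :=
  ha.arith hμ hb rfl

theorem mul (hμ : LengthBound w μ) (ha : RunsNum w μ P env a x q s)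
    (hb : RunsNum w μ P env b y r t) :
    RunsNum w μ P env (.arith .mul a b) (x * y) (q + r + 1) (s + t + 2 * (q + r) + 1) :=
  ha.arith hμ hb rfl

theorem div (hμ : LengthBound w μ) (ha : RunsNum w μ P env a x q s)
    (hb : RunsNum w μ P env b y r t) (hy : y ≠ 0) :
    RunsNum w μ P env (.arith .div a b) (x / y) (q + r + 1) (s + t + 2 * (q + r) + 1) :=
  ha.arith hμ hb ⟨hy, rfl⟩

theorem ifLt (hμ : LengthBound w μ) (ha : RunsNum w μ P env a x q s)
    (hb : RunsNum w μ P env b y r t) (hc : x < y → Runs w P env c v T)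
    (hd : ¬ x < y → Runs w P env d v T) :
    Runs w P env (.ifLt a b c d) v (s + t + T + 2 * (q + r) + 1) := by
  have hx := (hμ.length_le x).trans (Nat.mul_le_mul_left 2 ha.2)
  have hy := (hμ.length_le y).trans (Nat.mul_le_mul_left 2 hb.2)
  by_cases hxy : x < y
  · exact (ha.1.ifLt_pos hb.1 hxy (hc hxy)).mono (by omega)
  · exact (ha.1.ifLt_neg hb.1 hxy (hd hxy)).mono (by omega)

end RunsNum

end Runs

/-! ## The program -/

/-- The functions of the program. -/
inductive Fn
  | main | lookup | pick | pin | ratio | topProd | last | init | params | levels | scale | prod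

/-- The call of a function of the program. -/
abbrev Fn.call (f : Fn) (a : Expr) : Expr := .call f.ctorIdx a

section Program

open Expr

/-- The sublist of levels in a triple of a list of levels, a state and an edge list. -/
abbrev levelsOf (a : Expr) : Expr := fst a

/-- The state in a triple of a list of levels, a state and an edge list. -/
abbrev stateOf (a : Expr) : Expr := fst (snd a)

/-- The edge list in a triple of a list of levels, a state and an edge list. -/
abbrev edgesOf (a : Expr) : Expr := snd (snd a)

/-- `(v, st) ↦` the pair stored under the key `v` in the association list `st`. -/
def lookupBody : Expr :=
  letIn (fst (snd (var 0)))
    (ifEq (fst (var 0)) (fst (var 1)) (snd (var 0))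
      (Fn.lookup.call (pair (fst (var 1)) (snd (snd (var 1))))))

/-- `(v, es) ↦ pickEdge v es`. -/
def pickBody : Expr :=
  ifNil (snd (var 0)) nil
    (letIn (fst (snd (var 0)))
      (ifEq (fst (var 0)) (fst (var 1)) (pair (snd (var 0)) (snd (snd (var 1))))
        (ifEq (fst (snd (var 0))) (fst (var 1))
          (pair (pair (fst (var 0)) (snd (snd (var 0)))) (snd (snd (var 1))))
          (letIn (Fn.pick.call (pair (fst (var 1)) (snd (snd (var 1)))))
            (ifNil (var 0) nil (pair (fst (var 0)) (pair (var 1) (snd (var 0)))))))))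

/-- `(v, st) ↦` the state `st` after `pin` at `v`. -/
def pinBody : Expr :=
  letIn (Fn.lookup.call (var 0))
    (pair (pair (fst (var 1))
      (pair (arith .div (const 1) (arith .add (snd (var 0)) (fst (var 0)))) (snd (var 0))))
      (snd (var 1)))

/-- The disjunction of two truth values, where `nil` stands for `false`. -/
def orExpr (a b : Expr) : Expr := ifNil a b a

/-- The code for `ratioStep`. -/
def stepExpr (l c a b₀ b₁ : Expr) : Expr :=
  arith .div (arith .add (const 1) (arith .mul (arith .div a l) b₀))
    (arith .add c (arith .add (arith .div a l) b₁))

/-- The last step of `approxRatio`: `deep` tells whether branches have been truncated, `keep`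
whether the value `x` is kept and cut off, or replaced by `1 / c`. -/
def truncateExpr (θ : ℚ) (deep keep x c : Expr) : Expr :=
  ifNil deep (pair nil x)
    (pair deep (ifNil keep (arith .div (const 1) c) (ifLt (const θ) x (const θ) x)))

/-- The call of `ratio` at the vertex `v`. -/
abbrev ratioCall (v ls st es : Expr) : Expr := Fn.ratio.call (pair v (pair ls (pair st es)))

/-- The value of `approxRatio` from the results of the recursive calls.  The environment holds
these three results, the stored values of the vertex, the result of `pick`, and the argument. -/
def combineRatio (θ : ℚ) : Expr :=
  letIn (stepExpr (snd (fst (var 4))) (snd (var 3)) (snd (var 2)) (snd (var 1)) (snd (var 0)))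
    (letIn (orExpr (fst (var 3)) (fst (var 2)))
      (truncateExpr θ (var 0) (fst (levelsOf (snd (var 7)))) (var 1) (snd (var 5))))

/-- The recursive calls of `ratio`.  The environment holds the stored values of the vertex, the
result of `pick`, and the argument. -/
def recurRatio (θ : ℚ) : Expr :=
  letIn (ratioCall (fst (fst (var 1))) (snd (levelsOf (snd (var 2))))
      (Fn.pin.call (pair (fst (var 2)) (stateOf (snd (var 2))))) (snd (var 1)))
    (letIn (ratioCall (fst (var 3)) (snd (levelsOf (snd (var 3)))) (stateOf (snd (var 3)))
        (snd (var 2)))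
      (letIn (ratioCall (fst (var 4)) (snd (levelsOf (snd (var 4))))
          (Fn.pin.call (pair (fst (fst (var 3))) (stateOf (snd (var 4))))) (snd (var 3)))
        (combineRatio θ)))

/-- `(v, ls, st, es) ↦ approxRatio`, if `pick` succeeds.  The environment is that of
`recurRatio`. -/
def splitRatio (θ : ℚ) : Expr :=
  ifNil (levelsOf (snd (var 2))) (pair (pair nil nil) (arith .div (const 1) (snd (var 0))))
    (recurRatio θ)

/-- `(v, ls, st, es) ↦ approxRatio`. -/
def ratioBody (θ : ℚ) : Expr :=
  letIn (Fn.pick.call (pair (fst (var 0)) (edgesOf (snd (var 0)))))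
    (letIn (Fn.lookup.call (pair (fst (var 1)) (stateOf (snd (var 1)))))
      (ifNil (var 1) (pair nil (fst (var 0))) (splitRatio θ)))

/-- The product of the last entries of a list of lists. -/
def topProdBody : Expr :=
  ifNil (var 0) (const 1)
    (arith .mul (Fn.last.call (fst (var 0))) (Fn.topProd.call (snd (var 0))))

/-- The last entry of a list. -/
def lastBody : Expr := ifNil (snd (var 0)) (fst (var 0)) (Fn.last.call (snd (var 0)))

/-- `(i, L) ↦` the initial state of the vertices `i, i + 1, …` with the functions in `L`. -/
def initBody : Expr :=
  ifNil (snd (var 0)) nil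
    (pair (pair (fst (var 0)) (Fn.params.call (fst (snd (var 0)))))
      (Fn.init.call (pair (arith .add (fst (var 0)) (const 1)) (snd (snd (var 0))))))

/-- `vertexQuot` and `vertexParam` of a list of values. -/
def paramsBody : Expr :=
  ifNil (snd (var 0)) (pair (const 1) (const 2))
    (pair (arith .div (fst (var 0)) (fst (snd (var 0))))
      (ifNil (snd (snd (var 0))) (const 2)
        (arith .div (arith .sub (fst (snd (snd (var 0)))) (fst (var 0))) (fst (snd (var 0))))))

/-- The encoding of `n` levels that are only explored. -/
def lowLevels : ℕ → Expr
  | 0 => nil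
  | n + 1 => pair nil (lowLevels n)

/-- `t ↦ levelList P h`, where `h` is the least number with `κ ^ h * t < 1`. -/
def levelsBody (P : ℕ) (κ : ℚ) : Expr :=
  ifLt (var 0) (const 1) (lowLevels (2 * P))
    (pair (pair nil nil) (Fn.levels.call (arith .mul (const κ) (var 0))))

/-- `(t, l) ↦ (length l + 1) * t`. -/
def scaleBody : Expr :=
  ifNil (snd (var 0)) (fst (var 0))
    (arith .add (fst (var 0)) (Fn.scale.call (pair (fst (var 0)) (snd (snd (var 0))))))

/-- The factor of `approxProd` for an edge.  The environment holds the state after `pin` at the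
first end of the edge, the edge, and the argument of `prod`. -/
def factorExpr : Expr :=
  arith .add (snd (snd (var 1)))
    (arith .mul
      (snd (ratioCall (fst (var 1)) (levelsOf (var 2)) (stateOf (var 2)) (snd (edgesOf (var 2)))))
      (snd (ratioCall (fst (snd (var 1))) (levelsOf (var 2)) (var 0) (snd (edgesOf (var 2))))))

/-- `(ls, st, es) ↦ approxProd`. -/
def prodBody : Expr :=
  ifNil (edgesOf (var 0)) (const 1)
    (letIn (fst (edgesOf (var 0)))
      (letIn (Fn.pin.call (pair (fst (var 0)) (stateOf (var 1))))
        (arith .mul factorExpr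
          (Fn.prod.call (pair (levelsOf (var 2))
            (pair (Fn.pin.call (pair (fst (snd (var 1))) (var 0))) (snd (edgesOf (var 2)))))))))

/-- The code for `approxZ` with enough levels for the relative error `ε`, where `k` is a bound for
the initial error at every edge.  The environment holds `topProd` and the argument of `main`. -/
def approxExpr (k : ℕ) : Expr :=
  arith .mul (var 0)
    (Fn.prod.call (pair
      (Fn.levels.call (Fn.scale.call (pair
        (arith .mul (const k) (arith .add (const 1) (arith .div (const 1) (fst (var 1)))))
        (snd (snd (var 1))))))
      (pair (Fn.init.call (pair (const 0) (fst (snd (var 1))))) (snd (snd (var 1))))))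

/-- `(ε, F, es) ↦ approxZ`, or `0` if `topProd` is not positive. -/
def mainBody (k : ℕ) : Expr :=
  letIn (Fn.topProd.call (fst (snd (var 0))))
    (ifLt (const 0) (var 0) (approxExpr k) (const 0))

/-- The bodies of the functions for the families `𝓕_{c₀, +∞}^p` with `p⁻¹ ≤ P`. -/
def body (P : ℕ) (c₀ : ℚ) : Fn → Expr
  | .main => mainBody (4 * defaultError P)
  | .lookup => lookupBody
  | .pick => pickBody
  | .pin => pinBody
  | .ratio => ratioBody c₀⁻¹
  | .topProd => topProdBody
  | .last => lastBody
  | .init => initBody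
  | .params => paramsBody
  | .levels => levelsBody P (decayRate c₀ P)
  | .scale => scaleBody
  | .prod => prodBody

/-- The approximation scheme for the families `𝓕_{c₀, +∞}^p` with `p⁻¹ ≤ P`. -/
def program (P : ℕ) (c₀ : ℚ) : Program :=
  [Fn.main, .lookup, .pick, .pin, .ratio, .topProd, .last, .init, .params, .levels, .scale,
    .prod].map (body P c₀)

theorem getElem?_program (P : ℕ) (c₀ : ℚ) (f : Fn) :
    (program P c₀)[f.ctorIdx]? = some (body P c₀ f) := by
  cases f <;> rfl

end Program

section Encoding

variable {V : Type*} {K : Type}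

/-- The datum that stands for an edge, if the vertices have the numbers `key`. -/
def encEdge (key : V → K) (e : WeightedEdge V K) : Val K :=
  .pair (.num (key e.1)) (.pair (.num (key e.2.1)) (.num e.2.2))

/-- The datum that stands for an edge list. -/
def encEdges (key : V → K) (es : List (WeightedEdge V K)) : Val K :=
  .ofList (es.map (encEdge key))

/-- The datum that stands for an entry of a state: a vertex, its quotient and its parameter. -/
def encEntry (key : V → K) (e : V × K × K) : Val K :=
  .pair (.num (key e.1)) (.pair (.num e.2.1) (.num e.2.2))

/-- The datum that stands for a state, an association list of the quotients and parameters. -/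
def encState (key : V → K) (st : List (V × K × K)) : Val K := .ofList (st.map (encEntry key))

/-- The datum that stands for a truth value. -/
def encBool (b : Bool) : Val K := if b then .pair .nil .nil else .nil

/-- The datum that stands for a list of levels. -/
def encLevels (ls : List Bool) : Val K := .ofList (ls.map encBool)

/-- The triple that `levelsOf`, `stateOf` and `edgesOf` take apart. -/
def encContext (key : V → K) (ls : List Bool) (st : List (V × K × K))
    (es : List (WeightedEdge V K)) : Val K :=
  .pair (encLevels ls) (.pair (encState key st) (encEdges key es))

/-- The datum that stands for a result of `approxRatio`. -/
def encResult (r : Bool × K) : Val K := .pair (encBool r.1) (.num r.2)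

/-- The datum that stands for a result of `pickEdge`. -/
def encPick (key : V → K) : Option ((V × K) × List (WeightedEdge V K)) → Val K
  | none => .nil
  | some ((u, l), rest) => .pair (.pair (.num (key u)) (.num l)) (encEdges key rest)

end Encoding

section Calls

variable {K : Type} [Field K] [LinearOrder K] {w : K → ℕ} {P : ℕ} {c₀ : ℚ} {env : List (Val K)}
  {a : Expr} {u v : Val K} {s t : ℕ}

/-- The function `f` of the program maps `u` to `v` at cost at most `T`. -/
def Computes (w : K → ℕ) (P : ℕ) (c₀ : ℚ) (f : Fn) (u v : Val K) (T : ℕ) : Prop :=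
  Runs w (program P c₀) [u] (body P c₀ f) v T

theorem Computes.mono {f : Fn} (h : Computes w P c₀ f u v s) (hst : s ≤ t) :
    Computes w P c₀ f u v t :=
  Runs.mono h hst

theorem Computes.call {f : Fn} (hf : Computes w P c₀ f u v t)
    (ha : Runs w (program P c₀) env a u s) : Runs w (program P c₀) env (f.call a) v (s + t + 1) :=
  ha.call (getElem?_program P c₀ f) hf

end Calls

section Lookup

variable {V : Type*} [DecidableEq V] {K : Type} [Field K] [LinearOrder K] {w : K → ℕ} {P L : ℕ}
  {c₀ : ℚ} {key : V → K}

theorem computes_lookup (hkey : Function.Injective key) (hL : ∀ v, w (key v) ≤ L) {v : V}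
    {st : List (V × K × K)} {s c : K} (h : st.lookup v = some (s, c)) :
    Computes w P c₀ .lookup (.pair (.num (key v)) (encState key st)) (.pair (.num s) (.num c))
      (st.length * (4 * L + 40)) := by
  induction st with
  | nil => simp at h
  | cons e st ih =>
    obtain ⟨u, s', c'⟩ := e
    have hu := hL u
    have hv := hL v
    rw [List.length_cons, add_mul, one_mul]
    rw [List.lookup_cons] at h
    by_cases huv : v = u
    · obtain ⟨rfl, rfl⟩ : s' = s ∧ c' = c := by simpa [huv] using h
      exact (Runs.letIn (.fst (.snd (.var rfl))) (.ifEq_pos (.fst (.var rfl)) (.fst (.var rfl))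
        (by rw [huv]) (.snd (.var rfl)))).mono (by dsimp only; omega)
    · replace h : st.lookup v = some (s, c) := by simpa [beq_false_of_ne huv] using h
      exact (Runs.letIn (.fst (.snd (.var rfl))) (.ifEq_neg (.fst (.var rfl)) (.fst (.var rfl))
        (hkey.ne (Ne.symm huv)) ((ih h).call
          (.pair (.fst (.var rfl)) (.snd (.snd (.var rfl))))))).mono (by omega)

theorem computes_pick (hkey : Function.Injective key) (hL : ∀ v, w (key v) ≤ L) (v : V)
    (es : List (WeightedEdge V K)) :
    Computes w P c₀ .pick (.pair (.num (key v)) (encEdges key es)) (encPick key (pickEdge v es))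
      ((es.length + 1) * (8 * L + 60)) := by
  induction es with
  | nil => exact (Runs.ifNil_pos (.snd (.var rfl)) .nil).mono (by simp)
  | cons e es ih =>
    obtain ⟨x, y, l⟩ := e
    have hx := hL x
    have hy := hL y
    have hv := hL v
    rw [List.length_cons, add_mul _ 1, one_mul]
    generalize (es.length + 1) * (8 * L + 60) = T at *
    suffices Runs w (program P c₀) _ _ _ (T + 8 * L + 50) from
      (Runs.ifNil_neg (.snd (.var rfl)) (.letIn (.fst (.snd (.var rfl))) this)).mono (by omega)
    rw [pickEdge]
    split_ifs with hxv hyv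
    · exact (Runs.ifEq_pos (.fst (.var rfl)) (.fst (.var rfl)) (by rw [hxv])
        (.pair (.snd (.var rfl)) (.snd (.snd (.var rfl))))).mono (by dsimp only; omega)
    · exact (Runs.ifEq_neg (.fst (.var rfl)) (.fst (.var rfl)) (hkey.ne hxv)
        (.ifEq_pos (.fst (.snd (.var rfl))) (.fst (.var rfl)) (by rw [hyv])
          (.pair (.pair (.fst (.var rfl)) (.snd (.snd (.var rfl)))) (.snd (.snd (.var rfl)))))).mono
        (by dsimp only; omega)
    · refine (Runs.ifEq_neg (.fst (.var rfl)) (.fst (.var rfl)) (hkey.ne hxv)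
        (.ifEq_neg (.fst (.snd (.var rfl))) (.fst (.var rfl)) (hkey.ne hyv)
          (.letIn (ih.call (.pair (.fst (.var rfl)) (.snd (.snd (.var rfl)))))
            (t := 10) ?_))).mono (by omega)
      rcases pickEdge v es with _ | ⟨⟨u, l'⟩, rest⟩
      · exact (Runs.ifNil_pos (.var rfl) .nil).mono (by omega)
      · exact (Runs.ifNil_neg (.var rfl) (.pair (.fst (.var rfl))
          (.pair (.var rfl) (.snd (.var rfl))))).mono (by omega)

end Lookup

section Ratio

variable {K : Type} [Field K] [LinearOrder K]

/-- `e` evaluates to a result of `approxRatio` with a nonnegative number of size at most `q`, at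
cost at most `T`. -/
structure RunsResult (w μ : K → ℕ) (P : Program) (env : List (Val K)) (e : Expr) (r : Bool × K)
    (q T : ℕ) : Prop where
  runs : Runs w P env e (encResult r) T
  nonneg : 0 ≤ r.2
  size_le : μ r.2 ≤ q

theorem RunsResult.mono {w μ : K → ℕ} {P : Program} {env : List (Val K)} {e : Expr} {r : Bool × K}
    {q q' T T' : ℕ} (h : RunsResult w μ P env e r q T) (hq : q ≤ q') (hT : T ≤ T') :
    RunsResult w μ P env e r q' T' :=
  ⟨h.runs.mono hT, h.nonneg, h.size_le.trans hq⟩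

section Expressions

variable {w μ : K → ℕ} {P : Program} {env : List (Val K)} {W q t : ℕ}

theorem runs_orExpr {d e : Expr} {a b : Bool} (ha : Runs w P env d (encBool a) t)
    (hb : Runs w P env e (encBool b) t) :
    Runs w P env (orExpr d e) (encBool (a || b)) (2 * t + 1) := by
  cases a with
  | false => exact (Runs.ifNil_pos ha hb).mono (by omega)
  | true => exact (Runs.ifNil_neg ha ha).mono (by omega)

variable [IsStrictOrderedRing K]

theorem runsNum_stepExpr (hμ : LengthBound w μ) (h1 : μ 1 ≤ W) {el ec ea eb₀ eb₁ : Expr}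
    {l c a b₀ b₁ : K} (hl : RunsNum w μ P env el l W t) (hc : RunsNum w μ P env ec c W t)
    (ha : RunsNum w μ P env ea a q t) (hb₀ : RunsNum w μ P env eb₀ b₀ q t)
    (hb₁ : RunsNum w μ P env eb₁ b₁ q t) (hl_pos : 0 < l) (hc_pos : 0 < c) (ha_nonneg : 0 ≤ a)
    (hb₁_nonneg : 0 ≤ b₁) :
    RunsNum w μ P env (stepExpr el ec ea eb₀ eb₁) (ratioStep l c a b₀ b₁) (4 * q + 4 * W + 7)
      (7 * t + 28 * q + 24 * W + 40) := by
  have hal := ha.div hμ hl hl_pos.ne'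
  exact (((RunsNum.const 1 Rat.cast_one h1).add hμ (hal.mul hμ hb₀)).div hμ
    (hc.add hμ (hal.add hμ hb₁)) (by positivity)).mono (by omega) (by omega)

theorem runsResult_truncateExpr (hμ : LengthBound w μ) (h1 : μ 1 ≤ W) {θ : ℚ} (hθ : 0 ≤ θ)
    (hθW : μ (θ : K) ≤ W) {deep keep ex ec : Expr} {d b : Bool} {x c : K}
    (hd : Runs w P env deep (encBool d) t) (hb : Runs w P env keep (encBool b) t)
    (hx : RunsNum w μ P env ex x q t) (hc : RunsNum w μ P env ec c W t) (hx_nonneg : 0 ≤ x)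
    (hc_pos : 0 < c) (ht : 1 ≤ t) :
    RunsResult w μ P env (truncateExpr θ deep keep ex ec)
      (if d then (true, if b then min x θ else 1 / c) else (false, x)) (q + 2 * W + 1)
      (5 * t + 2 * q + 4 * W + 10) := by
  have hθK : (0 : K) ≤ θ := Rat.cast_nonneg.2 hθ
  have hcut : RunsNum w μ P env (.const θ) (θ : K) W 1 := .const θ rfl hθW
  have hdef : RunsNum w μ P env (.arith .div (.const 1) ec) (1 / c) _ _ :=
    (RunsNum.const 1 Rat.cast_one h1).div hμ hc hc_pos.ne'
  cases d with
  | false => exact ⟨(Runs.ifNil_pos hd (.pair .nil hx.1)).mono (by omega), hx_nonneg,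
      hx.2.trans (by omega)⟩
  | true =>
    cases b with
    | false => exact ⟨(Runs.ifNil_neg hd (.pair hd (.ifNil_pos hb hdef.1))).mono (by omega),
        (one_div_pos.2 hc_pos).le, hdef.2.trans (by omega)⟩
    | true =>
      have hmin : RunsNum w μ P env (.ifLt (.const θ) ex (.const θ) ex) (min x θ) (q + W)
          (2 * t + 2 * q + 2 * W + 3) := by
        refine ⟨(RunsNum.ifLt hμ hcut hx (T := t) (fun h => ?_) (fun h => ?_)).mono (by omega), ?_⟩
        · rw [min_eq_right h.le]
          exact hcut.1.mono ht
        · rw [min_eq_left (not_lt.1 h)]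
          exact hx.1
        · rcases min_choice x θ with h | h <;> rw [h]
          · exact hx.2.trans (by omega)
          · exact hθW.trans (by omega)
      exact ⟨(Runs.ifNil_neg hd (.pair hd (.ifNil_neg hb hmin.1))).mono (by omega),
        le_min hx_nonneg hθK, hmin.2.trans (by omega)⟩

end Expressions

variable {V : Type*}

/-- The numbers `key` of the vertices and the parameters `c` of their functions can be handled by
the program, and so can its constants. -/
structure Setting (w μ : K → ℕ) (W : ℕ) (c₀ : ℚ) (key c : V → K) : Prop where
  bound : LengthBound w μ
  injective : Function.Injective key
  key_le : ∀ v, μ (key v) ≤ W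
  one_le : μ 1 ≤ W
  cutoff_nonneg : 0 ≤ c₀⁻¹
  cutoff_le : μ ((c₀⁻¹ : ℚ) : K) ≤ W
  param_le : ∀ v, μ (c v) ≤ W
  param_pos : ∀ v, 0 < c v

/-- The association list `st` holds the quotients `s` and the parameters `c`. -/
structure Stores [DecidableEq V] (μ : K → ℕ) (c s : V → K) (U : ℕ) (st : List (V × K × K)) :
    Prop where
  lookup_eq : ∀ v, st.lookup v = some (s v, c v)
  nonneg : ∀ v, 0 ≤ s v
  size_le : ∀ v, μ (s v) ≤ U

variable {w μ : K → ℕ} {P W U q T X : ℕ} {c₀ : ℚ} {key c s : V → K} {st : List (V × K × K)}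
  {es rest : List (WeightedEdge V K)} {u v : V} {l : K}

theorem Setting.key_length_le (hS : Setting w μ W c₀ key c) (v : V) : w (key v) ≤ 2 * W :=
  (hS.bound.length_le _).trans (Nat.mul_le_mul_left 2 (hS.key_le v))

theorem runsResult_combineRatio [IsStrictOrderedRing K] (hS : Setting w μ W c₀ key c)
    (hl : 0 < l ∧ μ l ≤ W) (b : Bool) (ls : List Bool) {a b₀ b₁ : Bool × K}
    (ha : 0 ≤ a.2 ∧ μ a.2 ≤ q) (hb₀ : 0 ≤ b₀.2 ∧ μ b₀.2 ≤ q) (hb₁ : 0 ≤ b₁.2 ∧ μ b₁.2 ≤ q) :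
    RunsResult w μ (program P c₀) [encResult b₁, encResult b₀, encResult a,
        .pair (.num (s v)) (.num (c v)), encPick key (some ((u, l), rest)),
        .pair (.num (key v)) (encContext key (b :: ls) st es)] (combineRatio c₀⁻¹)
      (if a.1 || b₀.1 then
        (true, if b then min (ratioStep l (c v) a.2 b₀.2 b₁.2) ((c₀⁻¹ : ℚ) : K) else 1 / c v)
      else (false, ratioStep l (c v) a.2 b₀.2 b₁.2))
      (4 * q + 6 * W + 8) (36 * q + 36 * W + 120) := by
  have hc := hS.param_pos v
  have hstep : RunsNum w μ (program P c₀) [encResult b₁, encResult b₀, encResult a,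
        .pair (.num (s v)) (.num (c v)), encPick key (some ((u, l), rest)),
        .pair (.num (key v)) (encContext key (b :: ls) st es)]
      (stepExpr (.snd (.fst (.var 4))) (.snd (.var 3)) (.snd (.var 2)) (.snd (.var 1))
        (.snd (.var 0))) _ _ _ :=
    runsNum_stepExpr hS.bound hS.one_le (t := 3) ⟨.snd (.fst (.var rfl)), hl.2⟩
      ⟨(Runs.snd (.var rfl)).mono (by omega), hS.param_le v⟩
      ⟨(Runs.snd (.var rfl)).mono (by omega), ha.2⟩
      ⟨(Runs.snd (.var rfl)).mono (by omega), hb₀.2⟩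
      ⟨(Runs.snd (.var rfl)).mono (by omega), hb₁.2⟩ hl.1 hc ha.1 hb₁.1
  have hcut : RunsResult w μ (program P c₀) [encBool (a.1 || b₀.1),
        .num (ratioStep l (c v) a.2 b₀.2 b₁.2), encResult b₁, encResult b₀, encResult a,
        .pair (.num (s v)) (.num (c v)), encPick key (some ((u, l), rest)),
        .pair (.num (key v)) (encContext key (b :: ls) st es)]
      (truncateExpr c₀⁻¹ (.var 0) (.fst (levelsOf (.snd (.var 7)))) (.var 1) (.snd (.var 5)))
      _ _ _ :=
    runsResult_truncateExpr hS.bound hS.one_le hS.cutoff_nonneg hS.cutoff_le (t := 4)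
      ((Runs.var rfl).mono (by omega)) (.fst (.fst (.snd (.var rfl))))
      ⟨(Runs.var rfl).mono (by omega), hstep.2⟩
      ⟨(Runs.snd (.var rfl)).mono (by omega), hS.param_le v⟩
      (ratioStep_nonneg hl.1 hc ha.1 hb₀.1 hb₁.1) hc (by omega)
  exact ⟨(Runs.letIn hstep.1 (.letIn (runs_orExpr (.fst (.var rfl)) (.fst (.var rfl)))
    hcut.runs)).mono (by omega), hcut.nonneg, hcut.size_le.trans (by omega)⟩

variable [DecidableEq V]

theorem computes_ratio (hS : Setting w μ W c₀ key c) (hst : Stores μ c s U st)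
    (hX : st.length + es.length < X) {ls : List Bool} {r : Val K}
    (h : Runs w (program P c₀) [.pair (.num (s v)) (.num (c v)), encPick key (pickEdge v es),
        .pair (.num (key v)) (encContext key ls st es)]
      (.ifNil (.var 1) (.pair .nil (.fst (.var 0))) (splitRatio c₀⁻¹)) r T) :
    Computes w P c₀ .ratio (.pair (.num (key v)) (encContext key ls st es)) r
      (T + 125 * ((W + 1) * X)) := by
  have hpick : Computes w P c₀ .pick _ _ _ :=
    computes_pick hS.injective hS.key_length_le v es
  have hlookup : Computes w P c₀ .lookup _ _ _ :=
    computes_lookup hS.injective hS.key_length_le (hst.lookup_eq v)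
  refine (Runs.letIn (hpick.call (.pair (.fst (.var rfl)) (.snd (.snd (.snd (.var rfl))))))
    (.letIn (hlookup.call (.pair (.fst (.var rfl)) (.fst (.snd (.snd (.var rfl)))))) h)).mono ?_
  have hpick_cost : (es.length + 1) * (8 * (2 * W) + 60) ≤ X * (60 * (W + 1)) := by
    gcongr <;> omega
  have hlookup_cost : st.length * (4 * (2 * W) + 40) ≤ X * (40 * (W + 1)) := by
    gcongr <;> omega
  have hpos : 1 ≤ (W + 1) * X := Nat.mul_pos (by omega) (by omega)
  linarith

theorem runsResult_ratio_of_pickEdge_eq_none (hS : Setting w μ W c₀ key c)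
    (hst : Stores μ c s U st) (hX : st.length + es.length < X) (ls : List Bool)
    (h : pickEdge v es = none) :
    RunsResult w μ (program P c₀) [.pair (.num (key v)) (encContext key ls st es)]
      (ratioBody c₀⁻¹) (false, s v) U (10 + 125 * ((W + 1) * X)) := by
  refine ⟨computes_ratio hS hst hX ?_, hst.nonneg v, hst.size_le v⟩
  rw [h]
  exact (Runs.ifNil_pos (.var rfl) (.pair .nil (.fst (.var rfl)))).mono (by omega)

variable [IsStrictOrderedRing K]

theorem Stores.add_ne_zero (hst : Stores μ c s U st) (hS : Setting w μ W c₀ key c) (u : V) :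
    c u + s u ≠ 0 :=
  (add_pos_of_pos_of_nonneg (hS.param_pos u) (hst.nonneg u)).ne'

theorem Stores.pin (hst : Stores μ c s U st) (hS : Setting w μ W c₀ key c) (u : V) :
    Stores μ c (pin c s u) (U + (2 * W + 2)) ((u, 1 / (c u + s u), c u) :: st) where
  lookup_eq v := by
    rw [List.lookup_cons]
    rcases eq_or_ne v u with rfl | h
    · simp [pin_self]
    · simp [beq_false_of_ne h, pin_of_ne c s h, hst.lookup_eq]
  nonneg v := pin_nonneg hS.param_pos hst.nonneg u v
  size_le v := by
    rcases eq_or_ne v u with rfl | h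
    · rw [pin_self]
      have hadd : μ (c v + s v) ≤ _ := hS.bound.result_le (o := .add) rfl
      have hdiv : μ (1 / (c v + s v)) ≤ _ :=
        hS.bound.result_le (o := .div) ⟨hst.add_ne_zero hS v, rfl⟩
      have := hS.one_le
      have := hS.param_le v
      have := hst.size_le v
      omega
    · rw [pin_of_ne c s h]
      exact (hst.size_le v).trans (Nat.le_add_right _ _)

theorem computes_pin (hS : Setting w μ W c₀ key c) (hst : Stores μ c s U st) (v : V) :
    Computes w P c₀ .pin (.pair (.num (key v)) (encState key st))
      (encState key ((v, 1 / (c v + s v), c v) :: st))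
      (st.length * (8 * W + 40) + 6 * W + 4 * U + 30) := by
  have hlookup : Computes w P c₀ .lookup _ _ _ :=
    computes_lookup hS.injective hS.key_length_le (hst.lookup_eq v)
  have hdiv : RunsNum w μ (program P c₀) [.pair (.num (s v)) (.num (c v)),
      .pair (.num (key v)) (encState key st)]
      (.arith .div (.const 1) (.arith .add (.snd (.var 0)) (.fst (.var 0)))) _ _ _ :=
    (RunsNum.const 1 Rat.cast_one hS.one_le).div hS.bound
      (.add hS.bound ⟨.snd (.var rfl), hS.param_le v⟩ ⟨.fst (.var rfl), hst.size_le v⟩)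
      (hst.add_ne_zero hS v)
  refine (Runs.letIn (hlookup.call (.var rfl)) (.pair (.pair (.fst (.var rfl))
    (.pair hdiv.1 (.snd (.var rfl)))) (.snd (.var rfl)))).mono ?_
  rw [show 4 * (2 * W) + 40 = 8 * W + 40 by ring]
  generalize st.length * (8 * W + 40) = Y
  omega

theorem runsResult_recurRatio (hS : Setting w μ W c₀ key c) (hst : Stores μ c s U st)
    (hl : 0 < l ∧ μ l ≤ W) (b : Bool) (ls : List Bool) {a b₀ b₁ : Bool × K}
    (ha : RunsResult w μ (program P c₀) [.pair (.num (key u))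
      (encContext key ls ((v, 1 / (c v + s v), c v) :: st) rest)] (ratioBody c₀⁻¹) a q T)
    (hb₀ : RunsResult w μ (program P c₀) [.pair (.num (key v)) (encContext key ls st rest)]
      (ratioBody c₀⁻¹) b₀ q T)
    (hb₁ : RunsResult w μ (program P c₀) [.pair (.num (key v))
      (encContext key ls ((u, 1 / (c u + s u), c u) :: st) rest)] (ratioBody c₀⁻¹) b₁ q T) :
    RunsResult w μ (program P c₀) [.pair (.num (s v)) (.num (c v)),
        encPick key (some ((u, l), rest)), .pair (.num (key v)) (encContext key (b :: ls) st es)]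
      (recurRatio c₀⁻¹)
      (if a.1 || b₀.1 then
        (true, if b then min (ratioStep l (c v) a.2 b₀.2 b₁.2) ((c₀⁻¹ : ℚ) : K) else 1 / c v)
      else (false, ratioStep l (c v) a.2 b₀.2 b₁.2))
      (4 * q + 6 * W + 8)
      (3 * T + 2 * (st.length * (8 * W + 40)) + 40 * q + 60 * W + 8 * U + 400) := by
  have hpin : ∀ v, Computes w P c₀ .pin _ _ _ := computes_pin hS hst
  have hcombine := runsResult_combineRatio (P := P) (s := s) (u := u) (v := v) (rest := rest)
    (st := st) (es := es) hS hl b ls ⟨ha.nonneg, ha.size_le⟩ ⟨hb₀.nonneg, hb₀.size_le⟩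
    ⟨hb₁.nonneg, hb₁.size_le⟩
  refine ⟨(Runs.letIn (Computes.call (f := .ratio) ha.runs (.pair (.fst (.fst (.var rfl)))
    (.pair (.snd (.fst (.snd (.var rfl)))) (.pair ((hpin v).call (.pair (.fst (.var rfl))
      (.fst (.snd (.snd (.var rfl)))))) (.snd (.var rfl))))))
    (.letIn (Computes.call (f := .ratio) hb₀.runs (.pair (.fst (.var rfl))
      (.pair (.snd (.fst (.snd (.var rfl)))) (.pair (.fst (.snd (.snd (.var rfl))))
        (.snd (.var rfl))))))
    (.letIn (Computes.call (f := .ratio) hb₁.runs (.pair (.fst (.var rfl))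
      (.pair (.snd (.fst (.snd (.var rfl)))) (.pair ((hpin u).call (.pair (.fst (.fst (.var rfl)))
        (.fst (.snd (.snd (.var rfl)))))) (.snd (.var rfl))))))
      hcombine.runs))).mono ?_, hcombine.nonneg, hcombine.size_le⟩
  generalize st.length * (8 * W + 40) = Y
  omega

theorem runsResult_ratio_nil (hS : Setting w μ W c₀ key c) (hst : Stores μ c s U st)
    (hX : st.length + es.length < X) {e : (V × K) × List (WeightedEdge V K)}
    (h : pickEdge v es = some e) :
    RunsResult w μ (program P c₀) [.pair (.num (key v)) (encContext key [] st es)]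
      (ratioBody c₀⁻¹) (true, 1 / c v) (2 * W + 1) (4 * W + 20 + 125 * ((W + 1) * X)) := by
  have hdiv : RunsNum w μ (program P c₀) [.pair (.num (s v)) (.num (c v)), encPick key (some e),
      .pair (.num (key v)) (encContext key [] st es)] (.arith .div (.const 1) (.snd (.var 0)))
      _ _ _ :=
    (RunsNum.const 1 Rat.cast_one hS.one_le).div hS.bound ⟨.snd (.var rfl), hS.param_le v⟩
      (hS.param_pos v).ne'
  refine ⟨computes_ratio hS hst hX ?_, (one_div_pos.2 (hS.param_pos v)).le,
    hdiv.2.trans (by omega)⟩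
  rw [h]
  exact (Runs.ifNil_neg (.var rfl) (.ifNil_pos (.fst (.snd (.var rfl)))
    (.pair (.pair .nil .nil) hdiv.1))).mono (by omega)

theorem runsResult_ratio_cons (hS : Setting w μ W c₀ key c) (hst : Stores μ c s U st)
    (hX : st.length + es.length < X) (h : pickEdge v es = some ((u, l), rest))
    (hl : 0 < l ∧ μ l ≤ W) (b : Bool) (ls : List Bool) {a b₀ b₁ : Bool × K}
    (ha : RunsResult w μ (program P c₀) [.pair (.num (key u))
      (encContext key ls ((v, 1 / (c v + s v), c v) :: st) rest)] (ratioBody c₀⁻¹) a q T)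
    (hb₀ : RunsResult w μ (program P c₀) [.pair (.num (key v)) (encContext key ls st rest)]
      (ratioBody c₀⁻¹) b₀ q T)
    (hb₁ : RunsResult w μ (program P c₀) [.pair (.num (key v))
      (encContext key ls ((u, 1 / (c u + s u), c u) :: st) rest)] (ratioBody c₀⁻¹) b₁ q T) :
    RunsResult w μ (program P c₀) [.pair (.num (key v)) (encContext key (b :: ls) st es)]
      (ratioBody c₀⁻¹)
      (if a.1 || b₀.1 then
        (true, if b then min (ratioStep l (c v) a.2 b₀.2 b₁.2) ((c₀⁻¹ : ℚ) : K) else 1 / c v)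
      else (false, ratioStep l (c v) a.2 b₀.2 b₁.2))
      (4 * q + 6 * W + 8) (3 * T + 40 * q + 60 * W + 8 * U + 500 + 205 * ((W + 1) * X)) := by
  have hrec := runsResult_recurRatio (es := es) hS hst hl b ls ha hb₀ hb₁
  refine ⟨(computes_ratio hS hst hX (h ▸ Runs.ifNil_neg (.var rfl)
    (.ifNil_neg (.fst (.snd (.var rfl))) hrec.runs))).mono ?_, hrec.nonneg, hrec.size_le⟩
  have hpin_cost : st.length * (8 * W + 40) ≤ 40 * ((W + 1) * X) := by
    calc st.length * (8 * W + 40) ≤ X * (40 * (W + 1)) := by gcongr <;> omega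
      _ = 40 * ((W + 1) * X) := by ring
  linarith

theorem runsResult_ratio (hS : Setting w μ W c₀ key c) (ls : List Bool)
    (hst : Stores μ c s U st) (hes : ∀ e ∈ es, 0 < e.2.2 ∧ μ e.2.2 ≤ W)
    (hX : st.length + es.length + U + 4 * (W + 1) ≤ X) (v : V) :
    RunsResult w μ (program P c₀) [.pair (.num (key v)) (encContext key ls st es)]
      (ratioBody c₀⁻¹) (approxRatio ((c₀⁻¹ : ℚ) : K) c ls s es v) (16 ^ ls.length * X)
      (1000 * 64 ^ ls.length * ((W + 1) * X)) := by
  induction ls generalizing s U X st es v with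
  | nil =>
    have hWX : X ≤ (W + 1) * X := Nat.le_mul_of_pos_left _ (by omega)
    cases h : pickEdge v es with
    | none =>
      rw [approxRatio_of_pickEdge_eq_none _ c s _ h]
      exact (runsResult_ratio_of_pickEdge_eq_none (X := X) hS hst (by omega) [] h).mono
        (by rw [List.length_nil, pow_zero]; omega) (by rw [List.length_nil, pow_zero]; omega)
    | some e =>
      rw [approxRatio, h]
      exact (runsResult_ratio_nil (X := X) hS hst (by omega) h).mono
        (by rw [List.length_nil, pow_zero]; omega) (by rw [List.length_nil, pow_zero]; omega)
  | cons b ls ih =>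
    have hWX : X ≤ (W + 1) * X := Nat.le_mul_of_pos_left _ (by omega)
    have hsize : X ≤ 16 ^ ls.length * X := Nat.le_mul_of_pos_left _ (by positivity)
    have hcost : 16 ^ ls.length * X ≤ 64 ^ ls.length * ((W + 1) * X) := by
      gcongr
      norm_num
    have hcost' : (W + 1) * X ≤ 64 ^ ls.length * ((W + 1) * X) :=
      Nat.le_mul_of_pos_left _ (by positivity)
    rw [List.length_cons, pow_succ, pow_succ]
    cases h : pickEdge v es with
    | none =>
      rw [approxRatio_of_pickEdge_eq_none _ c s _ h]
      exact (runsResult_ratio_of_pickEdge_eq_none (X := X) hS hst (by omega) (b :: ls) h).mono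
        (by linarith) (by linarith)
    | some e =>
      obtain ⟨⟨u, l⟩, rest⟩ := e
      have hlen := length_of_pickEdge h
      obtain ⟨hl, hrest⟩ := forall_weight_of_pickEdge (p := fun l => 0 < l ∧ μ l ≤ W) h hes
      rw [approxRatio_of_pickEdge_eq_some _ c s b ls h]
      exact (runsResult_ratio_cons (X := X) hS hst (by omega) h hl b ls
        (ih (X := 2 * X) (hst.pin hS v) hrest (by rw [List.length_cons]; omega) u)
        (ih (X := 2 * X) hst hrest (by omega) v)
        (ih (X := 2 * X) (hst.pin hS u) hrest (by rw [List.length_cons]; omega) v)).mono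
        (by linarith) (by linarith)

theorem runsNum_factorExpr (hS : Setting w μ W c₀ key c) (ls : List Bool)
    (hst : Stores μ c s U st) (hes : ∀ e ∈ es, 0 < e.2.2 ∧ μ e.2.2 ≤ W)
    (hX : st.length + es.length + U + 6 * (W + 1) + 1 ≤ X) (hl : μ l ≤ W) (u v : V) :
    RunsNum w μ (program P c₀) [encState key ((u, 1 / (c u + s u), c u) :: st),
        encEdge key (u, v, l), encContext key ls st ((u, v, l) :: es)] factorExpr
      (l + (approxRatio ((c₀⁻¹ : ℚ) : K) c ls s es u).2 *
        (approxRatio ((c₀⁻¹ : ℚ) : K) c ls (pin c s u) es v).2)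
      (2 * (16 ^ ls.length * X) + W + 2) (2100 * (64 ^ ls.length * ((W + 1) * X))) := by
  have hu := runsResult_ratio (P := P) hS ls hst hes (X := X) (by omega) u
  have hv := runsResult_ratio (P := P) hS ls (hst.pin hS u) hes (X := X)
    (by rw [List.length_cons]; omega) v
  refine RunsNum.mono (.add hS.bound ⟨.snd (.snd (.var rfl)), hl⟩ (.mul hS.bound
    ⟨.snd (Computes.call (f := .ratio) hu.runs (.pair (.fst (.var rfl))
      (.pair (.fst (.var rfl)) (.pair (.fst (.snd (.var rfl)))
        (.snd (.snd (.snd (.var rfl)))))))), hu.size_le⟩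
    ⟨.snd (Computes.call (f := .ratio) hv.runs (.pair (.fst (.snd (.var rfl)))
      (.pair (.fst (.var rfl)) (.pair (.var rfl)
        (.snd (.snd (.snd (.var rfl)))))))), hv.size_le⟩)) (by omega) ?_
  have hsize : 16 ^ ls.length * X ≤ 64 ^ ls.length * ((W + 1) * X) := by
    gcongr
    · norm_num
    · exact Nat.le_mul_of_pos_left _ (by omega)
  have hX' : X ≤ 16 ^ ls.length * X := Nat.le_mul_of_pos_left _ (by positivity)
  linarith

theorem runsNum_prod (hS : Setting w μ W c₀ key c) (ls : List Bool)
    (hst : Stores μ c s U st) (hes : ∀ e ∈ es, 0 < e.2.2 ∧ μ e.2.2 ≤ W)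
    (hX : st.length + es.length * (4 * W + 7) + U + 4 * (W + 1) ≤ X)
    (hq : es.length * (2 * (16 ^ ls.length * X) + W + 3) + W ≤ q) :
    RunsNum w μ (program P c₀) [encContext key ls st es] prodBody
      (approxProd ((c₀⁻¹ : ℚ) : K) c ls s es)
      (es.length * (2 * (16 ^ ls.length * X) + W + 3) + W)
      (es.length * (4000 * (64 ^ ls.length * ((W + 1) * X)) + 2 * q) + 10) := by
  induction es generalizing s U st with
  | nil =>
    exact ⟨(Runs.ifNil_pos (.snd (.snd (.var rfl))) (.const 1 Rat.cast_one)).mono (by simp),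
      by simpa [approxProd] using hS.one_le⟩
  | cons e es ih =>
    obtain ⟨u, v, l⟩ := e
    obtain ⟨⟨-, hl⟩, hes⟩ := List.forall_mem_cons.1 hes
    rw [List.length_cons, Nat.add_one_mul es.length] at hX hq
    have hlen : es.length ≤ es.length * (4 * W + 7) := Nat.le_mul_of_pos_right _ (by omega)
    have hrest := ih ((hst.pin hS u).pin hS v) hes (by simp only [List.length_cons]; omega)
      (by omega)
    have hfactor := runsNum_factorExpr (P := P) (X := X) hS ls hst hes (by omega) hl u v
    have hpin : Computes w P c₀ .pin _ _ _ := computes_pin hS hst u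
    have hpin' : Computes w P c₀ .pin _ _ _ := computes_pin hS (hst.pin hS u) v
    have hmul := hfactor.mul (b := Fn.prod.call (.pair (levelsOf (.var 2)) (.pair
        (Fn.pin.call (.pair (.fst (.snd (.var 1))) (.var 0))) (.snd (edgesOf (.var 2))))))
      hS.bound ⟨Computes.call (f := .prod) hrest.1
      (.pair (.fst (.var rfl)) (.pair (hpin'.call (.pair (.fst (.snd (.var rfl))) (.var rfl)))
        (.snd (.snd (.snd (.var rfl)))))), hrest.2⟩
    rw [approxProd, List.length_cons, Nat.add_one_mul es.length, Nat.add_one_mul es.length]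
    refine ⟨(Runs.ifNil_neg (.snd (.snd (.var rfl))) (.letIn (.fst (.snd (.snd (.var rfl))))
      (.letIn (hpin.call (.pair (.fst (.var rfl)) (.fst (.snd (.var rfl))))) hmul.1))).mono ?_,
      hmul.2.trans (by omega)⟩
    have hpin_cost : (st.length + 1) * (8 * W + 40) ≤ 40 * ((W + 1) * X) := by
      calc (st.length + 1) * (8 * W + 40) ≤ X * (40 * (W + 1)) := by gcongr <;> omega
        _ = 40 * ((W + 1) * X) := by ring
    have hWX : X ≤ (W + 1) * X := Nat.le_mul_of_pos_left _ (by omega)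
    have hcost : (W + 1) * X ≤ 64 ^ ls.length * ((W + 1) * X) :=
      Nat.le_mul_of_pos_left _ (by positivity)
    rw [List.length_cons]
    linarith

end Ratio

/-! ## The preparation of the input -/

section Functions

variable {K : Type} {n d : ℕ}

/-- The datum that stands for a symmetric function. -/
def encFun (f : Fin (d + 1) → K) : Val K := .ofList (List.ofFn fun i => .num (f i))

/-- The datum that stands for a family of symmetric functions. -/
def encFuns {d : Fin n → ℕ} (f : ∀ v, Fin (d v + 1) → K) : Val K :=
  .ofList (List.ofFn fun v => encFun (f v))

theorem encFun_eq_pair (f : Fin (d + 1) → K) :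
    encFun f = .pair (.num (f 0)) (.ofList (List.ofFn fun i => .num (f i.succ))) := by
  rw [encFun, List.ofFn_succ]
  rfl

theorem encFun_succ (f : Fin (d + 2) → K) :
    encFun f = .pair (.num (f 0)) (encFun fun i => f i.succ) :=
  encFun_eq_pair f

theorem encFuns_succ {d : Fin (n + 1) → ℕ} (f : ∀ v, Fin (d v + 1) → K) :
    encFuns f = .pair (encFun (f 0)) (encFuns fun v => f v.succ) := by
  rw [encFuns, List.ofFn_succ]
  rfl

variable [Field K] {w μ : K → ℕ} {P W B q : ℕ} {c₀ : ℚ} {f : Fin (d + 1) → K}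

theorem size_vertexQuot_le (hμ : LengthBound w μ) (h1 : μ 1 ≤ W) (hd : d ≠ 0 → f 1 ≠ 0)
    (hf : ∀ i, μ (f i) ≤ W) : μ (vertexQuot f) ≤ 2 * W + 1 := by
  cases d with
  | zero => exact h1.trans (by omega)
  | succ d =>
    have hdiv : μ (vertexQuot f) ≤ _ := hμ.result_le (o := .div) ⟨hd d.succ_ne_zero, rfl⟩
    have := hf 0
    have := hf 1
    omega

theorem size_vertexParam_le (hμ : LengthBound w μ) (h2 : μ 2 ≤ W) (hd : d ≠ 0 → f 1 ≠ 0)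
    (hf : ∀ i, μ (f i) ≤ W) : μ (vertexParam f) ≤ 3 * W + 2 := by
  match d with
  | 0 => exact h2.trans (by omega)
  | 1 => exact h2.trans (by omega)
  | d + 2 =>
    have hdiv : μ (vertexParam f) ≤ _ := hμ.result_le (o := .div) ⟨hd d.succ.succ_ne_zero, rfl⟩
    have hsub : μ (f 2 - f 0) ≤ _ := hμ.result_le (o := .sub) rfl
    have := hf 0
    have := hf 1
    have := hf 2
    omega

variable [LinearOrder K]

theorem computes_last (f : Fin (d + 1) → K) :
    Computes w P c₀ .last (encFun f) (.num (f (Fin.last d))) (10 * (d + 1)) := by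
  induction d with
  | zero => exact (Runs.ifNil_pos (.snd (.var rfl)) (.fst (.var rfl))).mono (by omega)
  | succ d ih =>
    have htail := (ih fun i => f i.succ).call (env := [encFun f]) (a := .snd (.var 0))
      (s := 2) (by rw [encFun_succ]; exact .snd (.var rfl))
    rw [encFun_succ, encFun_eq_pair fun i => f i.succ] at htail ⊢
    exact (Runs.ifNil_neg (.snd (.var rfl)) htail).mono (by omega)

theorem runsNum_topProd (hμ : LengthBound w μ) (h1 : μ 1 ≤ W) {d : Fin n → ℕ}
    (f : ∀ v, Fin (d v + 1) → K) (hd : ∀ v, d v + 1 ≤ B) (hf : ∀ v i, μ (f v i) ≤ W)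
    (hq : n * (W + 1) + W ≤ q) :
    RunsNum w μ (program P c₀) [encFuns f] topProdBody (∏ v, f v (Fin.last _))
      (n * (W + 1) + W) ((n + 1) * (10 * B + 2 * W + 2 * q + 20)) := by
  induction n with
  | zero => exact ⟨(Runs.ifNil_pos (.var rfl) (.const 1 Rat.cast_one)).mono (by simp), by simpa⟩
  | succ n ih =>
    rw [Nat.add_one_mul n] at hq
    have hrest := ih (fun v => f v.succ) (fun v => hd _) (fun v => hf _) (by omega)
    have hB := hd 0
    rw [encFuns_succ, Fin.prod_univ_succ, Nat.add_one_mul n, Nat.add_one_mul (n + 1)]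
    have hmul := RunsNum.mul (P := program P c₀)
      (env := [.pair (encFun (f 0)) (encFuns fun v => f v.succ)])
      (a := Fn.last.call (.fst (.var 0))) (b := Fn.topProd.call (.snd (.var 0))) hμ
      ⟨(computes_last (f 0)).call (.fst (.var rfl)), hf 0 _⟩
      ⟨Computes.call (f := .topProd) hrest.1 (.snd (.var rfl)), hrest.2⟩
    exact ⟨(Runs.ifNil_neg (.var rfl) hmul.1).mono (by omega), hmul.2.trans (by omega)⟩

theorem computes_params (hμ : LengthBound w μ) (hd : d ≠ 0 → f 1 ≠ 0) (hf : ∀ i, μ (f i) ≤ W) :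
    Computes w P c₀ .params (encFun f) (.pair (.num (vertexQuot f)) (.num (vertexParam f)))
      (20 * W + 50) := by
  match d with
  | 0 => exact (Runs.ifNil_pos (.snd (.var rfl)) (.pair (.const 1 Rat.cast_one)
      (.const 2 (Rat.cast_ofNat _)))).mono (by omega)
  | 1 =>
    have hquot : RunsNum w μ (program P c₀) [.pair (.num (f 0)) (.pair (.num (f 1)) .nil)]
        (.arith .div (.fst (.var 0)) (.fst (.snd (.var 0)))) _ _ _ :=
      .div hμ ⟨.fst (.var rfl), hf 0⟩ ⟨.fst (.snd (.var rfl)), hf 1⟩ (hd one_ne_zero)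
    exact (Runs.ifNil_neg (.snd (.var rfl)) (.pair hquot.1
      (.ifNil_pos (.snd (.snd (.var rfl))) (.const 2 (Rat.cast_ofNat _))))).mono (by omega)
  | d + 2 =>
    have hf1 := hd d.succ.succ_ne_zero
    rw [encFun_succ, encFun_succ, encFun_eq_pair]
    generalize Val.ofList _ = l
    have hquot : RunsNum w μ (program P c₀)
        [.pair (.num (f 0)) (.pair (.num (f 1)) (.pair (.num (f 2)) l))]
        (.arith .div (.fst (.var 0)) (.fst (.snd (.var 0)))) _ _ _ :=
      .div hμ ⟨.fst (.var rfl), hf 0⟩ ⟨.fst (.snd (.var rfl)), hf 1⟩ hf1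
    have hparam : RunsNum w μ (program P c₀)
        [.pair (.num (f 0)) (.pair (.num (f 1)) (.pair (.num (f 2)) l))]
        (.arith .div (.arith .sub (.fst (.snd (.snd (.var 0)))) (.fst (.var 0)))
          (.fst (.snd (.var 0)))) _ _ _ :=
      .div hμ (.sub hμ ⟨.fst (.snd (.snd (.var rfl))), hf 2⟩ ⟨.fst (.var rfl), hf 0⟩)
        ⟨.fst (.snd (.var rfl)), hf 1⟩ hf1
    exact (Runs.ifNil_neg (.snd (.var rfl)) (.pair hquot.1
      (.ifNil_neg (.snd (.snd (.var rfl))) hparam.1))).mono (by omega)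

theorem computes_init (hμ : LengthBound w μ) {V : Type*} {key : V → K}
    (hkey : ∀ v, μ (key v) ≤ W) (h1 : μ 1 ≤ W) {d : Fin n → ℕ} (f : ∀ v, Fin (d v + 1) → K)
    (hd : ∀ v, d v ≠ 0 → f v 1 ≠ 0) (hf : ∀ v i, μ (f v i) ≤ W) (g : Fin n → V) {i : K}
    (hg : ∀ v : Fin n, key (g v) = i + (v : ℕ)) :
    Computes w P c₀ .init (.pair (.num i) (encFuns f))
      (encState key (List.ofFn fun v => (g v, vertexQuot (f v), vertexParam (f v))))
      ((n + 1) * (24 * W + 90)) := by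
  induction n generalizing i with
  | zero => exact (Runs.ifNil_pos (.snd (.var rfl)) .nil).mono (by omega)
  | succ n ih =>
    obtain rfl : key (g 0) = i := by simpa using hg 0
    have hrest := ih (fun v => f v.succ) (fun v => hd _) (fun v => hf _) (fun v => g v.succ)
      (i := key (g 0) + 1) fun v => by rw [hg]; push_cast [Fin.val_succ]; ring
    have hparams : Computes w P c₀ .params _ _ _ := computes_params hμ (hd 0) (hf 0)
    rw [encFuns_succ, List.ofFn_succ]
    have hnext : RunsNum w μ (program P c₀)
        [.pair (.num (key (g 0))) (.pair (encFun (f 0)) (encFuns fun v => f v.succ))]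
        (.arith .add (.fst (.var 0)) (.const 1)) _ _ _ :=
      .add hμ ⟨.fst (.var rfl), hkey _⟩ (.const 1 Rat.cast_one h1)
    refine (Runs.ifNil_neg (.snd (.var rfl)) (.pair (.pair (.fst (.var rfl))
      (hparams.call (.fst (.snd (.var rfl))))) (hrest.call (.pair hnext.1
        (.snd (.snd (.var rfl))))))).mono ?_
    rw [Nat.add_one_mul (n + 1)]
    omega

end Functions

section Levels

variable {K : Type} [Field K] [LinearOrder K] {w μ : K → ℕ} {P W q : ℕ} {c₀ : ℚ}

theorem runs_lowLevels (Q : Program) (env : List (Val K)) (n : ℕ) :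
    Runs w Q env (lowLevels n) (encLevels (List.replicate n false)) (2 * n + 1) := by
  induction n with
  | zero => exact Runs.nil
  | succ n ih => exact (Runs.pair .nil ih).mono (by omega)

theorem computes_levels (hμ : LengthBound w μ) (h1 : μ 1 ≤ W)
    (hκ : μ ((decayRate c₀ P : ℚ) : K) ≤ W) {t : K} (h : ℕ) (ht : μ t + h * (W + 1) ≤ q)
    (hlt : ((decayRate c₀ P : ℚ) : K) ^ h * t < 1)
    (hge : ∀ i < h, 1 ≤ ((decayRate c₀ P : ℚ) : K) ^ i * t) :
    Computes w P c₀ .levels (.num t) (encLevels (levelList P h))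
      ((h + 1) * (4 * W + 4 * q + 20) + 4 * P) := by
  induction h generalizing t with
  | zero =>
    rw [pow_zero, one_mul] at hlt
    exact (RunsNum.ifLt hμ ⟨.var rfl, le_rfl⟩ (.const 1 Rat.cast_one h1)
      (fun _ => runs_lowLevels _ _ _) (fun h => absurd hlt h)).mono (by omega)
  | succ h ih =>
    rw [add_mul, one_mul] at ht
    have hmul : RunsNum w μ (program P c₀) [.num t] (.arith .mul (.const (decayRate c₀ P)) (.var 0))
      _ _ _ := .mul hμ (.const _ rfl hκ) ⟨.var rfl, le_rfl⟩
    have hrest := ih (t := ((decayRate c₀ P : ℚ) : K) * t) (by have := hmul.2; omega)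
      (by rwa [← mul_assoc, ← pow_succ])
      fun i hi => by rw [← mul_assoc, ← pow_succ]; exact hge (i + 1) (by omega)
    have hone : ¬ t < 1 := by simpa using hge 0 (by omega)
    refine (RunsNum.ifLt hμ ⟨.var rfl, le_rfl⟩ (.const 1 Rat.cast_one h1) (fun h => absurd h hone)
      (fun _ => .pair (.pair .nil .nil) (hrest.call hmul.1))).mono ?_
    rw [Nat.add_one_mul (h + 1)]
    omega

theorem runsNum_scale (hμ : LengthBound w μ) {t : K} {r : ℕ} (ht : μ t ≤ r) (l : List (Val K))
    (hq : (l.length + 1) * (r + 1) ≤ q) :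
    RunsNum w μ (program P c₀) [.pair (.num t) (.ofList l)] scaleBody ((l.length + 1) * t)
      ((l.length + 1) * (r + 1)) ((l.length + 1) * (4 * q + 20)) := by
  induction l with
  | nil =>
    rw [List.length_nil, Nat.cast_zero, zero_add, one_mul]
    exact ⟨(Runs.ifNil_pos (.snd (.var rfl)) (.fst (.var rfl))).mono (by omega), by omega⟩
  | cons a l ih =>
    rw [List.length_cons, Nat.add_one_mul (l.length + 1)] at hq
    have hrest := ih (by omega)
    have hadd : RunsNum w μ (program P c₀) [.pair (.num t) (.ofList (a :: l))]
        (.arith .add (.fst (.var 0))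
          (Fn.scale.call (.pair (.fst (.var 0)) (.snd (.snd (.var 0)))))) _ _ _ :=
      .add hμ ⟨.fst (.var rfl), ht⟩ ⟨Computes.call (f := .scale) hrest.1
        (.pair (.fst (.var rfl)) (.snd (.snd (.var rfl)))), hrest.2⟩
    rw [List.length_cons, Nat.add_one_mul (l.length + 1), Nat.add_one_mul (l.length + 1),
      Nat.cast_add_one, add_one_mul (l.length + 1 : K), add_comm _ t]
    exact ⟨(Runs.ifNil_neg (.snd (.var rfl)) hadd.1).mono (by omega), hadd.2.trans (by omega)⟩

end Levels

/-! ## The main function -/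

theorem lookup_ofFn {n : ℕ} {β : Type*} (f : Fin n → β) (v : Fin n) :
    (List.ofFn fun u => (u, f u)).lookup v = some (f v) := by
  rw [List.ofFn_eq_map, List.lookup_graph f (List.mem_finRange v)]

section Input

variable {K : Type} [Field K]

/-- The number of a vertex in the input. -/
def vertexKey (K : Type) [Field K] {n : ℕ} (v : Fin n) : K := (v : ℕ)

/-- The association list of the quotients and parameters of the vertex functions. -/
def initialState (Ω : HolantInstance K) : List (Fin Ω.G.n × K × K) :=
  List.ofFn fun v => (v, vertexQuot (Ω.sig v), vertexParam (Ω.sig v))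

theorem encode_eq (Ω : HolantInstance K) (ε : K) :
    Ω.encode ε =
      .pair (.num ε) (.pair (encFuns Ω.sig) (encEdges (vertexKey K) (edgeList Ω))) := by
  rw [encEdges, edgeList, List.map_ofFn]
  rfl

/-- A bound for the error at the edges of a graph with `m` edges, in units of the error that the
relative error `ε` permits.  The levels have to reduce it below `1`. -/
def levelScale (P m : ℕ) (ε : K) : K := (m + 1) * ((4 * defaultError P : ℕ) * (1 + 1 / ε))

/-- All the numbers in the input and the constants of the program are of size at most `Y`, and
so are the numbers of vertices and edges and the lengths of the vertex functions. -/
structure InputBound (μ : K → ℕ) (P : ℕ) (c₀ : ℚ) (Ω : HolantInstance K) (ε : K) (Y : ℕ) :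
    Prop where
  zero_le : μ 0 ≤ Y
  one_le : μ 1 ≤ Y
  two_le : μ 2 ≤ Y
  cutoff_le : μ ((c₀⁻¹ : ℚ) : K) ≤ Y
  rate_le : μ ((decayRate c₀ P : ℚ) : K) ≤ Y
  factor_le : μ ((4 * defaultError P : ℕ) : K) ≤ Y
  eps_le : μ ε ≤ Y
  sig_le : ∀ v i, μ (Ω.sig v i) ≤ Y
  lam_le : ∀ e, μ (Ω.lam e) ≤ Y
  key_le : ∀ v : Fin Ω.G.n, μ (vertexKey K v) ≤ Y
  card_vertices_le : Ω.G.n ≤ Y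
  card_edges_le : Ω.G.m ≤ Y
  deg_lt : ∀ v, Ω.G.deg v < Y
  pos : 1 ≤ Y

/-- The conditions on an instance under which the program never divides by `0`. -/
structure IsAdmissible [LinearOrder K] (Ω : HolantInstance K) : Prop where
  lam_pos : ∀ e, 0 < Ω.lam e
  quot_nonneg : ∀ v, 0 ≤ vertexQuot (Ω.sig v)
  param_pos : ∀ v, 0 < vertexParam (Ω.sig v)
  sig_one_ne_zero : ∀ v, Ω.G.deg v ≠ 0 → Ω.sig v 1 ≠ 0

end Input

namespace InputBound

variable {K : Type} [Field K] [LinearOrder K] {w μ : K → ℕ} {P h Y : ℕ} {c₀ : ℚ}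
  {Ω : HolantInstance K} {ε : K}

theorem setting [IsStrictOrderedRing K] (hμ : LengthBound w μ) (hY : InputBound μ P c₀ Ω ε Y)
    (hc₀ : 0 ≤ c₀) (hΩ : IsAdmissible Ω) :
    Setting w μ (5 * Y) c₀ (vertexKey K) fun v => vertexParam (Ω.sig v) where
  bound := hμ
  injective _ _ h := Fin.ext (Nat.cast_injective h)
  key_le v := (hY.key_le v).trans (by omega)
  one_le := hY.one_le.trans (by omega)
  cutoff_nonneg := inv_nonneg.2 hc₀
  cutoff_le := hY.cutoff_le.trans (by omega)
  param_le v := (size_vertexParam_le hμ hY.two_le (hΩ.sig_one_ne_zero v) (hY.sig_le v)).trans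
    (by have := hY.pos; omega)
  param_pos := hΩ.param_pos

theorem stores (hμ : LengthBound w μ) (hY : InputBound μ P c₀ Ω ε Y) (hΩ : IsAdmissible Ω) :
    Stores μ (fun v => vertexParam (Ω.sig v)) (fun v => vertexQuot (Ω.sig v)) (3 * Y)
      (initialState Ω) where
  lookup_eq := lookup_ofFn fun v => (vertexQuot (Ω.sig v), vertexParam (Ω.sig v))
  nonneg := hΩ.quot_nonneg
  size_le v := (size_vertexQuot_le hμ hY.one_le (hΩ.sig_one_ne_zero v) (hY.sig_le v)).trans
    (by have := hY.pos; omega)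

theorem runsNum_topProd (hμ : LengthBound w μ) (hY : InputBound μ P c₀ Ω ε Y) :
    RunsNum w μ (program P c₀) [encFuns Ω.sig] topProdBody (topProd Ω) (3 * Y ^ 2)
      (100 * Y ^ 3) := by
  have hpos := hY.pos
  have hn := hY.card_vertices_le
  have hsize : Ω.G.n * (Y + 1) + Y ≤ 3 * Y ^ 2 := by nlinarith
  refine (FibonacciHolant.runsNum_topProd hμ hY.one_le Ω.sig hY.deg_lt hY.sig_le hsize).mono
    hsize ?_
  calc (Ω.G.n + 1) * (10 * Y + 2 * Y + 2 * (3 * Y ^ 2) + 20)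
      ≤ (2 * Y) * (38 * Y ^ 2) := by gcongr <;> nlinarith
    _ ≤ 100 * Y ^ 3 := by ring_nf; omega

theorem computes_init (hμ : LengthBound w μ) (hY : InputBound μ P c₀ Ω ε Y)
    (hΩ : IsAdmissible Ω) :
    Computes w P c₀ .init (.pair (.num 0) (encFuns Ω.sig))
      (encState (vertexKey K) (initialState Ω)) (300 * Y ^ 2) := by
  have hpos := hY.pos
  have hn := hY.card_vertices_le
  refine (FibonacciHolant.computes_init hμ hY.key_le hY.one_le Ω.sig hΩ.sig_one_ne_zero hY.sig_le
    id fun v => by rw [zero_add]; rfl).mono ?_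
  calc (Ω.G.n + 1) * (24 * Y + 90) ≤ (2 * Y) * (114 * Y) := by gcongr <;> omega
    _ ≤ 300 * Y ^ 2 := by ring_nf; omega

theorem runsNum_scale (hμ : LengthBound w μ) (hY : InputBound μ P c₀ Ω ε Y) {t : K}
    (ht : μ t ≤ 7 * Y) :
    RunsNum w μ (program P c₀) [.pair (.num t) (encEdges (vertexKey K) (edgeList Ω))] scaleBody
      ((Ω.G.m + 1) * t) (16 * Y ^ 2) (168 * Y ^ 3) := by
  have hpos := hY.pos
  have hm := hY.card_edges_le
  have hsize : (Ω.G.m + 1) * (7 * Y + 1) ≤ 16 * Y ^ 2 := by nlinarith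
  have hlen : ((edgeList Ω).map (encEdge (vertexKey K))).length = Ω.G.m := by simp [edgeList]
  have hscale := FibonacciHolant.runsNum_scale (P := P) (c₀ := c₀) (q := 16 * Y ^ 2) hμ ht
    ((edgeList Ω).map (encEdge (vertexKey K))) (by rwa [hlen])
  rw [hlen] at hscale
  refine hscale.mono hsize ?_
  calc (Ω.G.m + 1) * (4 * (16 * Y ^ 2) + 20) ≤ (2 * Y) * (84 * Y ^ 2) := by gcongr <;> nlinarith
    _ = 168 * Y ^ 3 := by ring

theorem computes_levels (hμ : LengthBound w μ) (hY : InputBound μ P c₀ Ω ε Y) {t : K}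
    (ht : μ t ≤ 16 * Y ^ 2) (hh : IsLeast {i | ((decayRate c₀ P : ℚ) : K) ^ i * t < 1} h)
    (hpow : 64 ^ (h + 2 * P) ≤ Y) :
    Computes w P c₀ .levels (.num t) (encLevels (levelList P h)) (100 * Y ^ 3) := by
  have hpos := hY.pos
  have hhP : h + 2 * P < Y := (Nat.lt_pow_self (by norm_num)).trans_le hpow
  refine (FibonacciHolant.computes_levels (q := 18 * Y ^ 2) hμ hY.one_le hY.rate_le h
    (by nlinarith) hh.1 fun i hi => not_lt.1 fun hi' => hi.not_ge (hh.2 hi')).mono ?_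
  have hY2 : Y ≤ Y ^ 2 := Nat.le_self_pow two_ne_zero Y
  calc (h + 1) * (4 * Y + 4 * (18 * Y ^ 2) + 20) + 4 * P
      ≤ Y * (96 * Y ^ 2) + 4 * Y ^ 3 := by
        gcongr
        · omega
        · omega
        · exact (by omega : P ≤ Y).trans (Nat.le_self_pow three_ne_zero Y)
    _ = 100 * Y ^ 3 := by ring

theorem runsNum_prod [IsStrictOrderedRing K] (hμ : LengthBound w μ)
    (hY : InputBound μ P c₀ Ω ε Y) (hc₀ : 0 ≤ c₀) (hΩ : IsAdmissible Ω)
    (hpow : 64 ^ (h + 2 * P) ≤ Y) :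
    RunsNum w μ (program P c₀)
      [encContext (vertexKey K) (levelList P h) (initialState Ω) (edgeList Ω)] prodBody
      (approxProd ((c₀⁻¹ : ℚ) : K) (fun v => vertexParam (Ω.sig v)) (levelList P h)
        (fun v => vertexQuot (Ω.sig v)) (edgeList Ω)) (140 * Y ^ 4) (1500000 * Y ^ 5) := by
  have hpos := hY.pos
  have hn := hY.card_vertices_le
  have hm := hY.card_edges_le
  have hpow' : 16 ^ (h + 2 * P) ≤ Y := (Nat.pow_le_pow_left (by norm_num) _).trans hpow
  have hlen : (levelList P h).length = h + 2 * P := length_levelList P h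
  have hstate : (initialState Ω).length = Ω.G.n := List.length_ofFn
  have hedges : (edgeList Ω).length = Ω.G.m := List.length_ofFn
  have hX : (initialState Ω).length + (edgeList Ω).length * (4 * (5 * Y) + 7) + 3 * Y +
      4 * (5 * Y + 1) ≤ 60 * Y ^ 2 := by
    rw [hstate, hedges]
    nlinarith
  have hq : (edgeList Ω).length * (2 * (16 ^ (levelList P h).length * (60 * Y ^ 2)) + 5 * Y + 3) +
      5 * Y ≤ 140 * Y ^ 4 := by
    rw [hedges, hlen]
    calc _ ≤ Y * (2 * (Y * (60 * Y ^ 2)) + 5 * Y ^ 3 + 3 * Y ^ 3) + 5 * Y ^ 4 := by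
          gcongr
          · exact Nat.le_self_pow three_ne_zero Y
          · exact Nat.le_mul_of_pos_right 3 (by positivity)
          · exact Nat.le_self_pow four_ne_zero Y
      _ ≤ 140 * Y ^ 4 := by ring_nf; omega
  refine (FibonacciHolant.runsNum_prod (hY.setting hμ hc₀ hΩ) (levelList P h) (hY.stores hμ hΩ)
    (forall_weight_edgeList (q := fun l => 0 < l ∧ μ l ≤ 5 * Y) fun e =>
      ⟨hΩ.lam_pos e, (hY.lam_le e).trans (by omega)⟩) hX hq).mono
    hq ?_
  rw [hedges, hlen]
  calc _ ≤ Y * (4000 * (Y * ((5 * Y + Y) * (60 * Y ^ 2))) + 2 * (140 * Y ^ 4)) + 10 * Y ^ 5 := by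
        gcongr
        exact Nat.le_mul_of_pos_right 10 (by positivity)
    _ ≤ 1500000 * Y ^ 5 := by ring_nf; omega

end InputBound

section Main

variable {K : Type} [Field K] [LinearOrder K] {w μ : K → ℕ} {P h Y : ℕ} {c₀ : ℚ}
  {Ω : HolantInstance K} {ε : K}

theorem runs_main_of_topProd_nonpos (hμ : LengthBound w μ) (hY : InputBound μ P c₀ Ω ε Y)
    (htop : ¬ 0 < topProd Ω) :
    Runs w (program P c₀) [Ω.encode ε] (.call 0 (.var 0)) (.num 0) (2000000 * Y ^ 5) := by
  have htopProd := hY.runsNum_topProd hμ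
  rw [encode_eq]
  have hmain : Computes w P c₀ .main (.pair (.num ε)
      (.pair (encFuns Ω.sig) (encEdges (vertexKey K) (edgeList Ω)))) (.num 0) _ :=
    Runs.letIn (Computes.call (f := .topProd) htopProd.1 (.fst (.snd (.var rfl))))
      (RunsNum.ifLt hμ (.const 0 Rat.cast_zero hY.zero_le) ⟨.var rfl, htopProd.2⟩
        (fun h => absurd h htop) fun _ => .const 0 Rat.cast_zero)
  refine (hmain.call (.var rfl)).mono ?_
  have hY₁ : Y ≤ Y ^ 5 := Nat.le_self_pow (by norm_num) Y
  have hY₂ : Y ^ 2 ≤ Y ^ 5 := Nat.pow_le_pow_right hY.pos (by norm_num)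
  have hY₃ : Y ^ 3 ≤ Y ^ 5 := Nat.pow_le_pow_right hY.pos (by norm_num)
  have := hY.pos
  omega

theorem runs_main_of_topProd_pos [IsStrictOrderedRing K] (hμ : LengthBound w μ)
    (hY : InputBound μ P c₀ Ω ε Y) (hc₀ : 0 ≤ c₀) (hΩ : IsAdmissible Ω) (hε : ε ≠ 0)
    (htop : 0 < topProd Ω)
    (hh : IsLeast {i | ((decayRate c₀ P : ℚ) : K) ^ i * levelScale P Ω.G.m ε < 1} h)
    (hpow : 64 ^ (h + 2 * P) ≤ Y) :
    Runs w (program P c₀) [Ω.encode ε] (.call 0 (.var 0))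
      (.num (approxZ ((c₀⁻¹ : ℚ) : K) P h Ω)) (2000000 * Y ^ 5) := by
  have htopProd := hY.runsNum_topProd hμ
  have hprod := hY.runsNum_prod hμ hc₀ hΩ hpow
  have hfactor : RunsNum w μ (program P c₀) [.num (topProd Ω), Ω.encode ε]
      (.arith .mul (.const (4 * defaultError P : ℕ)) (.arith .add (.const 1)
        (.arith .div (.const 1) (.fst (.var 1))))) _ _ _ :=
    .mul hμ (.const _ (Rat.cast_natCast _) hY.factor_le) (.add hμ (.const 1 Rat.cast_one hY.one_le)
      (.div hμ (.const 1 Rat.cast_one hY.one_le) ⟨.fst (.var rfl), hY.eps_le⟩ hε))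
  have hscale := hY.runsNum_scale hμ (hfactor.2.trans (by have := hY.pos; omega))
  have hlevels := hY.computes_levels hμ hscale.2 hh hpow
  rw [encode_eq] at hfactor ⊢
  have happrox : RunsNum w μ (program P c₀) [.num (topProd Ω), .pair (.num ε)
      (.pair (encFuns Ω.sig) (encEdges (vertexKey K) (edgeList Ω)))]
      (approxExpr (4 * defaultError P)) _ _ _ :=
    .mul hμ ⟨.var rfl, htopProd.2⟩ ⟨Computes.call (f := .prod) hprod.1
      (.pair (hlevels.call (Computes.call (f := .scale) hscale.1
        (.pair hfactor.1 (.snd (.snd (.var rfl))))))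
        (.pair ((hY.computes_init hμ hΩ).call (.pair (.const 0 Rat.cast_zero)
          (.fst (.snd (.var rfl))))) (.snd (.snd (.var rfl))))), hprod.2⟩
  have hmain : Computes w P c₀ .main (.pair (.num ε)
      (.pair (encFuns Ω.sig) (encEdges (vertexKey K) (edgeList Ω)))) _ _ :=
    Runs.letIn (Computes.call (f := .topProd) htopProd.1 (.fst (.snd (.var rfl))))
      (RunsNum.ifLt hμ (.const 0 Rat.cast_zero hY.zero_le) ⟨.var rfl, htopProd.2⟩
        (fun _ => happrox.1) fun h => absurd htop h)
  refine (hmain.call (.var rfl)).mono ?_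
  have hY₁ : Y ≤ Y ^ 5 := Nat.le_self_pow (by norm_num) Y
  have hY₂ : Y ^ 2 ≤ Y ^ 5 := Nat.pow_le_pow_right hY.pos (by norm_num)
  have hY₃ : Y ^ 3 ≤ Y ^ 5 := Nat.pow_le_pow_right hY.pos (by norm_num)
  have hY₄ : Y ^ 4 ≤ Y ^ 5 := Nat.pow_le_pow_right hY.pos (by norm_num)
  have := hY.pos
  omega

end Main

/-! ## Lengths of rational numbers -/

section RatSize

/-- The larger of the numbers of binary digits of the numerator and the denominator.  Unlike
`ratLength`, it is subadditive, up to one digit, under addition as well as multiplication. -/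
def ratSize (q : ℚ) : ℕ := max q.num.natAbs.size q.den.size

theorem natAbs_num_lt_two_pow_ratSize (q : ℚ) : q.num.natAbs < 2 ^ ratSize q :=
  Nat.size_le.1 (le_max_left _ _)

theorem den_lt_two_pow_ratSize (q : ℚ) : q.den < 2 ^ ratSize q :=
  Nat.size_le.1 (le_max_right _ _)

theorem ratSize_divInt_le {n d : ℤ} {k : ℕ} (hd : d ≠ 0) (hn : n.natAbs < 2 ^ k)
    (hdk : d.natAbs < 2 ^ k) : ratSize (Rat.divInt n d) ≤ k := by
  refine max_le (Nat.size_le.2 ?_) (Nat.size_le.2 ?_)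
  · rcases eq_or_ne n 0 with rfl | hn₀
    · simp
    · exact (Nat.le_of_dvd (Int.natAbs_pos.2 hn₀)
        (Int.natAbs_dvd_natAbs.2 (Rat.num_dvd n hd))).trans_lt hn
  · exact (Nat.le_of_dvd (Int.natAbs_pos.2 hd) (Int.natCast_dvd.1 (Rat.den_dvd n d))).trans_lt hdk

theorem natAbs_mul_lt_two_pow {a b : ℤ} {j k : ℕ} (ha : a.natAbs < 2 ^ j) (hb : b.natAbs < 2 ^ k) :
    (a * b).natAbs < 2 ^ (j + k) := by
  rw [Int.natAbs_mul, pow_add]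
  exact Nat.mul_lt_mul'' ha hb

theorem ratSize_add_le (x y : ℚ) : ratSize (x + y) ≤ ratSize x + ratSize y + 1 := by
  have hxy := natAbs_mul_lt_two_pow (b := y.den) (natAbs_num_lt_two_pow_ratSize x)
    (den_lt_two_pow_ratSize y)
  have hyx := natAbs_mul_lt_two_pow (a := x.den) (den_lt_two_pow_ratSize x)
    (natAbs_num_lt_two_pow_ratSize y)
  have hden := natAbs_mul_lt_two_pow (a := x.den) (b := y.den) (den_lt_two_pow_ratSize x)
    (den_lt_two_pow_ratSize y)
  have hnum := Int.natAbs_add_le (x.num * y.den) (x.den * y.num)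
  rw [Rat.add_num_den]
  refine ratSize_divInt_le (by simp) ?_ ?_
  · rw [pow_succ]
    omega
  · rw [pow_succ]
    omega

theorem ratSize_neg (x : ℚ) : ratSize (-x) = ratSize x := by
  rw [ratSize, ratSize, Rat.neg_num, Rat.neg_den, Int.natAbs_neg]

theorem ratSize_mul_le (x y : ℚ) : ratSize (x * y) ≤ ratSize x + ratSize y := by
  rw [Rat.mul_def', Rat.mkRat_eq_divInt, Nat.cast_mul]
  exact ratSize_divInt_le (by simp)
    (natAbs_mul_lt_two_pow (natAbs_num_lt_two_pow_ratSize x) (natAbs_num_lt_two_pow_ratSize y))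
    (natAbs_mul_lt_two_pow (a := x.den) (b := y.den) (den_lt_two_pow_ratSize x)
      (den_lt_two_pow_ratSize y))

theorem ratSize_inv_le {x : ℚ} (hx : x ≠ 0) : ratSize x⁻¹ ≤ ratSize x := by
  rw [Rat.inv_def]
  exact ratSize_divInt_le (Rat.num_ne_zero.2 hx) (den_lt_two_pow_ratSize x)
    (natAbs_num_lt_two_pow_ratSize x)

theorem lengthBound_ratLength : LengthBound ratLength ratSize where
  length_le x := by
    rw [two_mul]
    exact add_le_add (le_max_left _ _) (le_max_right _ _)
  le_length x := max_le (Nat.le_add_right _ _) (Nat.le_add_left _ _)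
  result_le {o x y z} h := by
    cases o with
    | add => exact h ▸ ratSize_add_le x y
    | sub =>
      obtain rfl : z = x - y := h
      rw [sub_eq_add_neg, ← ratSize_neg y]
      exact ratSize_add_le x (-y)
    | mul => exact h ▸ (ratSize_mul_le x y).trans (Nat.le_succ _)
    | div =>
      obtain ⟨hy, rfl⟩ := h
      rw [div_eq_mul_inv]
      have := ratSize_mul_le x y⁻¹
      have := ratSize_inv_le hy
      omega

theorem lengthBound_zero {K : Type} [Field K] :
    LengthBound (fun _ : K => 0) (fun _ : K => 0) := by
  constructor <;> simp

end RatSize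

/-! ## The size of the input -/

section InputSize

variable {K : Type}

theorem length_lt_size_ofList (w : K → ℕ) (l : List (Val K)) :
    l.length < (Val.ofList l).size w := by
  induction l with
  | nil => exact Nat.one_pos
  | cons a l ih => simp only [Val.ofList, Val.size, List.length_cons]; omega

theorem size_lt_size_ofList (w : K → ℕ) {a : Val K} {l : List (Val K)} (h : a ∈ l) :
    a.size w < (Val.ofList l).size w := by
  induction l with
  | nil => cases h
  | cons b l ih =>
    simp only [Val.ofList, Val.size]
    rcases List.mem_cons.1 h with rfl | h
    · omega
    · have := ih h
      omega

variable [Field K] (w : K → ℕ) (Ω : HolantInstance K) (ε : K)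

theorem size_encFuns_lt_size_encode : (encFuns Ω.sig).size w < (Ω.encode ε).size w := by
  simp only [encode_eq, Val.size]
  omega

theorem size_encEdges_lt_size_encode :
    (encEdges (vertexKey K) (edgeList Ω)).size w < (Ω.encode ε).size w := by
  simp only [encode_eq, Val.size]
  omega

theorem length_eps_lt_size_encode : w ε < (Ω.encode ε).size w := by
  simp only [encode_eq, Val.size]
  omega

theorem card_edges_lt_size_encode : Ω.G.m < (Ω.encode ε).size w := by
  have hlen := length_lt_size_ofList w ((edgeList Ω).map (encEdge (vertexKey K)))
  rw [List.length_map, edgeList, List.length_ofFn] at hlen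
  exact hlen.trans (size_encEdges_lt_size_encode w Ω ε)

theorem length_lam_lt_size_encode (e : Fin Ω.G.m) : w (Ω.lam e) < (Ω.encode ε).size w := by
  have hmem : encEdge (vertexKey K) (Ω.G.src e, Ω.G.tgt e, Ω.lam e) ∈
      (edgeList Ω).map (encEdge (vertexKey K)) :=
    List.mem_map_of_mem (List.mem_ofFn.2 ⟨e, rfl⟩)
  have hedge := size_lt_size_ofList w hmem
  have hedges := size_encEdges_lt_size_encode w Ω ε
  simp only [encEdge, encEdges, Val.size] at hedge hedges
  omega

theorem card_vertices_lt_size_encode : Ω.G.n < (Ω.encode ε).size w := by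
  have hlen := length_lt_size_ofList w (List.ofFn fun v => encFun (Ω.sig v))
  rw [List.length_ofFn] at hlen
  exact hlen.trans (size_encFuns_lt_size_encode w Ω ε)

theorem size_encFun_lt_size_encode (v : Fin Ω.G.n) :
    (encFun (Ω.sig v)).size w < (Ω.encode ε).size w :=
  (size_lt_size_ofList w (List.mem_ofFn.2 ⟨v, rfl⟩)).trans (size_encFuns_lt_size_encode w Ω ε)

theorem deg_add_one_lt_size_encode (v : Fin Ω.G.n) : Ω.G.deg v + 1 < (Ω.encode ε).size w := by
  have hlen := length_lt_size_ofList w (List.ofFn fun i => (.num (Ω.sig v i) : Val K))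
  rw [List.length_ofFn] at hlen
  exact hlen.trans (size_encFun_lt_size_encode w Ω ε v)

theorem length_sig_lt_size_encode (v : Fin Ω.G.n) (i : Fin (Ω.G.deg v + 1)) :
    w (Ω.sig v i) < (Ω.encode ε).size w :=
  (Nat.lt_succ_self _).trans <|
    (size_lt_size_ofList w (a := .num (Ω.sig v i)) (List.mem_ofFn.2 ⟨i, rfl⟩)).trans
      (size_encFun_lt_size_encode w Ω ε v)

variable {w Ω ε} {μ : K → ℕ} {P Y : ℕ} {c₀ : ℚ}

theorem LengthBound.natCast_le (hμ : LengthBound w μ) (i : ℕ) :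
    μ (i : K) ≤ μ 0 + i * (μ 1 + 1) := by
  induction i with
  | zero => simp
  | succ i ih =>
    have hadd : μ ((i : K) + 1) ≤ μ (i : K) + μ 1 + 1 := hμ.result_le (o := .add) rfl
    rw [Nat.cast_succ, Nat.add_one_mul i]
    omega

/-- A bound for the sizes of the constants of the program. -/
def constSize (μ : K → ℕ) (P : ℕ) (c₀ : ℚ) : ℕ :=
  μ 0 + μ 1 + μ 2 + μ ((c₀⁻¹ : ℚ) : K) + μ ((decayRate c₀ P : ℚ) : K) +
    μ ((4 * defaultError P : ℕ) : K) + 1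

theorem InputBound.of_constSize_le (hμ : LengthBound w μ)
    (hY : constSize μ P c₀ * ((Ω.encode ε).size w + 1) ≤ Y) : InputBound μ P c₀ Ω ε Y := by
  set N := (Ω.encode ε).size w
  have hconst : constSize μ P c₀ ≤ Y := (Nat.le_mul_of_pos_right _ N.succ_pos).trans hY
  have hN : N < Y := (Nat.le_mul_of_pos_left (N + 1) (Nat.succ_pos _)).trans hY
  have hcast : ∀ i ≤ N, μ (i : K) ≤ Y := fun i hi => by
    have hzero : μ 0 ≤ constSize μ P c₀ := by unfold constSize; omega
    have hone : μ 1 + 1 ≤ constSize μ P c₀ := by unfold constSize; omega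
    calc μ (i : K) ≤ μ 0 + i * (μ 1 + 1) := hμ.natCast_le i
      _ ≤ constSize μ P c₀ + N * constSize μ P c₀ := by gcongr
      _ = constSize μ P c₀ * (N + 1) := by ring
      _ ≤ Y := hY
  have hcard := card_vertices_lt_size_encode w Ω ε
  unfold constSize at hconst
  exact
    { zero_le := by omega
      one_le := by omega
      two_le := by omega
      cutoff_le := by omega
      rate_le := by omega
      factor_le := by omega
      eps_le := (hμ.le_length ε).trans ((length_eps_lt_size_encode w Ω ε).trans hN).le
      sig_le := fun v i =>
        (hμ.le_length _).trans ((length_sig_lt_size_encode w Ω ε v i).trans hN).le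
      lam_le := fun e => (hμ.le_length _).trans ((length_lam_lt_size_encode w Ω ε e).trans hN).le
      key_le := fun v => hcast v (v.2.trans hcard).le
      card_vertices_le := (hcard.trans hN).le
      card_edges_le := ((card_edges_lt_size_encode w Ω ε).trans hN).le
      deg_lt := fun v => (Nat.lt_succ_self _).trans
        ((deg_add_one_lt_size_encode w Ω ε v).trans hN)
      pos := by omega }

end InputSize

/-! ## The number of levels -/

section Levels

theorem exists_isLeast_pow_mul_lt_one {κ T : ℝ} (hκ : 1 / 2 ≤ κ) (hκ₁ : κ < 1) (hT : 1 ≤ T) :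
    ∃ h : ℕ, IsLeast {i : ℕ | κ ^ i * T < 1} h ∧ 1 ≤ κ ^ h * (2 * T) := by
  have hex : ∃ h : ℕ, κ ^ h * T < 1 := by
    obtain ⟨h, hh⟩ := exists_pow_lt_of_lt_one (show 0 < 1 / T by positivity) hκ₁
    exact ⟨h, by rwa [lt_div_iff₀ (by positivity)] at hh⟩
  classical
  refine ⟨Nat.find hex, ⟨Nat.find_spec hex, fun i hi => Nat.find_min' hex hi⟩, ?_⟩
  cases hfind : Nat.find hex with
  | zero => linarith
  | succ h =>
    have hprev : 1 ≤ κ ^ h * T := not_lt.1 (Nat.find_min hex (by omega))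
    calc 1 ≤ κ ^ h * T := hprev
      _ = 1 / 2 * (κ ^ h * (2 * T)) := by ring
      _ ≤ κ * (κ ^ h * (2 * T)) := by gcongr
      _ = κ ^ (h + 1) * (2 * T) := by ring

theorem pow_le_pow_of_one_le_pow_mul {b κ S : ℝ} {h j : ℕ} (hb : 0 ≤ b) (hκ : 0 ≤ κ)
    (hS : 0 ≤ S) (hbκ : b * κ ^ j ≤ 1) (hh : 1 ≤ κ ^ h * S) : b ^ h ≤ S ^ j :=
  calc b ^ h = b ^ h * 1 := (mul_one _).symm
    _ ≤ b ^ h * (κ ^ h * S) ^ j := by gcongr; exact one_le_pow₀ hh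
    _ = (b * κ ^ j) ^ h * S ^ j := by ring
    _ ≤ 1 * S ^ j := by gcongr; exact pow_le_one₀ (by positivity) hbκ
    _ = S ^ j := one_mul _

variable {P m : ℕ} {ε : ℝ}

theorem one_le_levelScale (hP : 1 ≤ P) (hε : 0 < ε) : 1 ≤ levelScale P m ε := by
  have hk : 1 ≤ 4 * defaultError P := by unfold defaultError; nlinarith
  have hε' : 0 ≤ 1 / ε := by positivity
  exact one_le_mul_of_one_le_of_one_le (by simp)
    (one_le_mul_of_one_le_of_one_le (by exact_mod_cast hk) (by linarith))

theorem levelScale_le {S : ℝ} (hε : 0 < ε) (hm : m + 1 ≤ S) (hS : 1 + 1 / ε ≤ S) :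
    levelScale P m ε ≤ (4 * defaultError P : ℕ) * S ^ 2 :=
  calc levelScale P m ε ≤ S * ((4 * defaultError P : ℕ) * S) := by
        have : 0 ≤ S := hm.trans' (by positivity)
        unfold levelScale
        gcongr
    _ = (4 * defaultError P : ℕ) * S ^ 2 := by ring

theorem exists_isLeast_pow_mul_levelScale_lt_one {b κ S : ℝ} {j : ℕ} (hb : 0 ≤ b)
    (hκ : 1 / 2 ≤ κ) (hκ₁ : κ < 1) (hbκ : b * κ ^ j ≤ 1) (hP : 1 ≤ P) (hε : 0 < ε)
    (hm : m + 1 ≤ S) (hS : 1 + 1 / ε ≤ S) :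
    ∃ h : ℕ, IsLeast {i : ℕ | κ ^ i * levelScale P m ε < 1} h ∧
      b ^ h ≤ (2 * (4 * defaultError P : ℕ) * S ^ 2) ^ j := by
  have hscale := one_le_levelScale (m := m) hP hε
  obtain ⟨h, hh, hone⟩ := exists_isLeast_pow_mul_lt_one hκ hκ₁ hscale
  refine ⟨h, hh, (pow_le_pow_of_one_le_pow_mul hb (by linarith) (by linarith) hbκ hone).trans ?_⟩
  rw [mul_assoc]
  gcongr
  exact levelScale_le hε hm hS

theorem edgeError_le_of_mul_levelScale_lt_one {κ : ℝ} (hκ : 0 ≤ κ) (hε : 0 < ε)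
    (h : κ * levelScale P m ε < 1) :
    m * (2 * (κ * defaultError P)) ≤ ε / (2 * (1 + ε)) := by
  have hscale : κ * levelScale P m ε * ε = 4 * κ * defaultError P * (m + 1) * (1 + ε) := by
    unfold levelScale
    push_cast
    field_simp
    ring
  rw [le_div_iff₀ (by positivity)]
  calc m * (2 * (κ * defaultError P)) * (2 * (1 + ε))
      ≤ 4 * κ * defaultError P * (m + 1) * (1 + ε) := by
        have : 0 ≤ 4 * κ * defaultError P * (1 + ε) := by positivity
        linarith
    _ ≤ 1 * ε := hscale ▸ by gcongr
    _ = ε := one_mul ε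

theorem exists_mul_pow_le_one {b κ : ℝ} (hb : 0 < b) (hκ : κ < 1) : ∃ j : ℕ, b * κ ^ j ≤ 1 := by
  obtain ⟨j, hj⟩ := exists_pow_lt_of_lt_one (one_div_pos.2 hb) hκ
  exact ⟨j, (le_div_iff₀' hb).1 hj.le⟩

theorem mul_pow_add_le {D N a b S B : ℝ} {h j r : ℕ} (hD : 0 ≤ D) (hb : 0 ≤ b)
    (haS : 0 ≤ a * S) (hN : N ≤ a * S)
    (hpow : b ^ h ≤ (B * S ^ 2) ^ j) :
    D * N * b ^ (h + r) ≤ D * a * b ^ r * B ^ j * S ^ (2 * j + 1) :=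
  calc D * N * b ^ (h + r) = D * N * b ^ r * b ^ h := by ring
    _ ≤ D * (a * S) * b ^ r * (B * S ^ 2) ^ j := by gcongr
    _ = D * a * b ^ r * B ^ j * S ^ (2 * j + 1) := by ring

end Levels

/-! ## The approximation scheme -/

section Transfer

variable {K L : Type} [Field K] [Field L] {φ : K →+* L}

theorem map_decayRate_cast [CharZero L] (φ : K →+* L) (c₀ : ℚ) (P : ℕ) :
    φ ((decayRate c₀ P : ℚ) : K) = decayRate (c₀ : L) P := by
  rw [map_ratCast, decayRate, decayRate]
  push_cast
  rfl

theorem map_levelScale (φ : K →+* L) (P m : ℕ) (ε : K) :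
    φ (levelScale P m ε) = levelScale P m (φ ε) := by
  simp only [levelScale, map_mul, map_add, map_div₀, map_natCast, map_one]

theorem IsAdmissible.of_map [LinearOrder K] [LinearOrder L] {Ω : HolantInstance K}
    (hφ : StrictMono φ) (h : IsAdmissible (Ω.map φ)) : IsAdmissible Ω where
  lam_pos e := hφ.lt_iff_lt.1 ((map_zero φ).trans_lt (h.lam_pos e))
  quot_nonneg v := hφ.le_iff_le.1 <|
    (map_zero φ).trans_le ((h.quot_nonneg v).trans_eq (vertexQuot_map φ (Ω.sig v)))
  param_pos v := hφ.lt_iff_lt.1 <|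
    (map_zero φ).trans_lt ((h.param_pos v).trans_eq (vertexParam_map φ (Ω.sig v)))
  sig_one_ne_zero v hd hzero := h.sig_one_ne_zero v hd ((congrArg φ hzero).trans (map_zero φ))

end Transfer

theorem IsAdmissible.of_isInputOf {Ω : HolantInstance ℝ} {c₀ p : ℝ} (hc₀ : 0 < c₀)
    (hc₀₂ : c₀ ≤ 2) (hp : 0 < p) (hΩ : Ω.IsInputOf (fibonacciFamilyFrom c₀ p) (Set.Ici 1))
    (h : topProd Ω ≠ 0) : IsAdmissible Ω where
  lam_pos e := one_pos.trans_le (hΩ.2 e)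
  quot_nonneg v := by
    have hlast := Finset.prod_ne_zero_iff.1 h v (Finset.mem_univ v)
    obtain ⟨hfst, hsnd⟩ := firstTwo_nonneg_pos hp (hΩ.1 v) hlast
    exact firstTwo_fst_div_snd hlast ▸ div_nonneg hfst hsnd.le
  param_pos v := hc₀.trans_le
    (le_vertexParam_and_isFibonacci hc₀₂ hp (hΩ.1 v)
      (Finset.prod_ne_zero_iff.1 h v (Finset.mem_univ v))).1
  sig_one_ne_zero v hd := by
    have hlast := Finset.prod_ne_zero_iff.1 h v (Finset.mem_univ v)
    have hmem := hΩ.1 v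
    generalize Ω.G.deg v = d, Ω.sig v = f at hd hlast hmem
    cases d with
    | zero => exact absurd rfl hd
    | succ d => exact (second_pos hp hmem hlast).ne'

section Scheme

variable {K : Type} [Field K] [LinearOrder K] {w μ : K → ℕ} {c₀ : ℚ}
  {p : ℝ} {P h Y : ℕ} {φ : K →+* ℝ} {Ω : HolantInstance K} {ε : K}

theorem exists_runs_main_relApprox_of_topProd_nonpos (hφ : StrictMono φ) (hμ : LengthBound w μ)
    (hp : 0 < p) (hΩ : (Ω.map φ).IsInputOf (fibonacciFamilyFrom c₀ p) (Set.Ici 1))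
    (hY : InputBound μ P c₀ Ω ε Y) (htop : ¬ 0 < topProd Ω) :
    ∃ z, Runs w (program P c₀) [Ω.encode ε] (.call 0 (.var 0)) (.num z) (2000000 * Y ^ 5) ∧
      RelApprox (φ ε) (Ω.map φ).Z (φ z) := by
  have htop₀ : topProd (Ω.map φ) = 0 := by
    refine le_antisymm ?_
      (Finset.prod_nonneg fun v _ => nonneg_of_mem_fibonacciFamilyFrom (hΩ.1 v) _)
    rw [topProd_map, ← map_zero φ]
    exact hφ.monotone (not_lt.1 htop)
  exact ⟨0, runs_main_of_topProd_nonpos hμ hY htop, fun _ => map_zero φ,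
    fun hZ => absurd (Z_eq_zero_of_topProd_eq_zero hp hΩ htop₀) hZ⟩

variable [IsStrictOrderedRing K]

theorem exists_runs_main_relApprox_of_topProd_pos (hφ : StrictMono φ) (hμ : LengthBound w μ)
    (hc₀ : 1 < c₀) (hc₀₂ : c₀ ≤ 2) (hp : 0 < p) (hP : 1 ≤ P) (hpP : p⁻¹ ≤ P)
    (hΩ : (Ω.map φ).IsInputOf (fibonacciFamilyFrom c₀ p) (Set.Ici 1)) (hε : 0 < ε)
    (hY : InputBound μ P c₀ Ω ε Y) (htop : 0 < topProd Ω)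
    (hh : IsLeast {i | decayRate (c₀ : ℝ) P ^ i * levelScale P Ω.G.m (φ ε) < 1} h)
    (hpow : 64 ^ (h + 2 * P) ≤ Y) :
    ∃ z, Runs w (program P c₀) [Ω.encode ε] (.call 0 (.var 0)) (.num z) (2000000 * Y ^ 5) ∧
      RelApprox (φ ε) (Ω.map φ).Z (φ z) := by
  have hc₀' : (1 : ℝ) < c₀ := by exact_mod_cast hc₀
  have hc₀₂' : (c₀ : ℝ) ≤ 2 := by exact_mod_cast hc₀₂
  have hP' : (1 : ℝ) ≤ P := by exact_mod_cast hP
  have hε' : 0 < φ ε := (map_zero φ).symm.trans_lt (hφ hε)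
  have htop' : topProd (Ω.map φ) ≠ 0 := by
    rw [topProd_map]
    exact (map_ne_zero φ).2 htop.ne'
  have hadm : IsAdmissible Ω :=
    .of_map hφ (.of_isInputOf (one_pos.trans hc₀') hc₀₂' hp hΩ htop')
  have hh' : IsLeast {i | ((decayRate c₀ P : ℚ) : K) ^ i * levelScale P Ω.G.m ε < 1} h := by
    convert hh using 4 with i
    rw [← hφ.lt_iff_lt, map_mul, map_pow, map_decayRate_cast, map_levelScale, map_one]
  have hclose := logClose_approxZ hc₀' hc₀₂' hp hP hpP hΩ htop' h
  rw [show (c₀ : ℝ)⁻¹ = φ ((c₀⁻¹ : ℚ) : K) by simp, approxZ_map hφ] at hclose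
  refine ⟨_, runs_main_of_topProd_pos hμ hY (one_pos.trans hc₀).le hadm hε.ne' htop hh' hpow,
    relApprox_of_logClose hε' ?_ (Z_nonneg hΩ) hclose⟩
  have hrate := le_decayRate hc₀₂' hP'
  exact edgeError_le_of_mul_levelScale_lt_one (pow_nonneg (by linarith) h) hε' hh.1

theorem exists_runs_main_relApprox (hφ : StrictMono φ) (hμ : LengthBound w μ)
    (hc₀ : 1 < c₀) (hc₀₂ : c₀ ≤ 2) (hp : 0 < p) (hP : 1 ≤ P) (hpP : p⁻¹ ≤ P)
    (hΩ : (Ω.map φ).IsInputOf (fibonacciFamilyFrom c₀ p) (Set.Ici 1)) (hε : 0 < ε)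
    (hh : IsLeast {i | decayRate (c₀ : ℝ) P ^ i * levelScale P Ω.G.m (φ ε) < 1} h)
    (hY : constSize μ P c₀ * ((Ω.encode ε).size w + 1) * 64 ^ (h + 2 * P) ≤ Y) :
    ∃ z, Runs w (program P c₀) [Ω.encode ε] (.call 0 (.var 0)) (.num z) (2000000 * Y ^ 5) ∧
      RelApprox (φ ε) (Ω.map φ).Z (φ z) := by
  have hinput : InputBound μ P c₀ Ω ε Y :=
    .of_constSize_le hμ ((Nat.le_mul_of_pos_right _ (by positivity)).trans hY)
  by_cases htop : 0 < topProd Ω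
  · have hconst : 0 < constSize μ P c₀ * ((Ω.encode ε).size w + 1) :=
      Nat.mul_pos (Nat.succ_pos _) (Nat.succ_pos _)
    exact exists_runs_main_relApprox_of_topProd_pos hφ hμ hc₀ hc₀₂ hp hP hpP hΩ hε hinput htop hh
      ((Nat.le_mul_of_pos_left _ hconst).trans hY)
  · exact exists_runs_main_relApprox_of_topProd_nonpos hφ hμ hp hΩ hinput htop

theorem isFPTAS_program [Algebra K ℝ] (hφ : StrictMono (algebraMap K ℝ)) (hμ : LengthBound w μ)
    (hc₀ : 1 < c₀) (hc₀₂ : c₀ ≤ 2) (hp : 0 < p) (hP : 1 ≤ P) (hpP : p⁻¹ ≤ P) :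
    IsFPTAS K w (program P c₀) (fibonacciFamilyFrom c₀ p) (Set.Ici 1) := by
  have hP' : (1 : ℝ) ≤ P := by exact_mod_cast hP
  have hrate : 11 / 12 ≤ decayRate (c₀ : ℝ) P := le_decayRate (by exact_mod_cast hc₀₂) hP'
  have hrate₁ : decayRate (c₀ : ℝ) P < 1 := decayRate_lt_one (by exact_mod_cast hc₀) (by positivity)
  obtain ⟨j, hj⟩ := exists_mul_pow_le_one (show (0 : ℝ) < 64 by norm_num) hrate₁
  set A : ℝ := constSize μ P c₀ * 2 * 64 ^ (2 * P) * (2 * (4 * defaultError P : ℕ)) ^ j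
  refine ⟨2000000 * A ^ 5, (2 * j + 1) * 5, fun Ω hΩ ε hε => ?_⟩
  set N := (Ω.encode ε).size w
  have hε' : 0 < algebraMap K ℝ ε := (map_zero _).symm.trans_lt (hφ hε)
  set S : ℝ := N + 1 / algebraMap K ℝ ε
  have hdiv : 0 < 1 / algebraMap K ℝ ε := one_div_pos.2 hε'
  have hm : (Ω.G.m : ℝ) + 1 ≤ N := by exact_mod_cast card_edges_lt_size_encode w Ω ε
  have hone : (1 : ℝ) ≤ N := hm.trans' (by simp)
  obtain ⟨h, hh, hpow⟩ := exists_isLeast_pow_mul_levelScale_lt_one (m := Ω.G.m) (S := S)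
    (show (0 : ℝ) ≤ 64 by norm_num) (by linarith) hrate₁ hj hP hε' (by linarith) (by linarith)
  have hY : ((constSize μ P c₀ * (N + 1) * 64 ^ (h + 2 * P) : ℕ) : ℝ) ≤ A * S ^ (2 * j + 1) := by
    push_cast
    exact mul_pow_add_le (Nat.cast_nonneg _) (by norm_num) (by linarith)
      (by linarith [hone]) hpow
  obtain ⟨z, ⟨t, ht, heval⟩, happrox⟩ :=
    exists_runs_main_relApprox hφ hμ hc₀ hc₀₂ hp hP hpP hΩ hε hh le_rfl
  refine ⟨z, t, heval, happrox, ?_⟩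
  calc (t : ℝ) ≤ ((2000000 * (constSize μ P c₀ * (N + 1) * 64 ^ (h + 2 * P)) ^ 5 : ℕ) : ℝ) := by
        exact_mod_cast ht
    _ = 2000000 * ((constSize μ P c₀ * (N + 1) * 64 ^ (h + 2 * P) : ℕ) : ℝ) ^ 5 := by
        push_cast; ring
    _ ≤ 2000000 * (A * S ^ (2 * j + 1)) ^ 5 := by gcongr
    _ = 2000000 * A ^ 5 * S ^ ((2 * j + 1) * 5) := by ring

end Scheme

section Mono

variable {𝓕 𝓕' : Set (SymFun ℝ)} {Λ : Set ℝ}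

theorem isFPTAS_mono {K : Type} [Field K] [LinearOrder K] [Algebra K ℝ] {w : K → ℕ} {P : Program}
    (h𝓕 : 𝓕 ⊆ 𝓕') (h : IsFPTAS K w P 𝓕' Λ) : IsFPTAS K w P 𝓕 Λ := by
  obtain ⟨C, k, hP⟩ := h
  exact ⟨C, k, fun Ω hΩ => hP Ω ⟨fun v => h𝓕 (hΩ.1 v), hΩ.2⟩⟩

theorem hasFPTAS_mono (h𝓕 : 𝓕 ⊆ 𝓕') (h : HasFPTAS 𝓕' Λ) : HasFPTAS 𝓕 Λ := by
  obtain ⟨P, hreal, hrat⟩ := h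
  exact ⟨P, isFPTAS_mono h𝓕 hreal, isFPTAS_mono h𝓕 hrat⟩

end Mono

theorem hasFPTAS_fibonacciFamilyFrom_rat {c₀ : ℚ} (hc₀ : 1 < c₀) (hc₀₂ : c₀ ≤ 2) {p : ℝ}
    (hp : 0 < p) : HasFPTAS (fibonacciFamilyFrom c₀ p) (Set.Ici 1) := by
  obtain ⟨P, hpP⟩ := exists_nat_ge (max 1 p⁻¹)
  have hP : 1 ≤ P := by exact_mod_cast (le_max_left _ _).trans hpP
  replace hpP := (le_max_right _ _).trans hpP
  exact ⟨program P c₀, isFPTAS_program strictMono_id lengthBound_zero hc₀ hc₀₂ hp hP hpP,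
    isFPTAS_program Rat.cast_strictMono lengthBound_ratLength hc₀ hc₀₂ hp hP hpP⟩

end FibonacciHolant

theorem theorem2_general (c₀ p : ℝ) (hc₀ : 1 < c₀) (hp : 0 < p) :
    HasFPTAS (fibonacciFamilyFrom c₀ p) (Set.Ici 1) := by
  obtain ⟨q, hq, hqc⟩ := exists_rat_btwn (lt_min hc₀ one_lt_two)
  have hq₁ : 1 < q := by exact_mod_cast hq
  have hq₂ : q ≤ 2 := by exact_mod_cast (hqc.trans_le (min_le_right _ _)).le
  exact FibonacciHolant.hasFPTAS_mono
    (FibonacciHolant.fibonacciFamilyFrom_anti (hqc.trans_le (min_le_left _ _)).le)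
    (FibonacciHolant.hasFPTAS_fibonacciFamilyFrom_rat hq₁ hq₂ hp)

theorem theorem2 (p : ℝ) (hp : 0 < p) :
    HasFPTAS (fibonacciFamilyFrom 1.17 p) (Set.Ici 1) :=
  theorem2_general 1.17 p (by norm_num) hp
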